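/- Let $N\ge 1$ and $0<\alpha<1$. Fix $\zeta\in C_c^\infty([0,\infty))$ with $0\le\zeta\le1$, $\zeta=1$ on $[0,\tfrac32]$ and $\operatorname{supp}\zeta\subset[0,\tfrac53)$, and put $\phi_{(0)}(\xi)=\zeta(|\xi|)$, $\phi_0(\xi)=\zeta(|\xi|)-\zeta(2|\xi|)$, $\phi_j(\xi)=\phi_0(2^{-j}\xi)$ for $j\in\mathbb Z$. For $1\le q\le p<\infty$ let $$\|f\|_{\mathcal M^p_q}=\sup_{x_0\in\mathbb R^N}\sup_{R>0}R^{\frac Np-\frac Nq}\|f\|_{L^q(B(x_0,R))},\qquad \|f\|_{M^p_q}=\sup_{x_0\in\mathbb R^N}\sup_{0<R\le1}R^{\frac Np-\frac Nq}\|f\|_{L^q(B(x_0,R))} .$$ For $1\le r\le\infty$ and $s\in\mathbb R$, the inhomogeneous Besov--Morrey space $N^s_{p,q,r}$ consists of the tempered distributions $u\in\mathcal S'(\mathbb R^N)$ with $$\|u\|_{N^s_{p,q,r}}=\|\mathcal F^{-1}\phi_{(0)}\mathcal Fu\|_{M^p_q}+\big\|\{2^{sj}\|\mathcal F^{-1}\phi_j\mathcal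 Fu\|_{M^p_q}\}_{j\ge1}\big\|_{\ell^r}<\infty ,$$ and the homogeneous space $\mathcal N^s_{p,q,r}$ of the classes $u\in\mathcal S'/\mathcal P$ ($\mathcal P$ being the polynomials on $\mathbb R^N$) with $$\|u\|_{\mathcal N^s_{p,q,r}}=\big\|\{2^{sj}\|\mathcal F^{-1}\phi_j\mathcal Fu\|_{\mathcal M^p_q}\}_{j\in\mathbb Z}\big\|_{\ell^r}<\infty .$$ Here $\mathcal F$ is the Fourier transform with kernel $e^{-ix\cdot\xi}$. Let $e^{\tau\Delta}u=\mathcal F^{-1}e^{-\tau|\xi|^2}\mathcal Fu$, let $$\Phi_\alpha(\theta)=\sum_{k=0}^\infty\frac{(-\theta)^k}{k!\,\Gamma(-\alpha k+1-\alpha)}$$ be the Wright type function, and for $t>0$ let $$P_\alpha(t)u=\int_0^\infty\Phi_\alpha(\theta)\,e^{t^\alpha\theta\Delta}u\,d\theta,\qquad S_\alpha(t)u=\alpha\int_0^\infty\theta\,\Phi_\alpha(\theta)\,e^{t^\alpha\theta\Delta}u\,d\theta ,$$ the integrals being understood in $\mathcal S'$, that is, after pairing with an arbitrary Schwartz function.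 These operators act on $\mathcal S'/\mathcal P$ through representatives. Let $1\le q\le p<\infty$, $1\le r\le\infty$ and $s\le\sigma$. Let $T_\alpha(t)$ be either $S_\alpha(t)$, in which case assume $\sigma-s<4$, or $P_\alpha(t)$, in which case assume $\sigma-s<2$. Then the following hold, where the integral that defines $T_\alpha(t)u$ converges, the result lies in the space on the left-hand side (in the homogeneous case, its class modulo polynomials does not depend on the representative of $u$), and the constants $C>0$ are independent of $u$ and $t$. 1. There is $C>0$ such that for all $u\in N^s_{p,q,r}$ and $t>0$, $$\|T_\alpha(t)u\|_{N^\sigma_{p,q,r}}\le C\big(1+t^{\frac{(s-\sigma)\alpha}2}\big)\|u\|_{N^s_{p,q,r}} .$$ 2. If $s<\sigma$, there is $C>0$ such that for all $u\in N^s_{p,q,\infty}$ and $t>0$, $$\|T_\alpha(t)u\|_{N^\sigma_{p,q,1}}\le C\big(1+t^{\frac{(s-\sigma)\alpha}2}\big)\|u\|_{N^s_{p,q,\infty}} .$$ 3. There is $C>0$ such that for all $u\in\mathcal N^s_{p,q,r}$ and $t>0$, $$\|T_\alpha(t)u\|_{\mathcal N^\sigma_{p,q,r}}\le C\,t^{\frac{(s-\sigma)\alpha}2}\|u\|_{\mathcal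 N^s_{p,q,r}} .$$ 4. If $s<\sigma$, there is $C>0$ such that for all $u\in\mathcal N^s_{p,q,\infty}$ and $t>0$, $$\|T_\alpha(t)u\|_{\mathcal N^\sigma_{p,q,1}}\le C\,t^{\frac{(s-\sigma)\alpha}2}\|u\|_{\mathcal N^s_{p,q,\infty}} .$$ -/

import Mathlib

open scoped SchwartzMap ENNReal
open MeasureTheory

noncomputable section

namespace BesovMorrey

/-- Euclidean space `ℝ^N`. -/
abbrev Space (N : ℕ) : Type := EuclideanSpace ℝ (Fin N)

/-- Tempered distributions on `ℝ^N` (complex valued; real distributions are a special case). -/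
abbrev Dist (N : ℕ) : Type := 𝓢'(Space N, ℂ)

/-! ### Morrey spaces -/

/-- The Morrey norm `sup_{x₀} sup_{R > 0} R^{N/p - N/q} ‖f‖_{L^q(B(x₀, R))}` of a function. -/
def morreyFun {N : ℕ} (p q : ℝ) (f : Space N → ℂ) : ℝ≥0∞ :=
  ⨆ (x₀ : Space N) (R : ℝ) (_ : 0 < R),
    ENNReal.ofReal (R ^ ((N : ℝ) / p - (N : ℝ) / q)) *
      eLpNorm f (ENNReal.ofReal q) (volume.restrict (Metric.ball x₀ R))

/-- The local Morrey norm: the same supremum over the radii `0 < R ≤ 1`. -/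
def locMorreyFun {N : ℕ} (p q : ℝ) (f : Space N → ℂ) : ℝ≥0∞ :=
  ⨆ (x₀ : Space N) (R : ℝ) (_ : 0 < R ∧ R ≤ 1),
    ENNReal.ofReal (R ^ ((N : ℝ) / p - (N : ℝ) / q)) *
      eLpNorm f (ENNReal.ofReal q) (volume.restrict (Metric.ball x₀ R))

/-- The tempered distribution `v` is the measurable function `f`. Such an `f` is unique almost
everywhere. -/
def Represents {N : ℕ} (f : Space N → ℂ) (v : Dist N) : Prop :=
  AEStronglyMeasurable f volume ∧
    ∀ g : 𝓢(Space N, ℂ), Integrable (fun x => g x * f x) volume ∧ v g = ∫ x, g x * f x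

/-- The Morrey norm of a tempered distribution: the norm of the function that it is, and `∞` if it
is not a function. -/
def morreyNorm {N : ℕ} (p q : ℝ) (v : Dist N) : ℝ≥0∞ :=
  ⨅ (f : Space N → ℂ) (_ : Represents f v), morreyFun p q f

/-- The local Morrey norm of a tempered distribution (`∞` if it is not a function). -/
def locMorreyNorm {N : ℕ} (p q : ℝ) (v : Dist N) : ℝ≥0∞ :=
  ⨅ (f : Space N → ℂ) (_ : Represents f v), locMorreyFun p q f

/-! ### Littlewood-Paley decomposition -/

/-- The cut-off functions `ζ` from which the dyadic decomposition is built. Only the values on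
`[0, ∞)` matter; the condition `ζ = 1` on `(-∞, 3/2]` fixes the extension to negative arguments. -/
structure IsCutoff (ζ : ℝ → ℝ) : Prop where
  smooth : ContDiff ℝ ((⊤ : ℕ∞) : WithTop ℕ∞) ζ
  nonneg : ∀ ρ, 0 ≤ ζ ρ
  le_one : ∀ ρ, ζ ρ ≤ 1
  eq_one : ∀ ρ, ρ ≤ 3 / 2 → ζ ρ = 1
  tsupport_subset : tsupport ζ ⊆ Set.Iio (5 / 3)

/-- The operator `ℱ⁻¹ m(ξ) ℱ`, where `ℱ` is the Fourier transform with kernel `e^{-i x·ξ}`. Mathlib's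
transform has the kernel `e^{-2π i x·ξ}`, which accounts for the factor `2π`. -/
def multiplier {N : ℕ} (m : Space N → ℝ) (u : Dist N) : Dist N :=
  TemperedDistribution.fourierMultiplierCLM ℂ
    (fun ξ : Space N => ((m ((2 * Real.pi) • ξ) : ℝ) : ℂ)) u

/-- `φ_{(0)}(ξ) = ζ(|ξ|)`. -/
def phiLow {N : ℕ} (ζ : ℝ → ℝ) (ξ : Space N) : ℝ := ζ ‖ξ‖

/-- `φ_0(ξ) = ζ(|ξ|) - ζ(2|ξ|)`. -/
def phiZero {N : ℕ} (ζ : ℝ → ℝ) (ξ : Space N) : ℝ := ζ ‖ξ‖ - ζ (2 * ‖ξ‖)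

/-- `φ_j(ξ) = φ_0(2^{-j} ξ)`. -/
def phi {N : ℕ} (ζ : ℝ → ℝ) (j : ℤ) (ξ : Space N) : ℝ := phiZero ζ (((2 : ℝ) ^ (-j)) • ξ)

/-- The `l^r` norm of a family of extended nonnegative reals. -/
def lrNorm {ι : Type} (r : ℝ≥0∞) (a : ι → ℝ≥0∞) : ℝ≥0∞ :=
  if r = ∞ then ⨆ i, a i else (∑' i, a i ^ r.toReal) ^ (1 / r.toReal)

/-! ### Besov-Morrey spaces -/

/-- The inhomogeneous Besov-Morrey norm (`∞` off the space). The sequence runs over `j ≥ 1`. -/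
def besovMorreyNorm {N : ℕ} (ζ : ℝ → ℝ) (s p q : ℝ) (r : ℝ≥0∞) (u : Dist N) : ℝ≥0∞ :=
  locMorreyNorm p q (multiplier (phiLow ζ) u) +
    lrNorm r (fun k : ℕ => ENNReal.ofReal ((2 : ℝ) ^ (s * ((k : ℝ) + 1))) *
      locMorreyNorm p q (multiplier (phi ζ ((k : ℤ) + 1)) u))

/-- Membership in the inhomogeneous Besov-Morrey space `N^s_{p,q,r}`. -/
def MemN {N : ℕ} (ζ : ℝ → ℝ) (s p q : ℝ) (r : ℝ≥0∞) (u : Dist N) : Prop :=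
  besovMorreyNorm ζ s p q r u < ∞

/-- The polynomials in `N` variables, as a subspace of the tempered distributions (the set below is
a subspace already, so the span adds nothing to it). -/
def polynomials (N : ℕ) : Submodule ℂ (Dist N) :=
  Submodule.span ℂ {v : Dist N | ∃ P : MvPolynomial (Fin N) ℂ,
    Represents (fun x : Space N => MvPolynomial.eval (fun i => ((x i : ℝ) : ℂ)) P) v}

/-- The quotient `𝒮' / 𝒫` of the tempered distributions by the polynomials. -/
abbrev DistModPoly (N : ℕ) : Type := Dist N ⧸ polynomials N

/-- The class modulo polynomials of a tempered distribution. -/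
abbrev modPoly {N : ℕ} (u : Dist N) : DistModPoly N := Submodule.Quotient.mk u

/-- The homogeneous Besov-Morrey expression of a tempered distribution. -/
def homBesovMorrey {N : ℕ} (ζ : ℝ → ℝ) (s p q : ℝ) (r : ℝ≥0∞) (u : Dist N) : ℝ≥0∞ :=
  lrNorm r (fun j : ℤ => ENNReal.ofReal ((2 : ℝ) ^ ((j : ℝ) * s)) *
    morreyNorm p q (multiplier (phi ζ j) u))

/-- The homogeneous Besov-Morrey norm of a class (`∞` off the space). The functions `φ_j` vanish near
the origin, so all representatives `u` of the class have the same `ℱ⁻¹ φ_j ℱ u`, and the infimum is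
over equal numbers. -/
def homBesovMorreyNorm {N : ℕ} (ζ : ℝ → ℝ) (s p q : ℝ) (r : ℝ≥0∞) (x : DistModPoly N) : ℝ≥0∞ :=
  ⨅ (u : Dist N) (_ : modPoly u = x), homBesovMorrey ζ s p q r u

/-- Membership in the homogeneous Besov-Morrey space. -/
def MemH {N : ℕ} (ζ : ℝ → ℝ) (s p q : ℝ) (r : ℝ≥0∞) (x : DistModPoly N) : Prop :=
  homBesovMorreyNorm ζ s p q r x < ∞

/-! ### The solution operators -/

/-- The heat semigroup `e^{τΔ} = ℱ⁻¹ e^{-τ|ξ|²} ℱ`. -/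
def heat {N : ℕ} (τ : ℝ) (u : Dist N) : Dist N :=
  multiplier (fun ξ : Space N => Real.exp (-τ * ‖ξ‖ ^ 2)) u

/-- The Wright type function. At the poles of `Γ` Mathlib has `Γ = 0`, so that the corresponding terms
vanish, in agreement with `1/Γ = 0` there. -/
def wright (α θ : ℝ) : ℝ :=
  ∑' k : ℕ, (-θ) ^ k / ((k.factorial : ℝ) * Real.Gamma (-α * (k : ℝ) + 1 - α))

/-- `v = ∫_0^∞ w(θ) U(θ) dθ` as a convergent integral of tempered distributions: after pairing with
any Schwartz function the integral converges absolutely and equals the pairing with `v`. This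
determines `v`. -/
def IsDistIntegral {N : ℕ} (w : ℝ → ℝ) (U : ℝ → Dist N) (v : Dist N) : Prop :=
  ∀ g : 𝓢(Space N, ℂ),
    IntegrableOn (fun θ : ℝ => ((w θ : ℝ) : ℂ) * U θ g) (Set.Ioi 0) volume ∧
      v g = ∫ θ in Set.Ioi (0 : ℝ), ((w θ : ℝ) : ℂ) * U θ g

/-- `v = P_α(t) u`, that is, `v = ∫_0^∞ Φ_α(θ) e^{t^α θ Δ} u dθ`. -/
def IsP {N : ℕ} (α t : ℝ) (u v : Dist N) : Prop :=
  IsDistIntegral (fun θ => wright α θ) (fun θ => heat (t ^ α * θ) u) v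

/-- `v = S_α(t) u`, that is, `v = α ∫_0^∞ θ Φ_α(θ) e^{t^α θ Δ} u dθ`. -/
def IsS {N : ℕ} (α t : ℝ) (u v : Dist N) : Prop :=
  IsDistIntegral (fun θ => α * (θ * wright α θ)) (fun θ => heat (t ^ α * θ) u) v

/-- `y` is the image of the class `x` under the operator with graph `T`: every representative of `x`
has an image, and its class is `y`. -/
def OnClasses {N : ℕ} (T : Dist N → Dist N → Prop) (x y : DistModPoly N) : Prop :=
  ∀ u : Dist N, modPoly u = x → ∃ v : Dist N, T u v ∧ modPoly v = y

end BesovMorrey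

end

/-!
Both operators are integrals `∫_0^∞ w(θ) e^{TθΔ} u dθ` with `T = t^α` and a weight `w` of the class
`IsWeight w k`: exponentially decaying at infinity, and `O(θ^k)` at the origin, where `k = 0` for
`P_α` and `k = 1` for `S_α`. The decay comes from writing the Wright function as a contour integral
around the cut of `ζ^{α-1} exp (ζ - θ ζ^α)`. The contour can be opened to a ray `arg ζ = ψ` with
`π/2 < ψ` and `α ψ < π/2`, and the arc joining it to `1`; there `Re ζ^α` is bounded below by a
positive constant, which gives `e^{-cθ}` (`abs_wright_le`). All moments of `w` are therefore finite,
and since `⟨e^{τΔ} u, g⟩` is continuous and polynomially bounded in `τ`, the integral converges for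
every tempered distribution (`exists_isDistIntegral`).

A multiplier with symbol `b(ρ ξ)`, `b` a Schwartz function, averages the translates of a function
with an integrable weight whose `L¹` norm does not depend on `ρ`. Minkowski's inequality bounds such
averages on Morrey spaces, and the same holds after a further integration in `θ`
(`morreySupNorm_distIntegral_dilMul_le`). Applied to `e^{τΔ}`, this bounds the operators on every
block. On the `j`-th block one has in addition
`e^{τΔ} = (4^j τ)⁻³ · [(τ|ξ|²)³ e^{-τ|ξ|²}] · [(2^{-j}|ξ|)⁻⁶]`, where both brackets agree there with dilates of
Schwartz symbols. With `λ = 4^j T`, the first bound is used for `λ θ ≤ 1` and the second one for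
`λ θ > 1`; integrating the resulting `w(θ) (1 + λ θ)⁻³` in `θ` bounds the operator on the `j`-th
block by a multiple of `min (1, λ^{-(k+1)})` (`exists_block_le`). The vanishing of the weight
of `S_α` at `θ = 0` is what doubles the admissible gain of regularity.

With `γ = (σ - s)/2`, the factor `2^{j(σ-s)}` is `T^{-γ} λ^γ`, so that the `j`-th block of the image
is bounded by `T^{-γ} λ^γ min (1, λ^{-(k+1)})` times that of `u`. As `0 ≤ γ < k + 1`, these factors
are bounded by `T^{-γ} = t^{(s-σ)α/2}`, and if `γ > 0` they are dominated by a two-sided geometric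
sequence, with a sum that is uniform in `T`. This gives the estimates with equal `r` and those from
`∞` to `1`.

Finally, averaging the translates of a polynomial against a weight with all moments gives a
polynomial, so the operators pass to the quotient by polynomials (`IsDistIntegral.mem_polynomials`).
-/

noncomputable section

namespace BesovMorrey

open Set Filter Topology FourierTransform

/-! ### Exponential decay of the Wright function -/

section Wright

/-- Euler's integral for `Γ` in the logarithmic coordinate. -/
theorem integrable_exp_mul_sub_exp {s : ℝ} (hs : 0 < s) :
    Integrable (fun x : ℝ => Real.exp (s * x - Real.exp x)) ∧
      ∫ x : ℝ, Real.exp (s * x - Real.exp x) = Real.Gamma s := by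
  have himg : Real.exp '' univ = Ioi 0 := by rw [image_univ, Real.range_exp]
  have key : ∀ x : ℝ, |Real.exp x| • (Real.exp (-Real.exp x) * Real.exp x ^ (s - 1)) =
      Real.exp (s * x - Real.exp x) := by
    intro x
    rw [abs_of_pos (Real.exp_pos x), smul_eq_mul, ← Real.exp_mul, ← Real.exp_add, ← Real.exp_add]
    ring_nf
  constructor
  · have h := (integrableOn_image_iff_integrableOn_abs_deriv_smul (s := univ) (f := Real.exp)
      (f' := Real.exp) MeasurableSet.univ (fun x _ => (Real.hasDerivAt_exp x).hasDerivWithinAt)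
      Real.exp_injective.injOn (fun x => Real.exp (-x) * x ^ (s - 1))).1
      (by rw [himg]; exact Real.GammaIntegral_convergent hs)
    simpa only [key, integrableOn_univ] using h
  · have h := integral_image_eq_integral_abs_deriv_smul (s := univ) (f := Real.exp)
      (f' := Real.exp) MeasurableSet.univ (fun x _ => (Real.hasDerivAt_exp x).hasDerivWithinAt)
      Real.exp_injective.injOn (fun x => Real.exp (-x) * x ^ (s - 1))
    rw [himg] at h
    rw [Real.Gamma_eq_integral hs, h]
    simp only [key, Measure.restrict_univ]

theorem integrable_exp_mul_sub_mul_exp {s c : ℝ} (hs : 0 < s) (hc : 0 < c) :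
    Integrable (fun x : ℝ => Real.exp (s * x - c * Real.exp x)) := by
  have h := ((integrable_exp_mul_sub_exp hs).1.comp_add_right (Real.log c)).const_mul
    (Real.exp (-(s * Real.log c)))
  refine h.congr (Eventually.of_forall fun x => ?_)
  simp only
  rw [← Real.exp_add, Real.exp_add x, Real.exp_log hc]
  ring_nf

/-- Sublinear powers are dominated: `θ X^α ≤ c X + C` for `X = e^x`. -/
theorem exists_mul_exp_le {α : ℝ} (hα0 : 0 < α) (hα1 : α < 1) {c : ℝ} (hc : 0 < c) (θ : ℝ) :
    ∃ C : ℝ, ∀ x : ℝ, θ * Real.exp (α * x) ≤ c * Real.exp x + C := by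
  -- beyond `x₀ = log (|θ| / c) / (1 - α)` the linear term wins
  obtain ⟨x₀, hx₀⟩ : ∃ x₀ : ℝ, |θ| ≤ c * Real.exp ((1 - α) * x₀) := by
    have : Tendsto (fun x : ℝ => c * Real.exp ((1 - α) * x)) atTop atTop :=
      (Real.tendsto_exp_atTop.comp (tendsto_id.const_mul_atTop (by linarith))).const_mul_atTop hc
    exact (this.eventually_ge_atTop |θ|).exists
  refine ⟨|θ| * Real.exp (α * x₀), fun x => ?_⟩
  have h1 : θ * Real.exp (α * x) ≤ |θ| * Real.exp (α * x) := by
    gcongr; exact le_abs_self θ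
  rcases le_total x x₀ with h | h
  · have : |θ| * Real.exp (α * x) ≤ |θ| * Real.exp (α * x₀) := by gcongr
    have := mul_pos hc (Real.exp_pos x)
    linarith
  · have h2 : |θ| * Real.exp (α * x) ≤ c * Real.exp ((1 - α) * x) * Real.exp (α * x) := by
      gcongr
      exact hx₀.trans (by gcongr)
    have h3 : c * Real.exp ((1 - α) * x) * Real.exp (α * x) = c * Real.exp x := by
      rw [mul_assoc, ← Real.exp_add]; ring_nf
    have : 0 ≤ |θ| * Real.exp (α * x₀) := by positivity
    linarith

/-- The entire integrand `exp (α z + e^z - θ e^{α z})` of the contour integral for the Wright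
function; it is `ζ^{α-1} exp (ζ - θ ζ^α) dζ` in the logarithmic coordinate `ζ = e^z`. -/
def wrightKernel (α θ : ℝ) (z : ℂ) : ℂ :=
  Complex.exp (α * z + Complex.exp z - θ * Complex.exp (α * z))

theorem differentiable_wrightKernel (α θ : ℝ) : Differentiable ℂ (wrightKernel α θ) := by
  unfold wrightKernel; fun_prop

theorem norm_wrightKernel (α θ x y : ℝ) : ‖wrightKernel α θ (x + y * Complex.I)‖ =
    Real.exp (α * x + Real.exp x * Real.cos y - θ * (Real.exp (α * x) * Real.cos (α * y))) := by
  rw [wrightKernel, Complex.norm_exp]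
  have h : (α : ℂ) * (x + y * Complex.I) = ((α * x : ℝ) : ℂ) + ((α * y : ℝ) : ℂ) * Complex.I := by
    push_cast; ring
  rw [h]
  simp only [Complex.sub_re, Complex.add_re, Complex.exp_re,
    Complex.add_im, Complex.ofReal_re, Complex.ofReal_im, Complex.mul_im, Complex.mul_re,
    Complex.I_re, Complex.I_im]
  simp

theorem wrightKernel_ofReal_im (α θ x : ℝ) : (wrightKernel α θ x).im = 0 := by
  rw [wrightKernel]
  have : (α : ℂ) * x + Complex.exp x - θ * Complex.exp (α * x) =
    ((α * x + Real.exp x - θ * Real.exp (α * x) : ℝ) : ℂ) := by push_cast; ring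
  rw [this]
  exact Complex.exp_ofReal_im _

/-- The majorant of the kernel on the line `Im z = π`, where `cos y = -1`. -/
theorem integrable_wrightKernel_bound {α : ℝ} (hα0 : 0 < α) (hα1 : α < 1) (θ : ℝ) :
    Integrable (fun x : ℝ => Real.exp (α * x - Real.exp x + θ * Real.exp (α * x))) := by
  obtain ⟨C, hC⟩ := exists_mul_exp_le hα0 hα1 (c := 1 / 2) (by norm_num) θ
  have h := (integrable_exp_mul_sub_mul_exp hα0 (c := 1 / 2) (by norm_num)).const_mul (Real.exp C)
  refine h.mono' (by fun_prop) (Eventually.of_forall fun x => ?_)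
  rw [Real.norm_eq_abs, abs_of_pos (Real.exp_pos _), ← Real.exp_add]
  refine Real.exp_le_exp.2 ?_
  linarith [hC x]

/-- The Wright function as an integral along the upper side of the cut `arg ζ = π`. The exponential
series in `θ` is integrated termwise, and the reflection formula turns `sin (π s) Γ(s)` into
`π / Γ(1 - s)`. -/
theorem hasSum_wright {α : ℝ} (hα0 : 0 < α) (hα1 : α < 1) {θ : ℝ} (hθ : 0 ≤ θ) :
    HasSum (fun k : ℕ => (-θ) ^ k / ((k.factorial : ℝ) * Real.Gamma (-α * (k : ℝ) + 1 - α)))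
      (1 / Real.pi * (∫ x : ℝ, wrightKernel α θ (x + Real.pi * Complex.I)).im) := by
  set e : ℝ → ℂ := fun x => Complex.exp (α * (x + Real.pi * Complex.I)) with he
  set F : ℕ → ℝ → ℂ := fun k x =>
    ((k.factorial : ℂ)⁻¹ * (-θ * e x) ^ k) * (e x * Complex.exp (-Real.exp x : ℝ)) with hF
  have hne : ∀ x, ‖e x‖ = Real.exp (α * x) := by
    intro x
    rw [he, Complex.norm_exp]; simp
  have hcont : ∀ k, Continuous (F k) := by intro k; fun_prop
  have hnF : ∀ k x, ‖F k x‖ = (k.factorial : ℝ)⁻¹ * (θ * Real.exp (α * x)) ^ k *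
      Real.exp (α * x - Real.exp x) := by
    intro k x
    rw [hF]
    simp only [norm_mul, norm_inv, norm_pow, norm_neg, hne, Complex.norm_natCast, Complex.norm_real,
      Complex.norm_exp, Complex.ofReal_re, Real.norm_eq_abs, abs_of_nonneg hθ]
    rw [← Real.exp_add]; ring_nf
  have hexp : ∀ x : ℝ, HasSum (fun k => ‖F k x‖)
      (Real.exp (α * x - Real.exp x + θ * Real.exp (α * x))) := by
    intro x
    have h1 := (NormedSpace.expSeries_div_hasSum_exp (θ * Real.exp (α * x))).mul_right
      (Real.exp (α * x - Real.exp x))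
    rw [← Real.exp_eq_exp_ℝ, ← Real.exp_add, add_comm] at h1
    refine h1.congr_fun ?_
    intro k
    rw [hnF, div_eq_inv_mul]
  have hsum : ∀ x : ℝ, HasSum (fun k => F k x) (wrightKernel α θ (x + Real.pi * Complex.I)) := by
    intro x
    have h1 := (NormedSpace.expSeries_div_hasSum_exp (-θ * e x)).mul_right
      (e x * Complex.exp (-Real.exp x : ℝ))
    rw [← Complex.exp_eq_exp_ℂ] at h1
    have h2 : Complex.exp (-θ * e x) * (e x * Complex.exp (-Real.exp x : ℝ)) =
        wrightKernel α θ (x + Real.pi * Complex.I) := by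
      rw [wrightKernel, he, ← Complex.exp_add, ← Complex.exp_add, Complex.exp_add x,
        Complex.exp_pi_mul_I]
      push_cast; ring_nf
    rw [h2] at h1
    refine h1.congr_fun ?_
    intro k
    rw [hF, div_eq_inv_mul]
  have hint := integrable_wrightKernel_bound hα0 hα1 θ
  have hS := hasSum_integral_of_dominated_convergence (μ := volume) (fun k x => ‖F k x‖)
    (fun k => (hcont k).aestronglyMeasurable) (fun k => Eventually.of_forall fun x => le_rfl)
    (Eventually.of_forall fun x => (hexp x).summable)
    (hint.congr (Eventually.of_forall fun x => (hexp x).tsum_eq.symm))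
    (Eventually.of_forall hsum)
  have hIm := (Complex.hasSum_im hS).mul_left (1 / Real.pi)
  refine hIm.congr_fun ?_
  intro k
  set s : ℝ := α * (k + 1) with hs
  have hs0 : 0 < s := by positivity
  have hFk : ∀ x, F k x = ((k.factorial : ℝ)⁻¹ * (-θ) ^ k : ℝ) * Complex.exp (Real.pi * s * Complex.I) *
      ((Real.exp (s * x - Real.exp x) : ℝ) : ℂ) := by
    intro x
    rw [hF]
    simp only [mul_pow, he, ← Complex.exp_nat_mul]
    push_cast
    have h1 : Complex.exp (k * (α * (x + Real.pi * Complex.I))) *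
        (Complex.exp (α * (x + Real.pi * Complex.I)) * Complex.exp (-Complex.exp x)) =
        Complex.exp (Real.pi * s * Complex.I) * Complex.exp (s * x - Complex.exp x) := by
      rw [← Complex.exp_add, ← Complex.exp_add, ← Complex.exp_add, hs]
      push_cast; ring_nf
    linear_combination ((k.factorial : ℂ)⁻¹ * (-θ) ^ k) * h1
  have hI : ∫ x, F k x = ((k.factorial : ℝ)⁻¹ * (-θ) ^ k : ℝ) *
      Complex.exp (Real.pi * s * Complex.I) * (Real.Gamma s : ℂ) := by
    simp only [hFk]
    rw [integral_const_mul, integral_complex_ofReal, (integrable_exp_mul_sub_exp hs0).2]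
  rw [hI]
  have him : (((k.factorial : ℝ)⁻¹ * (-θ) ^ k : ℝ) *
      Complex.exp (Real.pi * s * Complex.I) * (Real.Gamma s : ℂ)).im =
      (k.factorial : ℝ)⁻¹ * (-θ) ^ k * Real.sin (Real.pi * s) * Real.Gamma s := by
    rw [mul_assoc, Complex.im_ofReal_mul, Complex.im_mul_ofReal]
    have : (Real.pi : ℂ) * s * Complex.I = ((Real.pi * s : ℝ) : ℂ) * Complex.I := by push_cast; ring
    rw [this, Complex.exp_ofReal_mul_I_im]; ring
  rw [him]
  have hΓ := Real.Gamma_mul_Gamma_one_sub s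
  have harg : -α * (k : ℝ) + 1 - α = 1 - s := by rw [hs]; ring
  rw [harg]
  have hfac : (k.factorial : ℝ) ≠ 0 := by positivity
  have hpi := Real.pi_ne_zero
  have hΓs := (Real.Gamma_pos_of_pos hs0).ne'
  by_cases h0 : Real.sin (Real.pi * s) = 0
  · rw [h0, div_zero] at hΓ
    have : Real.Gamma (1 - s) = 0 := by
      rcases mul_eq_zero.1 hΓ with h | h
      · exact absurd h hΓs
      · exact h
    rw [this, h0]; simp
  · have : Real.Gamma (1 - s) = Real.pi / Real.sin (Real.pi * s) / Real.Gamma s := by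
      rw [← hΓ]; field_simp
    rw [this]; field_simp

/-- Deformation of the truncated contour from the cut `arg ζ = π` to the ray `arg ζ = ψ` and the
unit arc. The segment `(-∞, 0]` does not contribute to the imaginary part, because the kernel is
real there. -/
theorem im_integral_wrightKernel_eq (α θ ψ n : ℝ) :
    (∫ x in (-n)..n, wrightKernel α θ (x + Real.pi * Complex.I)).im =
      ((∫ x in (0 : ℝ)..n, wrightKernel α θ (x + ψ * Complex.I)) +
        Complex.I * (∫ y in (0 : ℝ)..ψ, wrightKernel α θ ((0 : ℝ) + y * Complex.I)) +
        Complex.I * (∫ y in ψ..Real.pi, wrightKernel α θ (n + y * Complex.I)) -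
        Complex.I * (∫ y in (0 : ℝ)..Real.pi, wrightKernel α θ ((-n : ℝ) + y * Complex.I))).im := by
  have hd := differentiable_wrightKernel α θ
  have hc : Continuous (wrightKernel α θ) := hd.continuous
  have h1 := Complex.integral_boundary_rect_eq_zero_of_differentiableOn (wrightKernel α θ)
    (-n : ℝ) (Real.pi * Complex.I) hd.differentiableOn
  have h2 := Complex.integral_boundary_rect_eq_zero_of_differentiableOn (wrightKernel α θ)
    (ψ * Complex.I) (n + Real.pi * Complex.I) hd.differentiableOn
  simp only [Complex.ofReal_re, Complex.ofReal_im, Complex.mul_re, Complex.mul_im, Complex.I_re,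
    Complex.I_im, Complex.add_re, Complex.add_im, mul_zero, mul_one, zero_mul, add_zero,
    zero_add, Complex.ofReal_zero, smul_eq_mul, sub_self] at h1 h2
  have hx : ∀ a b : ℝ, IntervalIntegrable
      (fun x : ℝ => wrightKernel α θ (x + Real.pi * Complex.I)) volume a b := fun a b =>
    Continuous.intervalIntegrable (by fun_prop) _ _
  have hy : ∀ a b : ℝ, IntervalIntegrable
      (fun y : ℝ => wrightKernel α θ (y * Complex.I)) volume a b := fun a b =>
    Continuous.intervalIntegrable (by fun_prop) _ _
  have e1 := intervalIntegral.integral_add_adjacent_intervals (hx (-n) 0) (hx 0 n)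
  have e2 := intervalIntegral.integral_add_adjacent_intervals (hy 0 ψ) (hy ψ Real.pi)
  have hreal : (∫ x in (-n)..0, wrightKernel α θ x).im = 0 := by
    have hi : IntervalIntegrable (fun x : ℝ => wrightKernel α θ x) volume (-n) 0 :=
      Continuous.intervalIntegrable (by fun_prop) _ _
    have := Complex.imCLM.intervalIntegral_comp_comm hi
    simp only [Complex.imCLM_apply, wrightKernel_ofReal_im, intervalIntegral.integral_zero] at this
    exact this.symm
  have key : (∫ x in (-n)..n, wrightKernel α θ (x + Real.pi * Complex.I)) =
      (∫ x in (-n)..0, wrightKernel α θ x) +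
      ((∫ x in (0 : ℝ)..n, wrightKernel α θ (x + ψ * Complex.I)) +
        Complex.I * (∫ y in (0 : ℝ)..ψ, wrightKernel α θ ((0 : ℝ) + y * Complex.I)) +
        Complex.I * (∫ y in ψ..Real.pi, wrightKernel α θ (n + y * Complex.I)) -
        Complex.I * (∫ y in (0 : ℝ)..Real.pi, wrightKernel α θ ((-n : ℝ) + y * Complex.I))) := by
    simp only [Complex.ofReal_zero, zero_add]
    linear_combination -e1 - h1 - h2 - Complex.I * e2
  rw [key, Complex.add_im, hreal, zero_add]

/-- The Wright function decays exponentially on `[0, ∞)`. -/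
theorem abs_wright_le {α : ℝ} (hα0 : 0 < α) (hα1 : α < 1) :
    ∃ A c : ℝ, 0 < A ∧ 0 < c ∧ ∀ θ : ℝ, 0 ≤ θ → |wright α θ| ≤ A * Real.exp (-c * θ) := by
  -- the angle `ψ` satisfies `π / 2 < ψ < π` and `α ψ < π / 2`
  set ψ : ℝ := Real.pi / (1 + α) with hψ
  have hpi := Real.pi_pos
  have hψ1 : Real.pi / 2 < ψ := by
    rw [hψ, div_lt_div_iff₀ (by norm_num) (by linarith)]; nlinarith
  have hψ2 : ψ < Real.pi := by
    rw [hψ, div_lt_iff₀ (by linarith)]; nlinarith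
  have hψ0 : 0 < ψ := by linarith
  have hαψ : α * ψ < Real.pi / 2 := by
    rw [hψ, mul_div_assoc', div_lt_div_iff₀ (by linarith) (by norm_num)]; nlinarith
  have hαψ0 : 0 < α * ψ := by positivity
  set κ : ℝ := -Real.cos ψ with hκ
  have hκ0 : 0 < κ := by
    have := Real.cos_neg_of_pi_div_two_lt_of_lt hψ1 (by linarith)
    linarith
  set c : ℝ := Real.cos (α * ψ) with hc
  have hc0 : 0 < c := Real.cos_pos_of_mem_Ioo ⟨by linarith, hαψ⟩
  have hcos : ∀ y ∈ Icc 0 ψ, c ≤ Real.cos (α * y) := by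
    intro y hy
    refine Real.cos_le_cos_of_nonneg_of_le_pi (by have := hy.1; positivity) (by linarith) ?_
    gcongr; exact hy.2
  have hcosψ : ∀ y ∈ Icc ψ Real.pi, Real.cos y ≤ -κ := by
    intro y hy
    rw [hκ, neg_neg]
    exact Real.cos_le_cos_of_nonneg_of_le_pi hψ0.le hy.2 hy.1
  have hint := integrable_exp_mul_sub_mul_exp hα0 hκ0
  set J : ℝ := ∫ x : ℝ, Real.exp (α * x - κ * Real.exp x) with hJ
  have hJ0 : 0 ≤ J := integral_nonneg fun x => (Real.exp_pos _).le
  refine ⟨J + ψ * Real.exp 1 + 1, c, by positivity, hc0, fun θ hθ => ?_⟩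
  have hsum := (hasSum_wright hα0 hα1 hθ).tsum_eq
  change wright α θ = _ at hsum
  -- the contributions of the two vertical sides far out, which vanish in the limit
  set ε : ℝ → ℝ := fun n =>
    Real.pi * Real.exp (α * n - κ * Real.exp n + θ * Real.exp (α * n)) +
      Real.pi * Real.exp (α * (-n) + 1 + θ) with hε
  -- the truncated contour integral
  have hbound : ∀ n : ℝ, 0 ≤ n →
      |(∫ x in (-n)..n, wrightKernel α θ (x + Real.pi * Complex.I)).im| ≤
        (J + ψ * Real.exp 1) * Real.exp (-c * θ) + ε n := by
    intro n hn
    rw [im_integral_wrightKernel_eq α θ ψ n]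
    refine (Complex.abs_im_le_norm _).trans ?_
    have n1 : ‖∫ x in (0 : ℝ)..n, wrightKernel α θ (x + ψ * Complex.I)‖ ≤
        J * Real.exp (-c * θ) := by
      have hle : ∀ x ∈ Ioc 0 n, ‖wrightKernel α θ (x + ψ * Complex.I)‖ ≤
          Real.exp (α * x - κ * Real.exp x) * Real.exp (-c * θ) := by
        intro x hx
        rw [norm_wrightKernel, ← Real.exp_add]
        refine Real.exp_le_exp.2 ?_
        have : 1 ≤ Real.exp (α * x) := Real.one_le_exp (by have := hx.1; positivity)
        have h3 : θ * (1 * c) ≤ θ * (Real.exp (α * x) * c) := by gcongr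
        rw [← hc]
        have h4 : Real.cos ψ = -κ := by rw [hκ, neg_neg]
        rw [h4]; linarith
      refine (intervalIntegral.norm_integral_le_of_norm_le hn
        (ae_of_all _ hle) (hint.mul_const _).intervalIntegrable).trans ?_
      rw [intervalIntegral.integral_mul_const, intervalIntegral.integral_of_le hn]
      gcongr
      exact setIntegral_le_integral hint (ae_of_all _ fun x => (Real.exp_pos _).le)
    have n2 : ‖∫ y in (0 : ℝ)..ψ, wrightKernel α θ ((0 : ℝ) + y * Complex.I)‖ ≤
        (ψ * Real.exp 1) * Real.exp (-c * θ) := by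
      have := intervalIntegral.norm_integral_le_of_norm_le_const (a := 0) (b := ψ)
        (f := fun y : ℝ => wrightKernel α θ ((0 : ℝ) + y * Complex.I))
        (C := Real.exp 1 * Real.exp (-c * θ)) (by
          intro y hy
          rw [uIoc_of_le hψ0.le] at hy
          rw [norm_wrightKernel, ← Real.exp_add]
          refine Real.exp_le_exp.2 ?_
          have h1 := mul_le_mul_of_nonneg_left (hcos y ⟨hy.1.le, hy.2⟩) hθ
          have h2 := Real.cos_le_one y
          simp only [mul_zero, Real.exp_zero, one_mul, zero_add]
          linarith)
      rw [sub_zero, abs_of_pos hψ0] at this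
      linarith
    have n3 : ‖∫ y in ψ..Real.pi, wrightKernel α θ (n + y * Complex.I)‖ ≤
        Real.pi * Real.exp (α * n - κ * Real.exp n + θ * Real.exp (α * n)) := by
      have := intervalIntegral.norm_integral_le_of_norm_le_const (a := ψ) (b := Real.pi)
        (f := fun y : ℝ => wrightKernel α θ (n + y * Complex.I))
        (C := Real.exp (α * n - κ * Real.exp n + θ * Real.exp (α * n))) (by
          intro y hy
          rw [uIoc_of_le hψ2.le] at hy
          rw [norm_wrightKernel]
          refine Real.exp_le_exp.2 ?_
          have h1 := mul_le_mul_of_nonneg_left (hcosψ y ⟨hy.1.le, hy.2⟩) (Real.exp_pos n).le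
          have h2 := mul_le_mul_of_nonneg_left (Real.neg_one_le_cos (α * y))
            (mul_nonneg hθ (Real.exp_pos (α * n)).le)
          linarith)
      refine this.trans ?_
      rw [mul_comm, abs_of_pos (by linarith)]
      gcongr; linarith
    have n4 : ‖∫ y in (0 : ℝ)..Real.pi, wrightKernel α θ ((-n : ℝ) + y * Complex.I)‖ ≤
        Real.pi * Real.exp (α * (-n) + 1 + θ) := by
      have := intervalIntegral.norm_integral_le_of_norm_le_const (a := 0) (b := Real.pi)
        (f := fun y : ℝ => wrightKernel α θ ((-n : ℝ) + y * Complex.I))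
        (C := Real.exp (α * (-n) + 1 + θ)) (by
          intro y hy
          rw [norm_wrightKernel]
          refine Real.exp_le_exp.2 ?_
          have h0 : Real.exp (-n) ≤ 1 := Real.exp_le_one_iff.2 (by linarith)
          have h1 : Real.exp (-n) * Real.cos y ≤ 1 * 1 := by
            have := Real.exp_pos (-n)
            nlinarith [Real.cos_le_one y]
          have h2 : Real.exp (α * (-n)) ≤ 1 := Real.exp_le_one_iff.2 (by nlinarith)
          have h3 : -1 ≤ Real.exp (α * (-n)) * Real.cos (α * y) := by
            have := Real.neg_one_le_cos (α * y)
            nlinarith [Real.exp_pos (α * (-n))]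
          have h4 := mul_le_mul_of_nonneg_left h3 hθ
          linarith)
      rw [sub_zero, abs_of_pos hpi] at this
      linarith
    have hI : ∀ z : ℂ, ‖Complex.I * z‖ = ‖z‖ := fun z => by simp
    refine (norm_sub_le _ _).trans ?_
    refine (add_le_add (norm_add₃_le) le_rfl).trans ?_
    rw [hI, hI, hI]
    simp only [hε]
    linarith
  have hε0 : Tendsto ε atTop (𝓝 0) := by
    have t2 : Tendsto (fun n : ℝ => Real.pi * Real.exp (α * (-n) + 1 + θ)) atTop (𝓝 0) := by
      have : Tendsto (fun n : ℝ => α * (-n) + 1 + θ) atTop atBot := by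
        refine tendsto_atBot_add_const_right _ _ (tendsto_atBot_add_const_right _ _ ?_)
        exact tendsto_neg_atTop_atBot.const_mul_atBot hα0
      simpa using (Real.tendsto_exp_atBot.comp this).const_mul Real.pi
    have t1 : Tendsto (fun n : ℝ => Real.pi *
        Real.exp (α * n - κ * Real.exp n + θ * Real.exp (α * n))) atTop (𝓝 0) := by
      obtain ⟨C, hC⟩ := exists_mul_exp_le hα0 hα1 (c := κ / 2) (by positivity) θ
      obtain ⟨C', hC'⟩ := exists_mul_exp_le hα0 hα1 (c := κ / 4) (by positivity) (1 : ℝ)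
      have : Tendsto (fun n : ℝ => α * n - κ * Real.exp n + θ * Real.exp (α * n)) atTop atBot := by
        refine tendsto_atBot_mono (f := fun n => -(κ / 4) * Real.exp n + (C + C'))
          (g := fun n => α * n - κ * Real.exp n + θ * Real.exp (α * n)) (fun n => ?_) ?_
        · have h1 := hC n
          have h2 := hC' n
          have h3 := Real.add_one_le_exp (α * n)
          linarith
        · exact tendsto_atBot_add_const_right _ _
            (Real.tendsto_exp_atTop.const_mul_atTop_of_neg (by linarith))
      simpa using (Real.tendsto_exp_atBot.comp this).const_mul Real.pi
    have := t1.add t2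
    rwa [add_zero] at this
  have hGint : Integrable (fun x : ℝ => wrightKernel α θ (x + Real.pi * Complex.I)) := by
    have hc : Continuous (wrightKernel α θ) := (differentiable_wrightKernel α θ).continuous
    refine (integrable_wrightKernel_bound hα0 hα1 θ).mono' (by fun_prop) (ae_of_all _ fun x => ?_)
    rw [norm_wrightKernel, Real.cos_pi]
    refine Real.exp_le_exp.2 ?_
    have h2 := mul_le_mul_of_nonneg_left (Real.neg_one_le_cos (α * Real.pi))
      (mul_nonneg hθ (Real.exp_pos (α * x)).le)
    linarith
  have hlim := intervalIntegral_tendsto_integral hGint tendsto_neg_atTop_atBot tendsto_id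
  have hlim' := ((Complex.continuous_im.tendsto _).comp hlim).abs
  have hle := le_of_tendsto_of_tendsto hlim' (tendsto_const_nhds.add hε0)
    ((eventually_ge_atTop 0).mono fun n hn => hbound n hn)
  rw [add_zero] at hle
  rw [hsum, abs_mul, abs_of_pos (by positivity : 0 < 1 / Real.pi)]
  have h1pi : 1 / Real.pi ≤ 1 := by
    rw [div_le_one hpi]; linarith [Real.pi_gt_three]
  calc 1 / Real.pi * |(∫ x : ℝ, wrightKernel α θ (x + Real.pi * Complex.I)).im|
      ≤ 1 * |(∫ x : ℝ, wrightKernel α θ (x + Real.pi * Complex.I)).im| := by gcongr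
    _ ≤ (J + ψ * Real.exp 1) * Real.exp (-c * θ) := by rw [one_mul]; exact hle
    _ ≤ (J + ψ * Real.exp 1 + 1) * Real.exp (-c * θ) := by
        refine mul_le_mul_of_nonneg_right ?_ (Real.exp_pos _).le
        linarith

theorem aestronglyMeasurable_wright {α : ℝ} (hα0 : 0 < α) (hα1 : α < 1) :
    AEStronglyMeasurable (wright α) (volume.restrict (Ioi 0)) := by
  refine aestronglyMeasurable_of_tendsto_ae atTop
    (f := fun n θ => ∑ k ∈ Finset.range n,
      (-θ) ^ k / ((k.factorial : ℝ) * Real.Gamma (-α * (k : ℝ) + 1 - α)))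
    (fun n => Continuous.aestronglyMeasurable (by fun_prop)) ?_
  filter_upwards [ae_restrict_mem measurableSet_Ioi] with θ hθ
  exact (hasSum_wright hα0 hα1 (le_of_lt hθ)).summable.hasSum.tendsto_sum_nat

end Wright

/-! ### Gaussian symbols -/

section Gauss

variable {E : Type*} [NormedAddCommGroup E] [InnerProductSpace ℝ E]

/-- The Gaussian `x ↦ e^{-c |x|²}`, with complex values. -/
def gauss (c : ℝ) (x : E) : ℂ := ((Real.exp (-c * ‖x‖ ^ 2) : ℝ) : ℂ)

theorem norm_iteratedFDeriv_clm_le {F G : Type*} [NormedAddCommGroup F] [NormedSpace ℝ F]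
    [NormedAddCommGroup G] [NormedSpace ℝ G] (A : F →L[ℝ] G) {a : ℝ} (ha : ‖A‖ ≤ a) (x : F)
    {n : ℕ} (hn : n ≠ 0) : ‖iteratedFDeriv ℝ n A x‖ ≤ a ^ n := by
  have ha0 : 0 ≤ a := (norm_nonneg _).trans ha
  obtain ⟨m, rfl⟩ := Nat.exists_eq_succ_of_ne_zero hn
  rw [Nat.succ_eq_add_one, ← norm_iteratedFDeriv_fderiv]
  have hA : fderiv ℝ A = fun _ => A := by ext1 y; exact A.fderiv
  rw [hA]
  rcases Nat.eq_zero_or_pos m with rfl | hm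
  · simpa using ha
  · rw [iteratedFDeriv_const_of_ne hm.ne']
    simp only [Pi.zero_apply, norm_zero]
    positivity

theorem norm_iteratedFDeriv_neg_mul_norm_sq_le {c : ℝ} (hc : 0 ≤ c) (x : E) {n : ℕ} (hn : 1 ≤ n) :
    ‖iteratedFDeriv ℝ n (fun x : E => -c * ‖x‖ ^ 2) x‖ ≤
      (2 * √c * (1 + √c * ‖x‖)) ^ n := by
  set A : E →L[ℝ] E := √c • ContinuousLinearMap.id ℝ E with hA
  have hAn : ‖A‖ ≤ √c := by
    rw [hA, norm_smul, Real.norm_of_nonneg (Real.sqrt_nonneg c)]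
    exact mul_le_of_le_one_right (Real.sqrt_nonneg c) ContinuousLinearMap.norm_id_le
  have hf : (fun x : E => -c * ‖x‖ ^ 2) = -fun x => innerSL ℝ (A x) (A x) := by
    ext y
    simp only [hA, Pi.neg_apply, smul_apply, ContinuousLinearMap.id_apply,
      innerSL_apply_apply, inner_smul_left, inner_smul_right, real_inner_self_eq_norm_sq]
    simp only [conj_trivial]
    rw [← mul_assoc, Real.mul_self_sqrt hc]; ring
  rw [hf, iteratedFDeriv_neg, Pi.neg_apply, norm_neg]
  refine ((innerSL ℝ (E := E)).norm_iteratedFDeriv_le_of_bilinear_of_le_one (N := (⊤ : ℕ∞))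
    A.contDiff A.contDiff x (by exact_mod_cast le_top) (norm_innerSL_le ℝ)).trans ?_
  set b : ℝ := 1 + √c * ‖x‖ with hb
  have hb1 : 1 ≤ b := by rw [hb]; have := mul_nonneg (Real.sqrt_nonneg c) (norm_nonneg x); linarith
  have h0 : ‖iteratedFDeriv ℝ 0 A x‖ ≤ b := by
    rw [norm_iteratedFDeriv_zero, hA, smul_apply, norm_smul,
      Real.norm_of_nonneg (Real.sqrt_nonneg c), ContinuousLinearMap.id_apply]
    linarith
  have hterm : ∀ i ∈ Finset.range (n + 1),
      (n.choose i : ℝ) * ‖iteratedFDeriv ℝ i A x‖ * ‖iteratedFDeriv ℝ (n - i) A x‖ ≤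
        (n.choose i : ℝ) * (√c ^ n * b) := by
    intro i hi
    have hin : i ≤ n := by simpa [Nat.lt_succ_iff] using hi
    rw [mul_assoc]
    refine mul_le_mul_of_nonneg_left ?_ (by positivity)
    rcases Nat.eq_zero_or_pos i with rfl | hi0
    · rw [mul_comm]
      refine mul_le_mul ?_ h0 (norm_nonneg _) (by positivity)
      exact norm_iteratedFDeriv_clm_le A hAn x (by omega)
    · rcases Nat.eq_zero_or_pos (n - i) with h | h
      · have : i = n := by omega
        subst this
        rw [Nat.sub_self]
        exact mul_le_mul (norm_iteratedFDeriv_clm_le A hAn x (by omega)) h0 (norm_nonneg _)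
          (by positivity)
      · calc _ ≤ √c ^ i * √c ^ (n - i) :=
              mul_le_mul (norm_iteratedFDeriv_clm_le A hAn x (by omega))
                (norm_iteratedFDeriv_clm_le A hAn x (by omega)) (norm_nonneg _) (by positivity)
          _ = √c ^ n * 1 := by rw [← pow_add, mul_one]; congr 1; omega
          _ ≤ _ := by gcongr
  refine (Finset.sum_le_sum hterm).trans ?_
  rw [← Finset.sum_mul, ← Nat.cast_sum, Nat.sum_range_choose]
  rw [mul_pow, mul_pow]
  push_cast
  rw [mul_assoc]
  gcongr
  exact le_self_pow₀ hb1 (by omega)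

theorem contDiff_gauss (c : ℝ) : ContDiff ℝ ((⊤ : ℕ∞) : WithTop ℕ∞) (gauss c : E → ℂ) := by
  unfold gauss
  exact Complex.ofRealCLM.contDiff.comp
    (Real.contDiff_exp.comp (contDiff_const.mul (contDiff_norm_sq ℝ)))

/-- The factor `√c` for each derivative makes the symbols `e^{-c |x|²}` tend to `1` as `c → 0`, with
all derivatives. -/
theorem norm_iteratedFDeriv_gauss_le {c : ℝ} (hc : 0 ≤ c) (x : E) (n : ℕ) :
    ‖iteratedFDeriv ℝ n (gauss c) x‖ ≤
      n.factorial * Real.exp (-c * ‖x‖ ^ 2) * (2 * √c * (1 + √c * ‖x‖)) ^ n := by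
  have h1 : (gauss c : E → ℂ) = Complex.ofRealLI ∘ (Real.exp ∘ fun x : E => -c * ‖x‖ ^ 2) := rfl
  have hf : ContDiff ℝ n (fun x : E => -c * ‖x‖ ^ 2) := contDiff_const.mul (contDiff_norm_sq ℝ)
  rw [h1, Complex.ofRealLI.norm_iteratedFDeriv_comp_left
    (Real.contDiff_exp.comp hf).contDiffAt le_rfl]
  refine norm_iteratedFDeriv_comp_le Real.contDiff_exp hf le_rfl x (fun i _ => ?_)
    (fun i hi _ => norm_iteratedFDeriv_neg_mul_norm_sq_le hc x hi)
  rw [norm_iteratedFDeriv_eq_norm_iteratedDeriv, iteratedDeriv_eq_iterate, Real.iter_deriv_exp,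
    Real.norm_of_nonneg (Real.exp_pos _).le]

theorem sqrt_mul_one_add_le {c : ℝ} (hc : 0 ≤ c) {r : ℝ} (hr : 0 ≤ r) :
    √c * (1 + √c * r) ≤ (1 + c) * (1 + r) := by
  have h1 : √c ≤ 1 + c := by nlinarith [Real.sq_sqrt hc, sq_nonneg (√c - 1), Real.sqrt_nonneg c]
  have h2 : √c * √c = c := Real.mul_self_sqrt hc
  nlinarith

/-- The derivatives of `e^{-c |x|²}` grow polynomially in `x` and in `c`. -/
theorem norm_iteratedFDeriv_gauss_le_pow {c : ℝ} (hc : 0 ≤ c) (x : E) {i n : ℕ} (hin : i ≤ n) :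
    ‖iteratedFDeriv ℝ i (gauss c) x‖ ≤
      n.factorial * (2 * (1 + c)) ^ n * (1 + ‖x‖) ^ n := by
  refine (norm_iteratedFDeriv_gauss_le hc x i).trans ?_
  have h1 : Real.exp (-c * ‖x‖ ^ 2) ≤ 1 := by
    rw [Real.exp_le_one_iff, neg_mul]; simp only [Left.neg_nonpos_iff]; positivity
  have h2 := sqrt_mul_one_add_le hc (norm_nonneg x)
  calc _ ≤ (n.factorial : ℝ) * 1 * (2 * ((1 + c) * (1 + ‖x‖))) ^ i := by
        rw [mul_assoc 2 (√c)]
        gcongr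
    _ ≤ (n.factorial : ℝ) * 1 * (2 * ((1 + c) * (1 + ‖x‖))) ^ n := by
        gcongr
        nlinarith [norm_nonneg x, mul_nonneg hc (norm_nonneg x)]
    _ = _ := by rw [mul_one, ← mul_assoc, mul_pow (2 * (1 + c)), mul_assoc]

theorem hasTemperateGrowth_gauss {c : ℝ} (hc : 0 ≤ c) :
    (gauss c : E → ℂ).HasTemperateGrowth :=
  ⟨contDiff_gauss c, fun n => ⟨n, _, fun x => norm_iteratedFDeriv_gauss_le_pow hc x le_rfl⟩⟩

/-- For small `c`, the symbol `e^{-c |x|²} - 1` is small together with its derivatives, up to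
polynomial growth. -/
theorem norm_iteratedFDeriv_gauss_sub_one_le {c : ℝ} (hc : 0 ≤ c) (hc1 : c ≤ 1) (x : E) {i n : ℕ}
    (hin : i ≤ n) :
    ‖iteratedFDeriv ℝ i (fun x => gauss c x - 1) x‖ ≤
      (n.factorial * 2 ^ n * √c) * (1 + ‖x‖) ^ (n + 2) := by
  have hs0 := Real.sqrt_nonneg c
  have hs1 : √c ≤ 1 := Real.sqrt_le_one.2 hc1
  have hx := norm_nonneg x
  have hfac : (1 : ℝ) ≤ n.factorial := by exact_mod_cast n.factorial_pos
  rcases Nat.eq_zero_or_pos i with rfl | hi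
  · rw [norm_iteratedFDeriv_zero]
    have h1 : gauss c x - 1 = ((Real.exp (-c * ‖x‖ ^ 2) - 1 : ℝ) : ℂ) := by
      rw [gauss]; push_cast; rfl
    have hnn : 0 ≤ c * ‖x‖ ^ 2 := by positivity
    have h2 : |Real.exp (-c * ‖x‖ ^ 2) - 1| ≤ c * ‖x‖ ^ 2 := by
      rw [abs_le]
      constructor
      · linarith [Real.add_one_le_exp (-c * ‖x‖ ^ 2)]
      · have : Real.exp (-c * ‖x‖ ^ 2) ≤ 1 := Real.exp_le_one_iff.2 (by linarith)
        linarith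
    rw [h1, Complex.norm_real, Real.norm_eq_abs]
    refine h2.trans ?_
    have h3 : c ≤ √c := by nlinarith [Real.mul_self_sqrt hc]
    have h4 : ‖x‖ ^ 2 ≤ (1 + ‖x‖) ^ (n + 2) := by
      calc ‖x‖ ^ 2 ≤ (1 + ‖x‖) ^ 2 := by gcongr; linarith
        _ ≤ _ := pow_le_pow_right₀ (by linarith) (by omega)
    calc c * ‖x‖ ^ 2 ≤ (1 * 1 * √c) * (1 + ‖x‖) ^ (n + 2) := by rw [one_mul, one_mul]; gcongr
      _ ≤ _ := by gcongr; exact one_le_pow₀ (by norm_num)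
  · have h1 : iteratedFDeriv ℝ i (fun x : E => gauss c x - 1) x =
        iteratedFDeriv ℝ i (gauss c : E → ℂ) x := by
      have := iteratedFDeriv_sub_apply (𝕜 := ℝ) (i := i) (x := x) (f := (gauss c : E → ℂ))
        (g := fun _ => (1 : ℂ))
        ((contDiff_gauss c).contDiffAt.of_le (by exact_mod_cast le_top)) contDiffAt_const
      rw [iteratedFDeriv_const_of_ne (by omega)] at this
      rw [Pi.zero_apply, sub_zero] at this
      exact this
    rw [h1]
    refine (norm_iteratedFDeriv_gauss_le hc x i).trans ?_
    have h2 : Real.exp (-c * ‖x‖ ^ 2) ≤ 1 := by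
      rw [Real.exp_le_one_iff, neg_mul]; simp only [Left.neg_nonpos_iff]; positivity
    calc _ ≤ (n.factorial : ℝ) * 1 * (2 * √c * (1 + 1 * ‖x‖)) ^ i := by gcongr
      _ = (n.factorial : ℝ) * (2 ^ i * √c ^ i * (1 + ‖x‖) ^ i) := by
        rw [mul_one, one_mul, mul_pow, mul_pow]
      _ ≤ (n.factorial : ℝ) * (2 ^ n * √c * (1 + ‖x‖) ^ (n + 2)) := by
        gcongr
        · norm_num
        · exact pow_le_of_le_one hs0 hs1 (by omega)
        · linarith
        · omega
      _ = _ := by ring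

theorem one_add_pow_mul_exp_neg_le {c : ℝ} (hc : 0 < c) (m : ℕ) :
    ∃ C : ℝ, ∀ r : ℝ, 0 ≤ r → (1 + r) ^ m * Real.exp (-c * r ^ 2) ≤ C := by
  refine ⟨m.factorial * Real.exp (1 + 1 / (4 * c)), fun r hr => ?_⟩
  have h1 : (1 + r) ^ m ≤ m.factorial * Real.exp (1 + r) := by
    have := Real.pow_div_factorial_le_exp (1 + r) (by linarith) m
    rw [div_le_iff₀ (by positivity)] at this
    linarith
  calc _ ≤ m.factorial * Real.exp (1 + r) * Real.exp (-c * r ^ 2) := by gcongr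
    _ = m.factorial * Real.exp (1 + r + -c * r ^ 2) := by rw [mul_assoc, ← Real.exp_add]
    _ ≤ _ := by
      refine mul_le_mul_of_nonneg_left (Real.exp_le_exp.2 ?_) (by positivity)
      have : 1 / (4 * c) - (r + -c * r ^ 2) = c * (r - 1 / (2 * c)) ^ 2 := by field_simp; ring
      have h2 : 0 ≤ c * (r - 1 / (2 * c)) ^ 2 := by positivity
      linarith

/-- The Gaussian as a Schwartz function. -/
def gaussSchwartz (c : ℝ) (hc : 0 < c) : 𝓢(E, ℂ) where
  toFun := gauss c
  smooth' := contDiff_gauss c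
  decay' := by
    intro k n
    obtain ⟨C, hC⟩ := one_add_pow_mul_exp_neg_le hc (k + n)
    refine ⟨n.factorial * (2 * (1 + c)) ^ n * C, fun x => ?_⟩
    have hx := norm_nonneg x
    have h2 := sqrt_mul_one_add_le hc.le hx
    calc _ ≤ (1 + ‖x‖) ^ k * (n.factorial * Real.exp (-c * ‖x‖ ^ 2) *
          (2 * ((1 + c) * (1 + ‖x‖))) ^ n) := by
          gcongr
          · linarith
          · refine (norm_iteratedFDeriv_gauss_le hc.le x n).trans ?_
            rw [mul_assoc 2 (√c)]
            gcongr
      _ = n.factorial * (2 * (1 + c)) ^ n * ((1 + ‖x‖) ^ (k + n) * Real.exp (-c * ‖x‖ ^ 2)) := by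
          rw [← mul_assoc 2, mul_pow, pow_add]; ring
      _ ≤ _ := by gcongr; exact hC _ hx

theorem gaussSchwartz_apply (c : ℝ) (hc : 0 < c) (x : E) : gaussSchwartz c hc x = gauss c x := rfl

end Gauss

/-! ### The integrals defining the solution operators -/

section HeatIntegral

variable {E : Type*} [NormedAddCommGroup E] [InnerProductSpace ℝ E]

/-- Multiplication by a symbol is bounded in the Schwartz seminorms by finitely many growth constants
of the symbol, uniformly over all symbols. -/
theorem exists_sup_seminorm_smulLeftCLM_le (s : Finset (ℕ × ℕ)) : ∃ n : ℕ, ∀ l : ℕ,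
    ∃ (s' : Finset (ℕ × ℕ)) (C : ℝ), 0 ≤ C ∧ ∀ m : E → ℂ, m.HasTemperateGrowth → ∀ M : ℝ, 0 ≤ M →
      (∀ i ≤ n, ∀ x, ‖iteratedFDeriv ℝ i m x‖ ≤ M * (1 + ‖x‖) ^ l) → ∀ f : 𝓢(E, ℂ),
      s.sup (schwartzSeminormFamily ℂ E ℂ) (SchwartzMap.smulLeftCLM ℂ m f) ≤
        C * M * s'.sup (schwartzSeminormFamily ℂ E ℂ) f := by
  set K := s.sup Prod.fst with hK
  set n := s.sup Prod.snd with hn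
  refine ⟨n, fun l => ⟨Finset.Iic (K + l, n), 2 ^ n * 2 ^ (K + l), by positivity, ?_⟩⟩
  intro m hm M hM hmM f
  set S := (Finset.Iic (K + l, n)).sup (schwartzSeminormFamily ℂ E ℂ) f with hS
  have hS0 : 0 ≤ S := apply_nonneg _ _
  refine Seminorm.finset_sup_apply_le (by positivity) fun kj hkj => ?_
  obtain ⟨k, j⟩ := kj
  have hk : k ≤ K := Finset.le_sup (f := Prod.fst) hkj
  have hj : j ≤ n := Finset.le_sup (f := Prod.snd) hkj
  refine SchwartzMap.seminorm_le_bound ℂ k j _ (by positivity) fun x => ?_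
  have hfun : (SchwartzMap.smulLeftCLM ℂ m f : E → ℂ) = fun x => m x * f x := by
    ext y; simp [hm]
  rw [hfun]
  have hx := norm_nonneg x
  have hmul := norm_iteratedFDeriv_mul_le (𝕜 := ℝ) (N := ((⊤ : ℕ∞) : WithTop ℕ∞)) hm.1
    (f.smooth ⊤) x (n := j) (by exact_mod_cast le_top)
  calc _ ≤ (1 + ‖x‖) ^ K * ∑ i ∈ Finset.range (j + 1), (j.choose i : ℝ) *
        ‖iteratedFDeriv ℝ i m x‖ * ‖iteratedFDeriv ℝ (j - i) f x‖ := by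
        refine mul_le_mul ?_ hmul (norm_nonneg _) (by positivity)
        calc ‖x‖ ^ k ≤ (1 + ‖x‖) ^ k := by gcongr; linarith
          _ ≤ (1 + ‖x‖) ^ K := pow_le_pow_right₀ (by linarith) hk
    _ ≤ ∑ i ∈ Finset.range (j + 1), (j.choose i : ℝ) * (M * (2 ^ (K + l) * S)) := by
        rw [Finset.mul_sum]
        refine Finset.sum_le_sum fun i hi => ?_
        have hij : i ≤ j := by simpa [Nat.lt_succ_iff] using hi
        have h1 := hmM i (hij.trans hj) x
        have h2 : (1 + ‖x‖) ^ (K + l) * ‖iteratedFDeriv ℝ (j - i) f x‖ ≤ 2 ^ (K + l) * S :=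
          SchwartzMap.one_add_le_sup_seminorm_apply (𝕜 := ℂ) (m := (K + l, n)) le_rfl
            (show j - i ≤ n by omega) f x
        calc _ ≤ (1 + ‖x‖) ^ K * ((j.choose i : ℝ) * (M * (1 + ‖x‖) ^ l) *
              ‖iteratedFDeriv ℝ (j - i) f x‖) := by gcongr
          _ = (j.choose i : ℝ) * (M * ((1 + ‖x‖) ^ (K + l) * ‖iteratedFDeriv ℝ (j - i) f x‖)) := by
            rw [pow_add]; ring
          _ ≤ _ := by gcongr
    _ = 2 ^ j * (M * (2 ^ (K + l) * S)) := by
        rw [← Finset.sum_mul, ← Nat.cast_sum, Nat.sum_range_choose]; push_cast; rfl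
    _ ≤ 2 ^ n * (M * (2 ^ (K + l) * S)) := by gcongr; norm_num
    _ = _ := by ring

theorem exists_norm_le_sup_seminorm (L : 𝓢(E, ℂ) →L[ℂ] ℂ) :
    ∃ (s : Finset (ℕ × ℕ)) (C : ℝ), 0 ≤ C ∧ ∀ f : 𝓢(E, ℂ),
      ‖L f‖ ≤ C * s.sup (schwartzSeminormFamily ℂ E ℂ) f := by
  obtain ⟨s, C, -, h⟩ := Seminorm.bound_of_continuous (schwartz_withSeminorms ℂ E ℂ)
    ((normSeminorm ℂ ℂ).comp L.toLinearMap) (continuous_norm.comp L.continuous)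
  exact ⟨s, C, C.2, fun f => h f⟩

theorem exists_sup_seminorm_gauss_le (s : Finset (ℕ × ℕ)) :
    ∃ (s' : Finset (ℕ × ℕ)) (C : ℝ) (n : ℕ), 0 ≤ C ∧ ∀ c : ℝ, 0 ≤ c → ∀ f : 𝓢(E, ℂ),
      s.sup (schwartzSeminormFamily ℂ E ℂ) (SchwartzMap.smulLeftCLM ℂ (gauss c) f) ≤
        C * (1 + c) ^ n * s'.sup (schwartzSeminormFamily ℂ E ℂ) f := by
  obtain ⟨n, hn⟩ := exists_sup_seminorm_smulLeftCLM_le (E := E) s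
  obtain ⟨s', C, hC, h⟩ := hn n
  refine ⟨s', C * (n.factorial * 2 ^ n), n, by positivity, fun c hc f => ?_⟩
  refine (h (gauss c) (hasTemperateGrowth_gauss hc) (n.factorial * (2 * (1 + c)) ^ n)
    (by positivity) (fun i hi x => norm_iteratedFDeriv_gauss_le_pow hc x hi) f).trans (le_of_eq ?_)
  rw [mul_pow]; ring

theorem gauss_add {F : Type*} [NormedAddCommGroup F] (c d : ℝ) :
    (gauss (c + d) : F → ℂ) = gauss c * gauss d := by
  ext x
  simp only [gauss, Pi.mul_apply]
  rw [← Complex.ofReal_mul, ← Real.exp_add]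
  ring_nf

/-- Pairings with `e^{-c |x|²} f` depend continuously on `c`. -/
theorem continuousOn_apply_gauss (L : 𝓢(E, ℂ) →L[ℂ] ℂ) (f : 𝓢(E, ℂ)) :
    ContinuousOn (fun c : ℝ => L (SchwartzMap.smulLeftCLM ℂ (gauss c) f)) (Ici 0) := by
  obtain ⟨s, C₀, hC₀, hL⟩ := exists_norm_le_sup_seminorm L
  obtain ⟨n, hn⟩ := exists_sup_seminorm_smulLeftCLM_le (E := E) s
  obtain ⟨s', C₁, hC₁, h₁⟩ := hn (n + 2)
  obtain ⟨s'', C₂, m, hC₂, h₂⟩ := exists_sup_seminorm_gauss_le (E := E) s'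
  set D := C₀ * (C₁ * (n.factorial * 2 ^ n) * C₂ * s''.sup (schwartzSeminormFamily ℂ E ℂ) f)
    with hD
  have hf0 : 0 ≤ s''.sup (schwartzSeminormFamily ℂ E ℂ) f := apply_nonneg _ _
  have hD0 : 0 ≤ D := by positivity
  have key : ∀ c d : ℝ, 0 ≤ c → 0 ≤ d → d ≤ 1 →
      ‖L (SchwartzMap.smulLeftCLM ℂ (gauss (c + d)) f) - L (SchwartzMap.smulLeftCLM ℂ (gauss c) f)‖
        ≤ D * (1 + c) ^ m * √d := by
    intro c d hc hd hd1
    have hgd : (fun x : E => gauss d x - 1).HasTemperateGrowth :=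
      (hasTemperateGrowth_gauss hd).sub (.const 1)
    have heq : SchwartzMap.smulLeftCLM ℂ (gauss (c + d)) f - SchwartzMap.smulLeftCLM ℂ (gauss c) f =
        SchwartzMap.smulLeftCLM ℂ (fun x : E => gauss d x - 1)
          (SchwartzMap.smulLeftCLM ℂ (gauss c) f) := by
      ext x
      rw [sub_apply, SchwartzMap.smulLeftCLM_apply_apply hgd,
        SchwartzMap.smulLeftCLM_apply_apply (hasTemperateGrowth_gauss hc),
        SchwartzMap.smulLeftCLM_apply_apply (hasTemperateGrowth_gauss (add_nonneg hc hd)),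
        gauss_add, Pi.mul_apply]
      simp only [smul_eq_mul]; ring
    rw [← map_sub, heq]
    have a1 := hL (SchwartzMap.smulLeftCLM ℂ (fun x : E => gauss d x - 1)
      (SchwartzMap.smulLeftCLM ℂ (gauss c) f))
    have a2 := h₁ _ hgd (n.factorial * 2 ^ n * √d) (by positivity)
      (fun i hi x => norm_iteratedFDeriv_gauss_sub_one_le hd hd1 x hi)
      (SchwartzMap.smulLeftCLM ℂ (gauss c) f)
    have a3 := h₂ c hc f
    calc _ ≤ C₀ * (C₁ * (n.factorial * 2 ^ n * √d) *
          (C₂ * (1 + c) ^ m * s''.sup (schwartzSeminormFamily ℂ E ℂ) f)) := by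
          refine a1.trans (mul_le_mul_of_nonneg_left (a2.trans ?_) hC₀)
          exact mul_le_mul_of_nonneg_left a3 (by positivity)
      _ = _ := by rw [hD]; ring
  intro c hc
  rw [mem_Ici] at hc
  rw [ContinuousWithinAt, tendsto_iff_norm_sub_tendsto_zero]
  have hlim : Tendsto (fun c' : ℝ => D * (1 + c) ^ m * √|c' - c|) (𝓝[Ici 0] c) (𝓝 0) := by
    have : ContinuousAt (fun c' : ℝ => D * (1 + c) ^ m * √|c' - c|) c := by fun_prop
    have h := this.tendsto
    simp only [sub_self, abs_zero, Real.sqrt_zero, mul_zero] at h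
    exact h.mono_left nhdsWithin_le_nhds
  refine squeeze_zero' (Eventually.of_forall fun _ => norm_nonneg _) ?_ hlim
  have hnear : ∀ᶠ c' in 𝓝[Ici 0] c, |c' - c| ≤ 1 := by
    have : ∀ᶠ c' in 𝓝 c, |c' - c| < 1 := by
      have := Metric.ball_mem_nhds c one_pos
      filter_upwards [this] with y hy
      rwa [Metric.mem_ball, Real.dist_eq] at hy
    exact (this.filter_mono nhdsWithin_le_nhds).mono fun _ h => h.le
  filter_upwards [hnear, self_mem_nhdsWithin] with c' h1 h0
  rw [mem_Ici] at h0
  rcases le_total c c' with h | h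
  · rw [abs_of_nonneg (by linarith)] at h1 ⊢
    have := key c (c' - c) hc (by linarith) h1
    rwa [add_sub_cancel] at this
  · rw [abs_of_nonpos (by linarith), neg_sub] at h1 ⊢
    have := key c' (c - c') h0 (by linarith) h1
    rw [add_sub_cancel] at this
    rw [norm_sub_rev]
    refine this.trans ?_
    gcongr

variable {N : ℕ}

theorem heat_apply (τ : ℝ) (u : Dist N) (g : 𝓢(Space N, ℂ)) :
    heat τ u g = u (𝓕 (SchwartzMap.smulLeftCLM ℂ (gauss (4 * Real.pi ^ 2 * τ)) (𝓕⁻ g))) := by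
  have : (fun ξ : Space N => ((Real.exp (-τ * ‖(2 * Real.pi) • ξ‖ ^ 2) : ℝ) : ℂ)) =
      gauss (4 * Real.pi ^ 2 * τ) := by
    ext ξ
    rw [gauss, norm_smul, mul_pow, Real.norm_eq_abs, sq_abs]
    ring_nf
  rw [heat, multiplier, this]
  rfl

/-- The integrals defining the solution operators converge for every tempered distribution, because
the pairing with `e^{τΔ} u` grows at most polynomially in `τ`. -/
theorem exists_isDistIntegral {w : ℝ → ℝ}
    (hw : AEStronglyMeasurable w (volume.restrict (Ioi 0)))
    (hmom : ∀ n : ℕ, IntegrableOn (fun θ => |w θ| * (1 + θ) ^ n) (Ioi 0))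
    {τ : ℝ} (hτ : 0 ≤ τ) (u : Dist N) :
    ∃ v : Dist N, IsDistIntegral w (fun θ => heat (τ * θ) u) v := by
  let L : 𝓢(Space N, ℂ) →L[ℂ] ℂ :=
    { toFun := fun f => u (𝓕 f)
      map_add' := fun f g => by rw [FourierTransform.fourier_add, map_add]
      map_smul' := fun a f => by rw [FourierTransform.fourier_smul, map_smul]; rfl
      cont := u.continuous.comp (fourierCLM ℂ 𝓢(Space N, ℂ)).continuous }
  have hheat : ∀ θ g, heat (τ * θ) u g =
      L (SchwartzMap.smulLeftCLM ℂ (gauss (4 * Real.pi ^ 2 * (τ * θ))) (𝓕⁻ g)) :=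
    fun θ g => heat_apply _ u g
  set B : ℝ := 4 * Real.pi ^ 2 * τ with hB
  have hB0 : 0 ≤ B := by positivity
  have harg : ∀ θ, 4 * Real.pi ^ 2 * (τ * θ) = B * θ := fun θ => by rw [hB]; ring
  simp only [harg] at hheat
  obtain ⟨s, C₀, hC₀, hL⟩ := exists_norm_le_sup_seminorm L
  obtain ⟨s', C₁, n, hC₁, h₁⟩ := exists_sup_seminorm_gauss_le (E := Space N) s
  have hbound : ∀ (g : 𝓢(Space N, ℂ)) (θ : ℝ), 0 < θ →
      ‖((w θ : ℝ) : ℂ) * heat (τ * θ) u g‖ ≤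
        (C₀ * C₁ * (1 + B) ^ n * s'.sup (schwartzSeminormFamily ℂ (Space N) ℂ) (𝓕⁻ g)) *
          (|w θ| * (1 + θ) ^ n) := by
    intro g θ hθ
    have hg0 : 0 ≤ s'.sup (schwartzSeminormFamily ℂ (Space N) ℂ) (𝓕⁻ g) := apply_nonneg _ _
    rw [norm_mul, Complex.norm_real, Real.norm_eq_abs, hheat]
    have a1 := (hL _).trans (mul_le_mul_of_nonneg_left
      (h₁ (B * θ) (by positivity) (𝓕⁻ g)) hC₀)
    have a2 : (1 + B * θ) ^ n ≤ ((1 + B) * (1 + θ)) ^ n := by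
      gcongr; nlinarith
    calc _ ≤ |w θ| * (C₀ * (C₁ * ((1 + B) * (1 + θ)) ^ n *
          s'.sup (schwartzSeminormFamily ℂ (Space N) ℂ) (𝓕⁻ g))) := by
          gcongr
          exact a1.trans (by gcongr)
      _ = _ := by rw [mul_pow]; ring
  have hmeas : ∀ g : 𝓢(Space N, ℂ), AEStronglyMeasurable
      (fun θ : ℝ => ((w θ : ℝ) : ℂ) * heat (τ * θ) u g) (volume.restrict (Ioi 0)) := by
    intro g
    refine (Complex.continuous_ofReal.comp_aestronglyMeasurable hw).mul ?_
    refine ContinuousOn.aestronglyMeasurable ?_ measurableSet_Ioi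
    simp only [hheat]
    refine (continuousOn_apply_gauss L (𝓕⁻ g)).comp (by fun_prop) ?_
    intro θ hθ
    exact mul_nonneg hB0 (le_of_lt hθ)
  have hint : ∀ g : 𝓢(Space N, ℂ), IntegrableOn
      (fun θ : ℝ => ((w θ : ℝ) : ℂ) * heat (τ * θ) u g) (Ioi 0) := by
    intro g
    refine Integrable.mono' ((hmom n).const_mul (C₀ * C₁ * (1 + B) ^ n *
      s'.sup (schwartzSeminormFamily ℂ (Space N) ℂ) (𝓕⁻ g))) (hmeas g) ?_
    filter_upwards [ae_restrict_mem measurableSet_Ioi] with θ hθ using hbound g θ hθ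
  let V : 𝓢(Space N, ℂ) →L[ℂ] ℂ := SchwartzMap.mkCLMtoNormedSpace
    (fun g => ∫ θ in Ioi (0 : ℝ), ((w θ : ℝ) : ℂ) * heat (τ * θ) u g)
    (fun f g => by
      rw [← integral_add (hint f) (hint g)]
      simp only [map_add, mul_add])
    (fun a g => by
      simp only [RingHom.id_apply]
      rw [smul_eq_mul, ← integral_const_mul]
      simp only [map_smul, smul_eq_mul]
      congr 1; ext θ; ring)
    (by
      -- the Fourier inversion is absorbed into the seminorms
      obtain ⟨s'', C₂, -, h₂⟩ := Seminorm.bound_of_continuous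
        (schwartz_withSeminorms ℂ (Space N) ℂ)
        ((s'.sup (schwartzSeminormFamily ℂ (Space N) ℂ)).comp
          (fourierInvCLM ℂ 𝓢(Space N, ℂ)).toLinearMap)
        ((Seminorm.continuous_finsetSup fun i _ =>
          (schwartz_withSeminorms ℂ (Space N) ℂ).continuous_seminorm i).comp
          (fourierInvCLM ℂ 𝓢(Space N, ℂ)).continuous)
      set J : ℝ := ∫ θ in Ioi (0 : ℝ), |w θ| * (1 + θ) ^ n with hJ
      have hJ0 : 0 ≤ J := setIntegral_nonneg measurableSet_Ioi fun θ hθ => by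
        have : (0 : ℝ) < θ := hθ
        positivity
      refine ⟨s'', C₀ * C₁ * (1 + B) ^ n * C₂ * J, by positivity, fun g => ?_⟩
      have hle := norm_integral_le_of_norm_le ((hmom n).const_mul
        (C₀ * C₁ * (1 + B) ^ n * s'.sup (schwartzSeminormFamily ℂ (Space N) ℂ) (𝓕⁻ g)))
        (by filter_upwards [ae_restrict_mem measurableSet_Ioi] with θ hθ using hbound g θ hθ)
      refine hle.trans ?_
      rw [integral_const_mul]
      have h3 : s'.sup (schwartzSeminormFamily ℂ (Space N) ℂ) (𝓕⁻ g) ≤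
          C₂ * s''.sup (schwartzSeminormFamily ℂ (Space N) ℂ) g := h₂ g
      calc _ ≤ C₀ * C₁ * (1 + B) ^ n *
            (C₂ * s''.sup (schwartzSeminormFamily ℂ (Space N) ℂ) g) * J := by gcongr
        _ = _ := by ring)
  exact ⟨ContinuousLinearMap.toPointwiseConvergenceCLM _ _ _ _ V, fun g => ⟨hint g, rfl⟩⟩

theorem IsDistIntegral.unique {w : ℝ → ℝ} {U : ℝ → Dist N} {v v' : Dist N}
    (h : IsDistIntegral w U v) (h' : IsDistIntegral w U v') : v = v' := by
  ext g
  rw [(h g).2, (h' g).2]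

theorem IsDistIntegral.add {w : ℝ → ℝ} {U U' : ℝ → Dist N} {v v' : Dist N}
    (h : IsDistIntegral w U v) (h' : IsDistIntegral w U' v') :
    IsDistIntegral w (fun θ => U θ + U' θ) (v + v') := by
  intro g
  have hsum : (fun θ : ℝ => ((w θ : ℝ) : ℂ) * (U θ + U' θ) g) =
      fun θ => ((w θ : ℝ) : ℂ) * U θ g + ((w θ : ℝ) : ℂ) * U' θ g := by
    ext θ; rw [add_apply, mul_add]
  rw [hsum]
  exact ⟨(h g).1.add (h' g).1, by rw [integral_add (h g).1 (h' g).1, ← (h g).2, ← (h' g).2]; rfl⟩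

theorem IsDistIntegral.smul {w : ℝ → ℝ} {U : ℝ → Dist N} {v : Dist N} (a : ℂ)
    (h : IsDistIntegral w U v) : IsDistIntegral w (fun θ => a • U θ) (a • v) := by
  intro g
  have hsum : (fun θ : ℝ => ((w θ : ℝ) : ℂ) * (a • U θ) g) =
      fun θ => a * (((w θ : ℝ) : ℂ) * U θ g) := by
    ext θ; rw [smul_apply, smul_eq_mul]; ring
  rw [hsum]
  exact ⟨(h g).1.const_mul a, by rw [integral_const_mul, ← (h g).2]; rfl⟩

end HeatIntegral

/-! ### Averages of translates on Morrey spaces -/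

section Averages

variable {N : ℕ}

/-- The supremum defining the Morrey norms, over radii `R` from a set `I`. Both Morrey
norms are of this form, with `I = (0, ∞)` and `I = (0, 1]`. -/
def morreySup (I : Set ℝ) (p q : ℝ) (f : Space N → ℂ) : ℝ≥0∞ :=
  ⨆ (x₀ : Space N) (R : ℝ) (_ : R ∈ I),
    ENNReal.ofReal (R ^ ((N : ℝ) / p - (N : ℝ) / q)) *
      eLpNorm f (ENNReal.ofReal q) (volume.restrict (Metric.ball x₀ R))

/-- The Morrey norm of a distribution with radii from `I`. -/
def morreySupNorm (I : Set ℝ) (p q : ℝ) (v : Dist N) : ℝ≥0∞ :=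
  ⨅ (f : Space N → ℂ) (_ : Represents f v), morreySup I p q f

theorem le_morreySup {I : Set ℝ} (p q : ℝ) (f : Space N → ℂ) (x₀ : Space N) {R : ℝ} (hR : R ∈ I) :
    ENNReal.ofReal (R ^ ((N : ℝ) / p - (N : ℝ) / q)) *
      eLpNorm f (ENNReal.ofReal q) (volume.restrict (Metric.ball x₀ R)) ≤ morreySup I p q f :=
  le_iSup_of_le x₀ (le_iSup_of_le R (le_iSup_of_le hR le_rfl))

theorem morreySup_congr_ae {I : Set ℝ} {p q : ℝ} {f g : Space N → ℂ} (h : f =ᵐ[volume] g) :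
    morreySup I p q f = morreySup I p q g := by
  unfold morreySup
  simp only [eLpNorm_congr_ae (ae_restrict_of_ae h)]

theorem morreySup_add_le {I : Set ℝ} {p q : ℝ} (hq : 1 ≤ q) {f g : Space N → ℂ}
    (hf : AEStronglyMeasurable f volume) (hg : AEStronglyMeasurable g volume) :
    morreySup I p q (fun x => f x + g x) ≤ morreySup I p q f + morreySup I p q g := by
  refine iSup_le fun x₀ => iSup_le fun R => iSup_le fun hR => ?_
  refine (mul_le_mul_right (eLpNorm_add_le hf.restrict hg.restrict
    (ENNReal.one_le_ofReal.2 hq)) _).trans ?_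
  rw [mul_add]
  exact add_le_add (le_morreySup p q f x₀ hR) (le_morreySup p q g x₀ hR)

/-- At most polynomial growth in the mean: the translates of Schwartz functions are integrable
against `|f|`, with a bound that is polynomial in the translation. -/
def ModerateGrowth (n : ℕ) (f : Space N → ℂ) : Prop :=
  ∀ g : 𝓢(Space N, ℂ), ∃ M : ℝ≥0∞, M ≠ ∞ ∧
    ∀ a : Space N, ∫⁻ x, ‖f x‖ₑ * ‖g (x + a)‖ₑ ≤ M * (1 + ‖a‖ₑ) ^ n

theorem lintegral_comp_sub_mul (F G : Space N → ℝ≥0∞) (a : Space N) :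
    ∫⁻ x, F (x - a) * G x = ∫⁻ x, F x * G (x + a) := by
  have := lintegral_add_right_eq_self (μ := (volume : Measure (Space N)))
    (fun x => F (x - a) * G x) a
  simpa using this.symm

theorem integral_comp_sub_mul (F G : Space N → ℂ) (a : Space N) :
    ∫ x, F (x - a) * G x = ∫ x, F x * G (x + a) := by
  have := integral_add_right_eq_self (μ := (volume : Measure (Space N)))
    (fun x => F (x - a) * G x) a
  simpa using this.symm

variable {Y : Type*} [MeasurableSpace Y] {ν : Measure Y} [SFinite ν]

/-- The average of the translates `f (· - a y)` with the complex weight `k` is again a function that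
pairs with Schwartz functions, and the pairing is the average of the pairings. -/
theorem average_pairing {n : ℕ} {f : Space N → ℂ} (hf : StronglyMeasurable f)
    (hfn : ModerateGrowth n f) {k : Y → ℂ} (hk : AEStronglyMeasurable k ν) {a : Y → Space N}
    (ha : Measurable a) (hka : ∫⁻ y, ‖k y‖ₑ * (1 + ‖a y‖ₑ) ^ n ∂ν ≠ ∞) :
    AEStronglyMeasurable (fun x => ∫ y, k y * f (x - a y) ∂ν) volume ∧
      ∀ g : 𝓢(Space N, ℂ), Integrable (fun x => g x * ∫ y, k y * f (x - a y) ∂ν) volume ∧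
        Integrable (fun y => k y * ∫ x, f x * g (x + a y)) ν ∧
        ∫ x, g x * ∫ y, k y * f (x - a y) ∂ν = ∫ y, k y * (∫ x, f x * g (x + a y)) ∂ν := by
  have hm : AEStronglyMeasurable (fun z : Y × Space N => k z.1 * f (z.2 - a z.1))
      (ν.prod volume) := by
    refine hk.comp_fst.mul (StronglyMeasurable.aestronglyMeasurable ?_)
    exact hf.comp_measurable (measurable_snd.sub (ha.comp measurable_fst))
  refine ⟨hm.prod_swap.integral_prod_right', fun g => ?_⟩
  have hmg : AEStronglyMeasurable (fun z : Y × Space N => g z.2 * (k z.1 * f (z.2 - a z.1)))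
      (ν.prod volume) :=
    (g.continuous.measurable.comp measurable_snd).aestronglyMeasurable.mul hm
  have hint : Integrable (fun z : Y × Space N => g z.2 * (k z.1 * f (z.2 - a z.1)))
      (ν.prod volume) := by
    refine ⟨hmg, ?_⟩
    rw [hasFiniteIntegral_iff_enorm, lintegral_prod _ hmg.enorm]
    obtain ⟨M, hM, hMa⟩ := hfn g
    calc _ = ∫⁻ y, ‖k y‖ₑ * (∫⁻ x, ‖f x‖ₑ * ‖g (x + a y)‖ₑ) ∂ν := by
          refine lintegral_congr fun y => ?_
          rw [← lintegral_comp_sub_mul (fun x => ‖f x‖ₑ) (fun x => ‖g x‖ₑ) (a y),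
            ← lintegral_const_mul' _ _ enorm_ne_top]
          refine lintegral_congr fun x => ?_
          simp only [enorm_mul]; ring
      _ ≤ ∫⁻ y, M * (‖k y‖ₑ * (1 + ‖a y‖ₑ) ^ n) ∂ν := by
          refine lintegral_mono fun y => ?_
          calc _ ≤ ‖k y‖ₑ * (M * (1 + ‖a y‖ₑ) ^ n) := by gcongr; exact hMa _
            _ = _ := by ring
      _ = M * ∫⁻ y, ‖k y‖ₑ * (1 + ‖a y‖ₑ) ^ n ∂ν := lintegral_const_mul' _ _ hM
      _ < ∞ := ENNReal.mul_lt_top hM.lt_top hka.lt_top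
  have e1 : ∀ x, ∫ y, g x * (k y * f (x - a y)) ∂ν = g x * ∫ y, k y * f (x - a y) ∂ν :=
    fun x => integral_const_mul _ _
  have e2 : ∀ y, ∫ x, g x * (k y * f (x - a y)) = k y * ∫ x, f x * g (x + a y) := by
    intro y
    rw [← integral_comp_sub_mul f g (a y), ← integral_const_mul]
    congr 1; ext x; ring
  have h1 := hint.integral_prod_right
  have h2 := hint.integral_prod_left
  simp only [e1, e2] at h1 h2
  refine ⟨h1, h2, ?_⟩
  have h3 := integral_integral_swap (μ := ν) (ν := (volume : Measure (Space N)))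
    (f := fun y x => g x * (k y * f (x - a y))) hint
  simp only [e1, e2] at h3
  exact h3.symm

/-- Minkowski's inequality for averages of translates, on one ball. -/
theorem eLpNorm_average_le {q : ℝ} (hq : 1 ≤ q) {f : Space N → ℂ} (hf : StronglyMeasurable f)
    {k : Y → ℂ} (hk : AEStronglyMeasurable k ν) {a : Y → Space N} (ha : Measurable a)
    (x₀ : Space N) (R : ℝ) {D : ℝ≥0∞} (hkfin : ∫⁻ y, ‖k y‖ₑ ∂ν ≠ ∞)
    (hD : ∀ z : Space N, eLpNorm f (ENNReal.ofReal q) (volume.restrict (Metric.ball z R)) ≤ D) :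
    eLpNorm (fun x => ∫ y, k y * f (x - a y) ∂ν) (ENNReal.ofReal q)
      (volume.restrict (Metric.ball x₀ R)) ≤ (∫⁻ y, ‖k y‖ₑ ∂ν) * D := by
  have hq0 : 0 < q := by linarith
  have hqo : ENNReal.ofReal q ≠ 0 := by simpa using hq0
  have hqt : (ENNReal.ofReal q).toReal = q := ENNReal.toReal_ofReal hq0.le
  set K := ∫⁻ y, ‖k y‖ₑ ∂ν with hK
  set κ := ν.withDensity (fun y => ‖k y‖ₑ) with hκ
  have hκu : κ univ = K := by rw [hκ, withDensity_apply _ MeasurableSet.univ, Measure.restrict_univ]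
  have hshift : ∀ x : Space N, Measurable fun y => f (x - a y) := fun x =>
    hf.measurable.comp (measurable_const.sub ha)
  have hjoint : Measurable fun z : Space N × Y => f (z.1 - a z.2) :=
    hf.measurable.comp (measurable_fst.sub (ha.comp measurable_snd))
  have hfin : IsFiniteMeasure κ := ⟨by rw [hκu]; exact hkfin.lt_top⟩
  -- Hölder's inequality for the measure `|k| ν`
  have hpt : ∀ x : Space N, ‖∫ y, k y * f (x - a y) ∂ν‖ₑ ^ q ≤
      K ^ (q - 1) * ∫⁻ y, ‖f (x - a y)‖ₑ ^ q ∂κ := by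
    intro x
    have h1 : ‖∫ y, k y * f (x - a y) ∂ν‖ₑ ≤ ∫⁻ y, ‖f (x - a y)‖ₑ ∂κ := by
      refine (enorm_integral_le_lintegral_enorm _).trans (le_of_eq ?_)
      rw [hκ, lintegral_withDensity_eq_lintegral_mul₀ hk.enorm (hshift x).enorm.aemeasurable]
      simp only [enorm_mul, Pi.mul_apply]
    have h2 := eLpNorm_le_eLpNorm_mul_rpow_measure_univ (μ := κ)
      (ENNReal.one_le_ofReal.2 hq) (hshift x).aestronglyMeasurable
    rw [eLpNorm_one_eq_lintegral_enorm, hκu,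
      eLpNorm_eq_lintegral_rpow_enorm_toReal hqo ENNReal.ofReal_ne_top, hqt] at h2
    calc _ ≤ ((∫⁻ y, ‖f (x - a y)‖ₑ ^ q ∂κ) ^ (1 / q) *
          K ^ (1 / (1 : ℝ≥0∞).toReal - 1 / q)) ^ q := by
          gcongr; exact h1.trans h2
      _ = _ := by
          rw [ENNReal.mul_rpow_of_nonneg _ _ hq0.le, ← ENNReal.rpow_mul, ← ENNReal.rpow_mul,
            one_div_mul_cancel hq0.ne', ENNReal.rpow_one, mul_comm]
          congr 2
          simp only [ENNReal.toReal_one]; field_simp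
  have hball : ∀ y, ∫⁻ x in Metric.ball x₀ R, ‖f (x - a y)‖ₑ ^ q ≤ D ^ q := by
    intro y
    have h1 : ∫⁻ x in Metric.ball x₀ R, ‖f (x - a y)‖ₑ ^ q =
        ∫⁻ x in Metric.ball (x₀ - a y) R, ‖f x‖ₑ ^ q := by
      rw [← lintegral_indicator Metric.isOpen_ball.measurableSet,
        ← lintegral_indicator Metric.isOpen_ball.measurableSet]
      refine Eq.trans ?_ (lintegral_sub_right_eq_self _ (a y))
      refine lintegral_congr fun x => ?_
      simp only [indicator, Metric.mem_ball, dist_eq_norm]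
      rw [show x - a y - (x₀ - a y) = x - x₀ by abel]
    have h2 := hD (x₀ - a y)
    rw [eLpNorm_eq_lintegral_rpow_enorm_toReal hqo ENNReal.ofReal_ne_top, hqt] at h2
    rw [h1]
    calc _ = ((∫⁻ x in Metric.ball (x₀ - a y) R, ‖f x‖ₑ ^ q) ^ (1 / q)) ^ q := by
          rw [← ENNReal.rpow_mul, one_div_mul_cancel hq0.ne', ENNReal.rpow_one]
      _ ≤ _ := by gcongr
  rw [eLpNorm_eq_lintegral_rpow_enorm_toReal hqo ENNReal.ofReal_ne_top, hqt]
  have hmain : ∫⁻ x in Metric.ball x₀ R, ‖∫ y, k y * f (x - a y) ∂ν‖ₑ ^ q ≤ (K * D) ^ q := by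
    calc _ ≤ ∫⁻ x in Metric.ball x₀ R, K ^ (q - 1) * ∫⁻ y, ‖f (x - a y)‖ₑ ^ q ∂κ :=
          lintegral_mono fun x => hpt x
      _ = K ^ (q - 1) * ∫⁻ x in Metric.ball x₀ R, ∫⁻ y, ‖f (x - a y)‖ₑ ^ q ∂κ :=
          lintegral_const_mul' _ _ (ENNReal.rpow_ne_top_of_nonneg (by linarith) hkfin)
      _ = K ^ (q - 1) * ∫⁻ y, (∫⁻ x in Metric.ball x₀ R, ‖f (x - a y)‖ₑ ^ q) ∂κ := by
          rw [lintegral_lintegral_swap]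
          exact (hjoint.enorm.pow_const q).aemeasurable
      _ ≤ K ^ (q - 1) * ∫⁻ _, D ^ q ∂κ := by gcongr with y; exact hball y
      _ = K ^ (q - 1) * (D ^ q * K) := by rw [lintegral_const, hκu]
      _ = (K * D) ^ q := by
          rw [ENNReal.mul_rpow_of_nonneg _ _ hq0.le]
          have : K ^ q = K ^ (q - 1) * K := by
            nth_rewrite 3 [← ENNReal.rpow_one K]
            rw [← ENNReal.rpow_add_of_nonneg _ _ (by linarith) zero_le_one, sub_add_cancel]
          rw [this]; ring
  calc _ ≤ ((K * D) ^ q) ^ (1 / q) := by gcongr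
    _ = _ := by rw [← ENNReal.rpow_mul, mul_one_div_cancel hq0.ne', ENNReal.rpow_one]

theorem morreySup_average_le {I : Set ℝ} {p q : ℝ} (hq : 1 ≤ q) {f : Space N → ℂ}
    (hf : StronglyMeasurable f) {k : Y → ℂ} (hk : AEStronglyMeasurable k ν) {a : Y → Space N}
    (ha : Measurable a) (hkfin : ∫⁻ y, ‖k y‖ₑ ∂ν ≠ ∞) :
    morreySup I p q (fun x => ∫ y, k y * f (x - a y) ∂ν) ≤
      (∫⁻ y, ‖k y‖ₑ ∂ν) * morreySup I p q f := by
  refine iSup_le fun x₀ => iSup_le fun R => iSup_le fun hR => ?_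
  refine (mul_le_mul_right (eLpNorm_average_le hq hf hk ha x₀ R hkfin
    (fun z => le_iSup (fun z => eLpNorm f (ENNReal.ofReal q)
      (volume.restrict (Metric.ball z R))) z)) _).trans ?_
  rw [mul_left_comm, ENNReal.mul_iSup]
  gcongr
  exact iSup_le fun z => le_morreySup p q f z hR

theorem exists_norm_le_one_add_norm_rpow (g : 𝓢(Space N, ℂ)) (m : ℕ) :
    ∃ C : ℝ, 0 ≤ C ∧ ∀ x, ‖g x‖ ≤ C * (1 + ‖x‖) ^ (-(m : ℝ)) := by
  refine ⟨2 ^ m * (Finset.Iic (m, 0)).sup (schwartzSeminormFamily ℂ (Space N) ℂ) g,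
    mul_nonneg (by positivity) (apply_nonneg _ _), fun x => ?_⟩
  have h := SchwartzMap.one_add_le_sup_seminorm_apply (𝕜 := ℂ) (m := (m, 0)) (le_refl m)
    (le_refl 0) g x
  rw [norm_iteratedFDeriv_zero] at h
  have hx : 0 < 1 + ‖x‖ := by positivity
  rw [Real.rpow_neg hx.le, Real.rpow_natCast, ← div_eq_mul_inv, le_div_iff₀ (by positivity),
    mul_comm]
  exact h

/-- Functions in a local Morrey space are uniformly locally integrable, hence their pairings with
translates of a Schwartz function are bounded. -/
theorem moderateGrowth_of_locMorrey {p q : ℝ} (hq : 1 ≤ q) {f : Space N → ℂ}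
    (hf : StronglyMeasurable f) (hfin : morreySup (Ioc 0 1) p q f ≠ ∞) : ModerateGrowth 0 f := by
  intro g
  have hq0 : 0 < q := by linarith
  have hunif : ∃ M : ℝ≥0∞, M ≠ ∞ ∧ ∀ z, ∫⁻ x in Metric.ball z 1, ‖f x‖ₑ ≤ M := by
    refine ⟨morreySup (Ioc 0 1) p q f * volume (Metric.ball (0 : Space N) 1) ^ (1 - 1 / q),
      ENNReal.mul_ne_top hfin (ENNReal.rpow_ne_top_of_nonneg
        (sub_nonneg.2 ((div_le_one hq0).2 hq)) measure_ball_lt_top.ne), fun z => ?_⟩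
    have h1 := eLpNorm_le_eLpNorm_mul_rpow_measure_univ
      (μ := (volume : Measure (Space N)).restrict (Metric.ball z 1))
      (ENNReal.one_le_ofReal.2 hq) hf.aestronglyMeasurable
    rw [eLpNorm_one_eq_lintegral_enorm, ENNReal.toReal_one, ENNReal.toReal_ofReal hq0.le,
      Measure.restrict_apply_univ, Measure.addHaar_ball_center volume z 1, div_one] at h1
    refine h1.trans ?_
    gcongr
    have h2 := le_morreySup (I := Ioc 0 1) p q f z (R := 1) ⟨one_pos, le_rfl⟩
    rwa [Real.one_rpow, ENNReal.ofReal_one, one_mul] at h2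
  obtain ⟨M, hM, hMz⟩ := hunif
  obtain ⟨C, hC, hgC⟩ := exists_norm_le_one_add_norm_rpow g (N + 1)
  set P : Space N → ℝ≥0∞ := fun z =>
    ENNReal.ofReal (C * 2 ^ (N + 1) * (1 + ‖z‖) ^ (-((N + 1 : ℕ) : ℝ))) with hP
  have hPm : Measurable P := by
    refine ENNReal.measurable_ofReal.comp ?_
    exact Measurable.const_mul ((measurable_const.add measurable_norm).pow_const _) _
  have hPfin : ∫⁻ z, P z ≠ ∞ := by
    have hi : Integrable (fun z : Space N =>
        C * 2 ^ (N + 1) * (1 + ‖z‖) ^ (-((N + 1 : ℕ) : ℝ))) volume :=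
      (integrable_one_add_norm (by simp)).const_mul _
    exact hi.lintegral_lt_top.ne
  set V := volume (Metric.ball (0 : Space N) 1) with hV
  have hV0 : V ≠ 0 := (Metric.measure_ball_pos volume _ one_pos).ne'
  have hVt : V ≠ ∞ := measure_ball_lt_top.ne
  set χ : Space N → ℝ≥0∞ := (Metric.ball (0 : Space N) 1).indicator 1 with hχ
  have hχm : Measurable χ := measurable_one.indicator Metric.isOpen_ball.measurableSet
  refine ⟨V⁻¹ * ((∫⁻ z, P z) * M), ENNReal.mul_ne_top (ENNReal.inv_ne_top.2 hV0)
    (ENNReal.mul_ne_top hPfin hM), fun a => ?_⟩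
  -- the majorant `P` of `g` varies by a bounded factor on unit balls
  have hpt : ∀ x, V * ‖g (x + a)‖ₑ ≤ ∫⁻ z, χ (x - z) * P (z + a) := by
    intro x
    have h1 : ∀ z, χ (x - z) * ‖g (x + a)‖ₑ ≤ χ (x - z) * P (z + a) := by
      intro z
      by_cases hz : x - z ∈ Metric.ball (0 : Space N) 1
      · gcongr
        rw [← ofReal_norm]
        refine ENNReal.ofReal_le_ofReal ((hgC _).trans ?_)
        rw [mem_ball_zero_iff] at hz
        have h2 : 1 + ‖z + a‖ ≤ 2 * (1 + ‖x + a‖) := by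
          have : ‖z + a‖ ≤ ‖x + a‖ + ‖x - z‖ := by
            calc ‖z + a‖ = ‖(x + a) - (x - z)‖ := by congr 1; abel
              _ ≤ _ := norm_sub_le _ _
          have := norm_nonneg (x + a)
          linarith
        have h3 : (1 + ‖x + a‖) ^ (-((N + 1 : ℕ) : ℝ)) ≤
            2 ^ (N + 1) * (1 + ‖z + a‖) ^ (-((N + 1 : ℕ) : ℝ)) := by
          rw [Real.rpow_neg (by positivity), Real.rpow_neg (by positivity), Real.rpow_natCast,
            Real.rpow_natCast, ← div_eq_mul_inv, inv_eq_one_div,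
            div_le_div_iff₀ (by positivity) (by positivity), one_mul, ← mul_pow]
          gcongr
        calc _ ≤ C * (2 ^ (N + 1) * (1 + ‖z + a‖) ^ (-((N + 1 : ℕ) : ℝ))) := by gcongr
          _ = _ := by ring
      · rw [hχ, indicator_of_notMem hz, zero_mul, zero_mul]
    have h4 : ∫⁻ z, χ (x - z) = V := by
      rw [lintegral_sub_left_eq_self χ x, hχ, lintegral_indicator Metric.isOpen_ball.measurableSet]
      simp [hV]
    calc _ = ∫⁻ z, χ (x - z) * ‖g (x + a)‖ₑ := by
          rw [lintegral_mul_const' _ _ enorm_ne_top, h4]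
      _ ≤ _ := lintegral_mono h1
  have hM' : ∀ z, ∫⁻ x, ‖f x‖ₑ * χ (x - z) ≤ M := by
    intro z
    refine le_trans (le_of_eq ?_) (hMz z)
    rw [← lintegral_indicator Metric.isOpen_ball.measurableSet]
    refine lintegral_congr fun x => ?_
    simp only [hχ, indicator, Metric.mem_ball, dist_eq_norm, sub_zero, Pi.one_apply, mul_ite,
      mul_one, mul_zero]
  have hjm : Measurable fun w : Space N × Space N => ‖f w.1‖ₑ * (χ (w.1 - w.2) * P (w.2 + a)) :=
    (hf.measurable.comp measurable_fst).enorm.mul ((hχm.comp (measurable_fst.sub measurable_snd)).mul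
      (hPm.comp (measurable_snd.add_const a)))
  have hkey : V * ∫⁻ x, ‖f x‖ₑ * ‖g (x + a)‖ₑ ≤ (∫⁻ z, P z) * M := by
    calc _ = ∫⁻ x, ‖f x‖ₑ * (V * ‖g (x + a)‖ₑ) := by
          rw [← lintegral_const_mul' _ _ hVt]
          exact lintegral_congr fun x => by ring
      _ ≤ ∫⁻ x, ‖f x‖ₑ * ∫⁻ z, χ (x - z) * P (z + a) := by gcongr with x; exact hpt x
      _ = ∫⁻ x, ∫⁻ z, ‖f x‖ₑ * (χ (x - z) * P (z + a)) :=
          lintegral_congr fun x => (lintegral_const_mul' _ _ enorm_ne_top).symm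
      _ = ∫⁻ z, ∫⁻ x, ‖f x‖ₑ * (χ (x - z) * P (z + a)) :=
          lintegral_lintegral_swap hjm.aemeasurable
      _ = ∫⁻ z, P (z + a) * ∫⁻ x, ‖f x‖ₑ * χ (x - z) := by
          refine lintegral_congr fun z => ?_
          rw [← lintegral_const_mul' _ _ ENNReal.ofReal_ne_top]
          exact lintegral_congr fun x => by ring
      _ ≤ ∫⁻ z, P (z + a) * M := by gcongr with z; exact hM' z
      _ = (∫⁻ z, P z) * M := by
          rw [lintegral_mul_const' _ _ hM, lintegral_add_right_eq_self P a]
  rw [pow_zero, mul_one]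
  calc _ = V⁻¹ * (V * ∫⁻ x, ‖f x‖ₑ * ‖g (x + a)‖ₑ) := by
        rw [← mul_assoc, ENNReal.inv_mul_cancel hV0 hVt, one_mul]
    _ ≤ _ := by gcongr

end Averages

/-! ### Dilated Schwartz multipliers as averages of translates -/

section Dilates

variable {N : ℕ}

theorem hasTemperateGrowth_dilate (b : 𝓢(Space N, ℂ)) (ρ : ℝ) :
    (fun ξ : Space N => b (ρ • ξ)).HasTemperateGrowth :=
  b.hasTemperateGrowth.comp (ρ • ContinuousLinearMap.id ℝ (Space N)).hasTemperateGrowth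

/-- The Fourier multiplier with symbol `ξ ↦ b (ρ ξ)`, for a Schwartz function `b`. -/
def dilMul (b : 𝓢(Space N, ℂ)) (ρ : ℝ) (u : Dist N) : Dist N :=
  TemperedDistribution.fourierMultiplierCLM ℂ (fun ξ : Space N => b (ρ • ξ)) u

theorem dilMul_apply (b : 𝓢(Space N, ℂ)) (ρ : ℝ) (u : Dist N) (g : 𝓢(Space N, ℂ)) :
    dilMul b ρ u g = u (𝓕 (SchwartzMap.smulLeftCLM ℂ (fun ξ : Space N => b (ρ • ξ)) (𝓕⁻ g))) :=
  rfl

/-- On test functions, the transpose of the multiplier `b (ρ ·)` is an average of translates with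
weight `𝓕⁻ b`. -/
theorem fourier_smulLeft_dilate_apply (b : 𝓢(Space N, ℂ)) (ρ : ℝ) (g : 𝓢(Space N, ℂ))
    (x : Space N) :
    (𝓕 (SchwartzMap.smulLeftCLM ℂ (fun ξ : Space N => b (ρ • ξ)) (𝓕⁻ g))) x =
      ∫ y, (𝓕⁻ b) y * g (x + ρ • y) := by
  set B : 𝓢(Space N, ℂ) := 𝓕⁻ b with hB
  set G : 𝓢(Space N, ℂ) := 𝓕⁻ g with hG
  have hb : b = 𝓕 B := (FourierTransform.fourier_fourierInv_eq b).symm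
  have hg : g = 𝓕 G := (FourierTransform.fourier_fourierInv_eq g).symm
  set h : Space N → ℂ := fun ξ => Real.fourierChar (-inner ℝ ξ x) • G ξ with hh
  set L : Space N →ₗ[ℝ] Space N →ₗ[ℝ] ℝ := ρ • innerₗ (Space N) with hL
  have hLc : Continuous fun p : Space N × Space N => L p.1 p.2 := by
    simp only [hL, LinearMap.smul_apply, innerₗ_apply_apply]
    fun_prop
  have hhi : Integrable h volume := by
    have hc : Continuous h := by
      refine Continuous.smul ?_ G.continuous
      have hi : Continuous fun ξ : Space N => -inner ℝ ξ x := by fun_prop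
      exact continuous_subtype_val.comp (Real.continuous_fourierChar.comp hi)
    refine G.integrable.norm.mono' hc.aestronglyMeasurable (ae_of_all _ fun ξ => ?_)
    rw [hh]; simp
  have key := VectorFourier.integral_fourierIntegral_smul_eq_flip (μ := volume) (ν := volume)
    (L := L) (f := (B : Space N → ℂ)) (g := h) Real.continuous_fourierChar hLc B.integrable hhi
  have e1 : ∀ ξ, VectorFourier.fourierIntegral Real.fourierChar volume L (B : Space N → ℂ) ξ =
      b (ρ • ξ) := by
    intro ξ
    rw [hb, SchwartzMap.fourier_coe, Real.fourier_eq, VectorFourier.fourierIntegral]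
    simp only [hL, LinearMap.smul_apply, innerₗ_apply_apply, inner_smul_right, smul_eq_mul]
  have e2 : ∀ y, VectorFourier.fourierIntegral Real.fourierChar volume L.flip h y =
      g (x + ρ • y) := by
    intro y
    rw [hg, SchwartzMap.fourier_coe, Real.fourier_eq, VectorFourier.fourierIntegral]
    refine integral_congr_ae (ae_of_all _ fun ξ => ?_)
    simp only [hL, hh, LinearMap.flip_apply, LinearMap.smul_apply, innerₗ_apply_apply]
    rw [smul_smul, ← AddChar.map_add_eq_mul, inner_add_right, inner_smul_right, smul_eq_mul,
      real_inner_comm ξ y]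
    congr 2; ring
  simp only [e1, e2, smul_eq_mul] at key
  rw [← key, SchwartzMap.fourier_coe, Real.fourier_eq]
  refine integral_congr_ae (ae_of_all _ fun ξ => ?_)
  simp only [hh]
  rw [SchwartzMap.smulLeftCLM_apply_apply (hasTemperateGrowth_dilate b ρ), smul_eq_mul,
    mul_smul_comm]

theorem lintegral_schwartz_moment_ne_top (B : 𝓢(Space N, ℂ)) (n : ℕ) :
    ∫⁻ y, ‖B y‖ₑ * (1 + ‖y‖ₑ) ^ n ≠ ∞ := by
  have hi : Integrable (fun y : Space N => ‖B y‖ * (1 + ‖y‖) ^ n) volume := by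
    have : ∀ y : Space N, ‖B y‖ * (1 + ‖y‖) ^ n =
        ∑ i ∈ Finset.range (n + 1), (n.choose i : ℝ) * (‖y‖ ^ i * ‖B y‖) := by
      intro y
      rw [add_comm, add_pow, Finset.mul_sum]
      refine Finset.sum_congr rfl fun i _ => ?_
      rw [one_pow]; ring
    simp only [this]
    exact integrable_finsetSum _ fun i _ => (B.integrable_pow_mul volume i).const_mul _
  have h := hi.lintegral_lt_top.ne
  convert h using 3 with y
  rw [ENNReal.ofReal_mul (norm_nonneg _), ENNReal.ofReal_pow (by positivity),
    ENNReal.ofReal_add zero_le_one (norm_nonneg _), ofReal_norm, ofReal_norm, ENNReal.ofReal_one]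

theorem one_add_enorm_smul_pow_le (r : ℝ) (y : Space N) (n : ℕ) :
    (1 + ‖r • y‖ₑ) ^ n ≤ (1 + ‖r‖ₑ) ^ n * (1 + ‖y‖ₑ) ^ n := by
  rw [← mul_pow, enorm_smul]
  gcongr
  calc 1 + ‖r‖ₑ * ‖y‖ₑ ≤ (1 + ‖r‖ₑ * ‖y‖ₑ) + (‖r‖ₑ + ‖y‖ₑ) := le_self_add
    _ = _ := by ring

/-- A Schwartz multiplier acts on a distribution that is a function by averaging the translates of
the function. -/
theorem dilMul_apply_of_represents {n : ℕ} {f : Space N → ℂ} (hf : StronglyMeasurable f)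
    (hfn : ModerateGrowth n f) {v : Dist N} (hv : Represents f v) (b : 𝓢(Space N, ℂ)) (ρ : ℝ)
    (g : 𝓢(Space N, ℂ)) :
    dilMul b ρ v g = ∫ y, (𝓕⁻ b) y * ∫ x, f x * g (x + ρ • y) := by
  set B : 𝓢(Space N, ℂ) := 𝓕⁻ b with hB
  have hmeas : AEStronglyMeasurable (fun z : Space N × Space N =>
      B z.1 * (f z.2 * g (z.2 + ρ • z.1))) (volume.prod volume) := by
    refine (Measurable.mul (B.continuous.measurable.comp measurable_fst)
      ((hf.measurable.comp measurable_snd).mul ?_)).aestronglyMeasurable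
    exact g.continuous.measurable.comp (measurable_snd.add (measurable_fst.const_smul ρ))
  have hint : Integrable (fun z : Space N × Space N =>
      B z.1 * (f z.2 * g (z.2 + ρ • z.1))) (volume.prod volume) := by
    refine ⟨hmeas, ?_⟩
    rw [hasFiniteIntegral_iff_enorm, lintegral_prod _ hmeas.enorm]
    obtain ⟨M, hM, hMa⟩ := hfn g
    calc _ = ∫⁻ y, ‖B y‖ₑ * ∫⁻ x, ‖f x‖ₑ * ‖g (x + ρ • y)‖ₑ := by
          refine lintegral_congr fun y => ?_
          rw [← lintegral_const_mul' _ _ enorm_ne_top]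
          simp only [enorm_mul]
      _ ≤ ∫⁻ y, (M * (1 + ‖ρ‖ₑ) ^ n) * (‖B y‖ₑ * (1 + ‖y‖ₑ) ^ n) := by
          refine lintegral_mono fun y => ?_
          calc _ ≤ ‖B y‖ₑ * (M * ((1 + ‖ρ‖ₑ) ^ n * (1 + ‖y‖ₑ) ^ n)) := by
                gcongr
                exact (hMa _).trans (mul_le_mul_right (one_add_enorm_smul_pow_le ρ y n) _)
            _ = _ := by ring
      _ = (M * (1 + ‖ρ‖ₑ) ^ n) * ∫⁻ y, ‖B y‖ₑ * (1 + ‖y‖ₑ) ^ n :=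
          lintegral_const_mul' _ _ (ENNReal.mul_ne_top hM (ENNReal.pow_ne_top (by simp)))
      _ < ∞ := ENNReal.mul_lt_top (ENNReal.mul_lt_top hM.lt_top
          (ENNReal.pow_lt_top (by simp))) (lintegral_schwartz_moment_ne_top B n).lt_top
  rw [dilMul_apply, (hv.2 _).2]
  have h := integral_integral_swap (μ := (volume : Measure (Space N)))
    (ν := (volume : Measure (Space N))) (f := fun y x => B y * (f x * g (x + ρ • y))) hint
  simp only [integral_const_mul] at h
  rw [h]
  refine integral_congr_ae (ae_of_all _ fun x => ?_)
  simp only [fourier_smulLeft_dilate_apply]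
  rw [← integral_mul_const]
  refine integral_congr_ae (ae_of_all _ fun y => ?_)
  simp only; ring

/-- The function `∫_0^∞ ω(θ) (B_{ρ(θ)} * f) dθ`, where `B_ρ` is the `L¹`-normalized dilate of `B`. -/
def dilAverage (ω ρ : ℝ → ℝ) (B f : Space N → ℂ) (x : Space N) : ℂ :=
  ∫ z : ℝ × Space N, ((ω z.1 : ℂ) * B z.2) * f (x - ρ z.1 • z.2)
    ∂((volume.restrict (Ioi (0 : ℝ))).prod volume)

theorem aestronglyMeasurable_dilAverage_kernel (B : 𝓢(Space N, ℂ)) {ω : ℝ → ℝ}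
    (hω : AEStronglyMeasurable ω (volume.restrict (Ioi 0))) :
    AEStronglyMeasurable (fun z : ℝ × Space N => (ω z.1 : ℂ) * B z.2)
      ((volume.restrict (Ioi (0 : ℝ))).prod volume) :=
  (Complex.continuous_ofReal.comp_aestronglyMeasurable hω.comp_fst).mul
    (B.continuous.measurable.comp measurable_snd).aestronglyMeasurable

theorem lintegral_dilAverage_kernel_ne_top (B : 𝓢(Space N, ℂ)) {ω ρ : ℝ → ℝ} {n : ℕ}
    (hω : AEStronglyMeasurable ω (volume.restrict (Ioi 0))) (hρ : Measurable ρ)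
    (hωρ : ∫⁻ θ in Ioi 0, ‖ω θ‖ₑ * (1 + ‖ρ θ‖ₑ) ^ n ≠ ∞) :
    ∫⁻ z : ℝ × Space N, ‖(ω z.1 : ℂ) * B z.2‖ₑ * (1 + ‖ρ z.1 • z.2‖ₑ) ^ n
      ∂((volume.restrict (Ioi (0 : ℝ))).prod volume) ≠ ∞ := by
  refine ne_top_of_le_ne_top (ENNReal.mul_ne_top hωρ (lintegral_schwartz_moment_ne_top B n)) ?_
  have hBm : Measurable fun y : Space N => ‖B y‖ₑ * (1 + ‖y‖ₑ) ^ n :=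
    B.continuous.measurable.enorm.mul ((measurable_enorm.const_add 1).pow_const n)
  rw [← lintegral_prod_mul (μ := volume.restrict (Ioi (0 : ℝ)))
    (f := fun θ => ‖ω θ‖ₑ * (1 + ‖ρ θ‖ₑ) ^ n)
    (hω.enorm.mul (((hρ.enorm.const_add 1).pow_const n).aemeasurable)) hBm.aemeasurable]
  refine lintegral_mono fun z => ?_
  rw [enorm_mul]
  calc _ ≤ ‖(ω z.1 : ℂ)‖ₑ * ‖B z.2‖ₑ * ((1 + ‖ρ z.1‖ₑ) ^ n * (1 + ‖z.2‖ₑ) ^ n) := by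
        gcongr; exact one_add_enorm_smul_pow_le _ _ _
    _ = _ := by
        have : ‖(ω z.1 : ℂ)‖ₑ = ‖ω z.1‖ₑ := by
          rw [← ofReal_norm, ← ofReal_norm, Complex.norm_real]
        rw [this]; ring

/-- An integral over `θ` of dilated multipliers, applied to a function, is a function. -/
theorem represents_dilAverage {n : ℕ} {f : Space N → ℂ} (hf : StronglyMeasurable f)
    (hfn : ModerateGrowth n f) {v : Dist N} (hv : Represents f v) (b : 𝓢(Space N, ℂ))
    {ω ρ : ℝ → ℝ} (hω : AEStronglyMeasurable ω (volume.restrict (Ioi 0))) (hρ : Measurable ρ)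
    (hωρ : ∫⁻ θ in Ioi 0, ‖ω θ‖ₑ * (1 + ‖ρ θ‖ₑ) ^ n ≠ ∞) {z : Dist N}
    (hz : IsDistIntegral ω (fun θ => dilMul b (ρ θ) v) z) :
    Represents (dilAverage ω ρ (𝓕⁻ b : 𝓢(Space N, ℂ)) f) z := by
  set B : 𝓢(Space N, ℂ) := 𝓕⁻ b with hB
  have hk := aestronglyMeasurable_dilAverage_kernel B hω
  have ha : Measurable (fun z : ℝ × Space N => ρ z.1 • z.2) :=
    (hρ.comp measurable_fst).smul measurable_snd
  have hka := lintegral_dilAverage_kernel_ne_top B hω hρ hωρ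
  obtain ⟨h1, h2⟩ := average_pairing hf hfn hk ha hka
  refine ⟨h1, fun g => ⟨(h2 g).1, ?_⟩⟩
  change z g = ∫ x, g x * ∫ z : ℝ × Space N, ((ω z.1 : ℂ) * B z.2) * f (x - ρ z.1 • z.2)
    ∂((volume.restrict (Ioi (0 : ℝ))).prod volume)
  rw [(h2 g).2.2, (hz g).2, integral_prod _ (h2 g).2.1]
  refine integral_congr_ae (ae_of_all _ fun θ => ?_)
  simp only [dilMul_apply_of_represents hf hfn hv, mul_assoc]
  rw [integral_const_mul]

theorem morreySup_dilAverage_le {I : Set ℝ} {p q : ℝ} (hq : 1 ≤ q) {f : Space N → ℂ}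
    (hf : StronglyMeasurable f) (B : 𝓢(Space N, ℂ)) {ω ρ : ℝ → ℝ}
    (hω : AEStronglyMeasurable ω (volume.restrict (Ioi 0))) (hρ : Measurable ρ)
    (hωfin : ∫⁻ θ in Ioi 0, ‖ω θ‖ₑ ≠ ∞) :
    morreySup I p q (dilAverage ω ρ B f) ≤
      (∫⁻ θ in Ioi 0, ‖ω θ‖ₑ) * (∫⁻ y, ‖B y‖ₑ) * morreySup I p q f := by
  have hk := aestronglyMeasurable_dilAverage_kernel B hω
  have ha : Measurable (fun z : ℝ × Space N => ρ z.1 • z.2) :=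
    (hρ.comp measurable_fst).smul measurable_snd
  have hB : ∫⁻ y, ‖B y‖ₑ ≠ ∞ := by
    simpa using lintegral_schwartz_moment_ne_top B 0
  have hprod : ∫⁻ z : ℝ × Space N, ‖(ω z.1 : ℂ) * B z.2‖ₑ
      ∂((volume.restrict (Ioi (0 : ℝ))).prod volume) =
      (∫⁻ θ in Ioi 0, ‖ω θ‖ₑ) * ∫⁻ y, ‖B y‖ₑ := by
    rw [← lintegral_prod_mul hω.enorm (by fun_prop)]
    refine lintegral_congr fun z => ?_
    rw [enorm_mul]
    congr 1
    rw [← ofReal_norm, ← ofReal_norm, Complex.norm_real]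
  rw [← hprod]
  exact morreySup_average_le hq hf hk ha (by rw [hprod]; exact ENNReal.mul_ne_top hωfin hB)

theorem Represents.exists_stronglyMeasurable {f : Space N → ℂ} {v : Dist N} (h : Represents f v) :
    ∃ f' : Space N → ℂ, StronglyMeasurable f' ∧ Represents f' v ∧
      ∀ I p q, morreySup I p q f' = morreySup I p q f := by
  have hae := h.1.ae_eq_mk
  refine ⟨h.1.mk f, h.1.stronglyMeasurable_mk, ⟨h.1.stronglyMeasurable_mk.aestronglyMeasurable,
    fun g => ?_⟩, fun I p q => morreySup_congr_ae hae.symm⟩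
  have hae' : (fun x => g x * f x) =ᵐ[volume] fun x => g x * h.1.mk f x := by
    filter_upwards [hae] with x hx
    rw [hx]
  exact ⟨(h.2 g).1.congr hae', by rw [(h.2 g).2, integral_congr_ae hae']⟩

/-- A constant that bounds the dilates of the multiplier `b` on Morrey spaces: the `L¹` norm of the
kernel, increased to be positive. -/
def kernelConst (b : 𝓢(Space N, ℂ)) : ℝ≥0∞ := (∫⁻ y, ‖(𝓕⁻ b) y‖ₑ) + 1

theorem kernelConst_ne_zero (b : 𝓢(Space N, ℂ)) : kernelConst b ≠ 0 := by simp [kernelConst]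

theorem kernelConst_ne_top (b : 𝓢(Space N, ℂ)) : kernelConst b ≠ ∞ := by
  have : ∫⁻ y, ‖(𝓕⁻ b) y‖ₑ ≠ ∞ := by
    simpa using lintegral_schwartz_moment_ne_top (𝓕⁻ b : 𝓢(Space N, ℂ)) 0
  simpa [kernelConst] using this

theorem morreySup_mono {I J : Set ℝ} (h : I ⊆ J) (p q : ℝ) (f : Space N → ℂ) :
    morreySup I p q f ≤ morreySup J p q f :=
  iSup_le fun x₀ => iSup_le fun _ => iSup_le fun hR => le_morreySup p q f x₀ (h hR)

theorem morreySupNorm_le (I : Set ℝ) (p q : ℝ) {f : Space N → ℂ} {v : Dist N}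
    (h : Represents f v) : morreySupNorm I p q v ≤ morreySup I p q f :=
  iInf₂_le_of_le f h le_rfl

/-- To bound a quantity by a multiple of the norm, it suffices to consider representing functions for
which the integrals against translates of Schwartz functions converge. -/
theorem le_mul_morreySupNorm {I : Set ℝ} (hI : Ioc 0 1 ⊆ I) {p q : ℝ} (hq : 1 ≤ q) {C S : ℝ≥0∞}
    (hC0 : C ≠ 0) (hCt : C ≠ ∞) {v : Dist N}
    (h : ∀ f : Space N → ℂ, StronglyMeasurable f → ModerateGrowth 0 f → Represents f v →
      S ≤ C * morreySup I p q f) : S ≤ C * morreySupNorm I p q v := by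
  unfold morreySupNorm
  simp only [ENNReal.mul_iInf_of_ne hC0 hCt]
  refine le_iInf fun f => le_iInf fun hf => ?_
  by_cases htop : morreySup I p q f = ∞
  · rw [htop, ENNReal.mul_top hC0]; exact le_top
  · obtain ⟨f', h1, h2, h3⟩ := hf.exists_stronglyMeasurable
    rw [← h3]
    refine h f' h1 (moderateGrowth_of_locMorrey (p := p) hq h1 ?_) h2
    refine ne_top_of_le_ne_top htop ?_
    rw [← h3]
    exact morreySup_mono hI p q f'

/-- Integrals of dilated multipliers are bounded on Morrey spaces. -/
theorem morreySupNorm_distIntegral_dilMul_le {I : Set ℝ} (hI : Ioc 0 1 ⊆ I) {p q : ℝ} (hq : 1 ≤ q)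
    (b : 𝓢(Space N, ℂ)) {ω ρ : ℝ → ℝ} (hω : AEStronglyMeasurable ω (volume.restrict (Ioi 0)))
    (hρ : Measurable ρ) {W : ℝ≥0∞} (hW0 : W ≠ 0) (hWt : W ≠ ∞) (hωW : ∫⁻ θ in Ioi 0, ‖ω θ‖ₑ ≤ W)
    {v z : Dist N} (hz : IsDistIntegral ω (fun θ => dilMul b (ρ θ) v) z) :
    morreySupNorm I p q z ≤ W * kernelConst b * morreySupNorm I p q v := by
  refine le_mul_morreySupNorm hI hq (mul_ne_zero hW0 (kernelConst_ne_zero b))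
    (ENNReal.mul_ne_top hWt (kernelConst_ne_top b)) fun f hf hfn hfv => ?_
  have hfin : ∫⁻ θ in Ioi 0, ‖ω θ‖ₑ ≠ ∞ := ne_top_of_le_ne_top hWt hωW
  have hrep := represents_dilAverage hf hfn hfv b hω hρ (by simpa using hfin) hz
  refine (morreySupNorm_le I p q hrep).trans ?_
  refine (morreySup_dilAverage_le hq hf _ hω hρ hfin).trans ?_
  gcongr
  exact le_self_add

/-- Dilated multipliers are bounded on Morrey spaces, uniformly in the dilation. -/
theorem morreySupNorm_dilMul_le {I : Set ℝ} (hI : Ioc 0 1 ⊆ I) {p q : ℝ} (hq : 1 ≤ q)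
    (b : 𝓢(Space N, ℂ)) (ρ : ℝ) (v : Dist N) :
    morreySupNorm I p q (dilMul b ρ v) ≤ kernelConst b * morreySupNorm I p q v := by
  refine le_mul_morreySupNorm hI hq (kernelConst_ne_zero b) (kernelConst_ne_top b)
    fun f hf hfn hfv => ?_
  set B : 𝓢(Space N, ℂ) := 𝓕⁻ b with hB
  have hBfin : ∫⁻ y, ‖B y‖ₑ ≠ ∞ := by simpa using lintegral_schwartz_moment_ne_top B 0
  have hBm : AEStronglyMeasurable (B : Space N → ℂ) volume :=
    B.continuous.measurable.aestronglyMeasurable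
  have ha : Measurable fun y : Space N => ρ • y := measurable_id.const_smul ρ
  obtain ⟨h1, h2⟩ := average_pairing hf hfn hBm ha (by simpa using hBfin)
  have hrep : Represents (fun x => ∫ y, B y * f (x - ρ • y)) (dilMul b ρ v) :=
    ⟨h1, fun g => ⟨(h2 g).1, by rw [(h2 g).2.2, dilMul_apply_of_represents hf hfn hfv]⟩⟩
  refine (morreySupNorm_le I p q hrep).trans ?_
  refine (morreySup_average_le hq hf hBm ha hBfin).trans ?_
  gcongr
  exact le_self_add

theorem morreySupNorm_add_le {I : Set ℝ} {p q : ℝ} (hq : 1 ≤ q) (v w : Dist N) :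
    morreySupNorm I p q (v + w) ≤ morreySupNorm I p q v + morreySupNorm I p q w := by
  conv_rhs => unfold morreySupNorm
  simp only [ENNReal.iInf_add, ENNReal.add_iInf]
  refine le_iInf fun f => le_iInf fun hf => le_iInf fun g => le_iInf fun hg => ?_
  have hrep : Represents (fun x => g x + f x) (v + w) := by
    refine ⟨hg.1.add hf.1, fun h => ?_⟩
    simp only [mul_add]
    refine ⟨(hg.2 h).1.add (hf.2 h).1, ?_⟩
    rw [integral_add (hg.2 h).1 (hf.2 h).1, ← (hg.2 h).2, ← (hf.2 h).2]; rfl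
  exact (morreySupNorm_le I p q hrep).trans (morreySup_add_le hq hg.1 hf.1)

end Dilates

/-! ### Weights with exponential decay -/

section Weights

/-- Weights on `(0, ∞)` that vanish to order `k` at the origin and decay exponentially. The operators
`P_α` and `S_α` have weights of this type with `k = 0` and `k = 1`. -/
structure IsWeight (w : ℝ → ℝ) (k : ℕ) : Prop where
  aestronglyMeasurable : AEStronglyMeasurable w (volume.restrict (Ioi 0))
  bound : ∃ A c : ℝ, 0 < A ∧ 0 < c ∧ ∀ θ : ℝ, 0 < θ → |w θ| ≤ A * θ ^ k * Real.exp (-c * θ)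

theorem isWeight_wright {α : ℝ} (hα0 : 0 < α) (hα1 : α < 1) : IsWeight (wright α) 0 := by
  obtain ⟨A, c, hA, hc, h⟩ := abs_wright_le hα0 hα1
  refine ⟨aestronglyMeasurable_wright hα0 hα1, A, c, hA, hc, fun θ hθ => ?_⟩
  rw [pow_zero, mul_one]
  exact h θ hθ.le

theorem isWeight_mul_wright {α : ℝ} (hα0 : 0 < α) (hα1 : α < 1) :
    IsWeight (fun θ => α * (θ * wright α θ)) 1 := by
  obtain ⟨A, c, hA, hc, h⟩ := abs_wright_le hα0 hα1
  refine ⟨((aestronglyMeasurable_id.mul (aestronglyMeasurable_wright hα0 hα1)).const_mul α),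
    A, c, hA, hc, fun θ hθ => ?_⟩
  rw [abs_mul, abs_mul, abs_of_pos hα0, abs_of_pos hθ, pow_one]
  have := mul_le_mul_of_nonneg_left (h θ hθ.le) hθ.le
  have h0 : 0 ≤ θ * |wright α θ| := by positivity
  calc α * (θ * |wright α θ|) ≤ 1 * (θ * |wright α θ|) := by gcongr
    _ ≤ θ * (A * Real.exp (-c * θ)) := by rw [one_mul]; exact this
    _ = _ := by ring

variable {w : ℝ → ℝ} {k : ℕ}

theorem IsWeight.integrableOn_moment (hw : IsWeight w k) (n : ℕ) :
    IntegrableOn (fun θ => |w θ| * (1 + θ) ^ n) (Ioi 0) := by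
  obtain ⟨A, c, hA, hc, h⟩ := hw.bound
  have hexp : IntegrableOn (fun θ : ℝ => (A * ((k + n).factorial * (2 / c) ^ (k + n) *
      Real.exp (c / 2))) * Real.exp (-(c / 2) * θ)) (Ioi 0) :=
    (exp_neg_integrableOn_Ioi 0 (by positivity)).const_mul _
  refine Integrable.mono' hexp ?_ ?_
  · exact (continuous_abs.comp_aestronglyMeasurable hw.aestronglyMeasurable).mul
      (Continuous.aestronglyMeasurable (by fun_prop))
  · filter_upwards [ae_restrict_mem measurableSet_Ioi] with θ hθ
    have hθ0 : (0 : ℝ) < θ := hθ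
    rw [Real.norm_of_nonneg (by positivity)]
    have h1 : (1 + θ) ^ (k + n) ≤ (k + n).factorial * (2 / c) ^ (k + n) *
        Real.exp (c / 2 * (1 + θ)) := by
      have := Real.pow_div_factorial_le_exp (c / 2 * (1 + θ)) (by positivity) (k + n)
      rw [div_le_iff₀ (by positivity), mul_pow] at this
      have h2 : (2 / c) ^ (k + n) * (c / 2) ^ (k + n) = 1 := by
        rw [← mul_pow]; field_simp; simp
      calc (1 + θ) ^ (k + n) = (2 / c) ^ (k + n) * ((c / 2) ^ (k + n) * (1 + θ) ^ (k + n)) := by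
            rw [← mul_assoc, h2, one_mul]
        _ ≤ (2 / c) ^ (k + n) * (Real.exp (c / 2 * (1 + θ)) * (k + n).factorial) := by gcongr
        _ = _ := by ring
    calc |w θ| * (1 + θ) ^ n ≤ (A * θ ^ k * Real.exp (-c * θ)) * (1 + θ) ^ n := by
          gcongr; exact h θ hθ0
      _ ≤ (A * (1 + θ) ^ k * Real.exp (-c * θ)) * (1 + θ) ^ n := by gcongr; linarith
      _ = A * Real.exp (-c * θ) * (1 + θ) ^ (k + n) := by rw [pow_add]; ring
      _ ≤ A * Real.exp (-c * θ) * ((k + n).factorial * (2 / c) ^ (k + n) *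
        Real.exp (c / 2 * (1 + θ))) := by gcongr
      _ = (A * ((k + n).factorial * (2 / c) ^ (k + n))) *
          (Real.exp (-c * θ) * Real.exp (c / 2 * (1 + θ))) := by ring
      _ = (A * ((k + n).factorial * (2 / c) ^ (k + n))) *
          (Real.exp (c / 2) * Real.exp (-(c / 2) * θ)) := by
          rw [← Real.exp_add, ← Real.exp_add]; ring_nf
      _ = _ := by ring

theorem integrableOn_pow_div_one_add_cube {k : ℕ} (hk : k ≤ 1) :
    IntegrableOn (fun x : ℝ => x ^ k * (8 / (1 + x) ^ 3)) (Ioi 0) := by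
  refine Integrable.mono' ((integrable_inv_one_add_sq.const_mul 8).integrableOn (s := Ioi 0))
    ?_ ?_
  · exact (Measurable.mul (measurable_id.pow_const k)
      (measurable_const.div ((measurable_const.add measurable_id).pow_const 3))).aestronglyMeasurable
  · filter_upwards [ae_restrict_mem measurableSet_Ioi] with x hx
    have hx0 : (0 : ℝ) < x := hx
    rw [Real.norm_of_nonneg (by positivity)]
    have h1 : x ^ k ≤ 1 + x := by
      interval_cases k
      · simpa using hx0.le
      · simp
    calc x ^ k * (8 / (1 + x) ^ 3) ≤ (1 + x) * (8 / (1 + x) ^ 3) := by gcongr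
      _ = 8 / (1 + x) ^ 2 := by field_simp
      _ ≤ 8 / (1 + x ^ 2) := by
          gcongr
          nlinarith
      _ = _ := by rw [div_eq_mul_inv]

/-- The weight, damped at the scale `1 / l`, has integral `O(min (1, l^{-(k+1)}))`. The third power in
the damping makes `θ^k (1 + θ)⁻³` integrable for `k ≤ 1`. -/
theorem IsWeight.exists_decay (hw : IsWeight w k) (hk : k ≤ 1) :
    ∃ D : ℝ, 0 < D ∧ ∀ l : ℝ, 0 < l → ∀ ω : ℝ → ℝ,
      (∀ θ : ℝ, 0 < θ → |ω θ| ≤ |w θ| * (8 / (1 + l * θ) ^ 3)) →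
      ∫⁻ θ in Ioi 0, ‖ω θ‖ₑ ≤ ENNReal.ofReal (D * min 1 (l ^ (k + 1))⁻¹) := by
  obtain ⟨A, c, hA, hc, h⟩ := hw.bound
  have hJ := integrableOn_pow_div_one_add_cube hk
  set J : ℝ := ∫ x in Ioi (0 : ℝ), x ^ k * (8 / (1 + x) ^ 3) with hJd
  have hJ0 : 0 ≤ J := setIntegral_nonneg measurableSet_Ioi fun x hx => by
    have : (0 : ℝ) < x := hx
    positivity
  have hw0 : IntegrableOn (fun θ => 8 * |w θ|) (Ioi 0) := by
    have h1 := (hw.integrableOn_moment 0).const_mul 8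
    simp only [pow_zero, mul_one] at h1
    exact h1
  set W : ℝ := ∫ θ in Ioi (0 : ℝ), 8 * |w θ| with hWd
  have hW0 : 0 ≤ W := setIntegral_nonneg measurableSet_Ioi fun x _ => by positivity
  refine ⟨W + A * J + 1, by positivity, fun l hl ω hω => ?_⟩
  -- a bound by an integrable function bounds the `lintegral`
  have hmono : ∀ G : ℝ → ℝ, IntegrableOn G (Ioi 0) → (∀ θ : ℝ, 0 < θ → |ω θ| ≤ G θ) →
      ∫⁻ θ in Ioi 0, ‖ω θ‖ₑ ≤ ENNReal.ofReal (∫ θ in Ioi (0 : ℝ), G θ) := by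
    intro G hG hle
    have hae : ∀ᵐ θ ∂(volume.restrict (Ioi (0 : ℝ))), |ω θ| ≤ G θ := by
      filter_upwards [ae_restrict_mem measurableSet_Ioi] with θ hθ using hle θ hθ
    rw [ofReal_integral_eq_lintegral_ofReal hG (hae.mono fun θ h => (abs_nonneg _).trans h)]
    refine lintegral_mono_ae (hae.mono fun θ h => ?_)
    rw [← ofReal_norm, Real.norm_eq_abs]
    exact ENNReal.ofReal_le_ofReal h
  have b1 : ∫⁻ θ in Ioi 0, ‖ω θ‖ₑ ≤ ENNReal.ofReal W := by
    refine hmono _ hw0 fun θ hθ => (hω θ hθ).trans ?_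
    have h1 : 8 / (1 + l * θ) ^ 3 ≤ 8 := by
      rw [div_le_iff₀ (by positivity)]
      have : 1 ≤ (1 + l * θ) ^ 3 := one_le_pow₀ (by nlinarith [mul_pos hl hθ])
      linarith
    calc _ ≤ |w θ| * 8 := by gcongr
      _ = _ := mul_comm _ _
  have b2 : ∫⁻ θ in Ioi 0, ‖ω θ‖ₑ ≤ ENNReal.ofReal (A * J * (l ^ (k + 1))⁻¹) := by
    have hscale : IntegrableOn (fun θ : ℝ => (l * θ) ^ k * (8 / (1 + l * θ) ^ 3)) (Ioi 0) := by
      have := (integrableOn_Ioi_comp_mul_left_iff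
        (fun x : ℝ => x ^ k * (8 / (1 + x) ^ 3)) 0 hl).2 (by simpa using hJ)
      exact this
    have hval := integral_comp_mul_left_Ioi (fun x : ℝ => x ^ k * (8 / (1 + x) ^ 3)) 0 hl
    rw [mul_zero, smul_eq_mul] at hval
    have := hmono _ (hscale.const_mul (A * (l ^ k)⁻¹)) fun θ hθ => by
      refine (hω θ hθ).trans ?_
      have h1 : |w θ| ≤ A * θ ^ k := by
        refine (h θ hθ).trans (mul_le_of_le_one_right (by positivity) ?_)
        rw [Real.exp_le_one_iff]; nlinarith [mul_pos hc hθ]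
      calc _ ≤ A * θ ^ k * (8 / (1 + l * θ) ^ 3) := by gcongr
        _ = _ := by rw [mul_pow]; field_simp
    refine this.trans (le_of_eq ?_)
    rw [integral_const_mul, hval, ← hJd, pow_succ]
    congr 1
    field_simp
  rcases le_total (1 : ℝ) ((l ^ (k + 1))⁻¹) with hm | hm
  · rw [min_eq_left hm]
    refine b1.trans (ENNReal.ofReal_le_ofReal ?_)
    have : 0 ≤ A * J := by positivity
    linarith
  · rw [min_eq_right hm]
    refine b2.trans (ENNReal.ofReal_le_ofReal ?_)
    gcongr
    linarith

end Weights

/-! ### Littlewood-Paley blocks of the solution operators -/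

section Blocks

variable {N : ℕ} {ζ : ℝ → ℝ}

theorem IsCutoff.eq_zero (hζ : IsCutoff ζ) {ρ : ℝ} (hρ : 5 / 3 ≤ ρ) : ζ ρ = 0 :=
  image_eq_zero_of_notMem_tsupport fun h => absurd (hζ.tsupport_subset h) (not_lt.2 hρ)

theorem IsCutoff.contDiff_norm (hζ : IsCutoff ζ) (c : ℝ) :
    ContDiff ℝ ((⊤ : ℕ∞) : WithTop ℕ∞) (fun ξ : Space N => ζ (c * ‖ξ‖)) := by
  rw [contDiff_iff_contDiffAt]
  intro x
  by_cases hx : x = 0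
  · have hev : (fun ξ : Space N => ζ (c * ‖ξ‖)) =ᶠ[𝓝 x] fun _ => 1 := by
      have hc : ContinuousAt (fun ξ : Space N => c * ‖ξ‖) x := by fun_prop
      have : ∀ᶠ ξ in 𝓝 x, c * ‖ξ‖ < 3 / 2 := by
        refine hc.eventually_lt_const ?_
        rw [hx]; simp
      filter_upwards [this] with ξ hξ using hζ.eq_one _ hξ.le
    exact contDiffAt_const.congr_of_eventuallyEq hev
  · exact (hζ.smooth.contDiffAt).comp x (contDiffAt_const.mul (contDiffAt_norm ℝ hx))

theorem IsCutoff.hasCompactSupport (hζ : IsCutoff ζ) {c : ℝ} (hc : 0 < c) :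
    HasCompactSupport (fun ξ : Space N => ζ (c * ‖ξ‖)) := by
  refine HasCompactSupport.intro (isCompact_closedBall (0 : Space N) (5 / 3 / c)) fun ξ hξ => ?_
  rw [mem_closedBall_zero_iff, not_le, div_lt_iff₀ hc] at hξ
  exact hζ.eq_zero (by linarith)

theorem IsCutoff.hasTemperateGrowth (hζ : IsCutoff ζ) {c : ℝ} (hc : 0 < c) :
    (fun ξ : Space N => ((ζ (c * ‖ξ‖) : ℝ) : ℂ)).HasTemperateGrowth :=
  ((hζ.hasCompactSupport hc).comp_left (g := ((↑) : ℝ → ℂ)) Complex.ofReal_zero).hasTemperateGrowth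
    (Complex.ofRealCLM.contDiff.comp (hζ.contDiff_norm c))

theorem hasTemperateGrowth_phiLow (hζ : IsCutoff ζ) :
    (fun ξ : Space N => ((phiLow ζ ((2 * Real.pi) • ξ) : ℝ) : ℂ)).HasTemperateGrowth := by
  have h := hζ.hasTemperateGrowth (N := N) Real.two_pi_pos
  have he : (fun ξ : Space N => ((phiLow ζ ((2 * Real.pi) • ξ) : ℝ) : ℂ)) =
      fun ξ : Space N => ((ζ (2 * Real.pi * ‖ξ‖) : ℝ) : ℂ) := by
    ext ξ
    rw [phiLow, norm_smul, Real.norm_of_nonneg Real.two_pi_pos.le]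
  rw [he]; exact h

theorem hasTemperateGrowth_phi (hζ : IsCutoff ζ) (j : ℤ) :
    (fun ξ : Space N => ((phi ζ j ((2 * Real.pi) • ξ) : ℝ) : ℂ)).HasTemperateGrowth := by
  have h2 : (0 : ℝ) < 2 ^ (-j) * (2 * Real.pi) := by positivity
  have h := (hζ.hasTemperateGrowth (N := N) h2).sub
    (hζ.hasTemperateGrowth (N := N) (mul_pos two_pos h2))
  have he : (fun ξ : Space N => ((phi ζ j ((2 * Real.pi) • ξ) : ℝ) : ℂ)) =
      (fun ξ : Space N => ((ζ (2 ^ (-j) * (2 * Real.pi) * ‖ξ‖) : ℝ) : ℂ)) -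
      fun ξ : Space N => ((ζ (2 * (2 ^ (-j) * (2 * Real.pi)) * ‖ξ‖) : ℝ) : ℂ) := by
    ext ξ
    rw [Pi.sub_apply, phi, phiZero, norm_smul, norm_smul, Real.norm_of_nonneg Real.two_pi_pos.le,
      Real.norm_of_nonneg (by positivity : (0 : ℝ) ≤ 2 ^ (-j))]
    push_cast
    ring_nf
  rw [he]; exact h

/-- The Gaussian symbol `e^{-|2πξ|²}` of the heat semigroup at time one. -/
def heatSymbol (N : ℕ) : 𝓢(Space N, ℂ) :=
  gaussSchwartz (4 * Real.pi ^ 2) (by positivity)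

theorem heatSymbol_sqrt_smul {τ : ℝ} (hτ : 0 ≤ τ) (ξ : Space N) :
    heatSymbol N (√τ • ξ) = ((Real.exp (-τ * ‖(2 * Real.pi) • ξ‖ ^ 2) : ℝ) : ℂ) := by
  rw [heatSymbol, gaussSchwartz_apply, gauss, norm_smul, norm_smul, mul_pow, mul_pow,
    Real.norm_of_nonneg Real.two_pi_pos.le, Real.norm_of_nonneg (Real.sqrt_nonneg τ),
    Real.sq_sqrt hτ]
  ring_nf

theorem heat_eq_dilMul {τ : ℝ} (hτ : 0 ≤ τ) (u : Dist N) :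
    heat τ u = dilMul (heatSymbol N) (√τ) u := by
  rw [heat, multiplier, dilMul]
  simp only [heatSymbol_sqrt_smul hτ]

theorem multiplier_heat {m : Space N → ℝ}
    (hm : (fun ξ : Space N => ((m ((2 * Real.pi) • ξ) : ℝ) : ℂ)).HasTemperateGrowth)
    {τ : ℝ} (hτ : 0 ≤ τ) (u : Dist N) :
    multiplier m (heat τ u) = heat τ (multiplier m u) := by
  rw [heat_eq_dilMul hτ, heat_eq_dilMul hτ, multiplier, multiplier, dilMul, dilMul,
    TemperedDistribution.fourierMultiplierCLM_fourierMultiplierCLM_apply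
      (hasTemperateGrowth_dilate _ _) hm,
    TemperedDistribution.fourierMultiplierCLM_fourierMultiplierCLM_apply hm
      (hasTemperateGrowth_dilate _ _), mul_comm]

theorem IsDistIntegral.congr_on {w w' : ℝ → ℝ} {U U' : ℝ → Dist N} {v : Dist N}
    (h : IsDistIntegral w U v)
    (he : ∀ θ : ℝ, 0 < θ → ∀ g, ((w θ : ℝ) : ℂ) * U θ g = ((w' θ : ℝ) : ℂ) * U' θ g) :
    IsDistIntegral w' U' v := by
  intro g
  have heq : EqOn (fun θ : ℝ => ((w θ : ℝ) : ℂ) * U θ g)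
      (fun θ : ℝ => ((w' θ : ℝ) : ℂ) * U' θ g) (Ioi 0) := fun θ hθ => he θ hθ g
  exact ⟨(h g).1.congr_fun heq measurableSet_Ioi,
    by rw [(h g).2, setIntegral_congr_fun measurableSet_Ioi heq]⟩

theorem IsDistIntegral.multiplier {w : ℝ → ℝ} {U : ℝ → Dist N} {v : Dist N}
    (h : IsDistIntegral w U v) (m : Space N → ℝ) :
    IsDistIntegral w (fun θ => BesovMorrey.multiplier m (U θ)) (BesovMorrey.multiplier m v) :=
  fun g => h (𝓕 (SchwartzMap.smulLeftCLM ℂ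
    (fun ξ : Space N => ((m ((2 * Real.pi) • ξ) : ℝ) : ℂ)) (𝓕⁻ g)))

theorem IsDistIntegral.multiplier_heat {w : ℝ → ℝ} {s : ℝ} (hs : 0 ≤ s) {u v : Dist N}
    (h : IsDistIntegral w (fun θ => heat (s * θ) u) v) {m : Space N → ℝ}
    (hm : (fun ξ : Space N => ((m ((2 * Real.pi) • ξ) : ℝ) : ℂ)).HasTemperateGrowth) :
    IsDistIntegral w (fun θ => heat (s * θ) (BesovMorrey.multiplier m u))
      (BesovMorrey.multiplier m v) :=
  (h.multiplier m).congr_on fun θ hθ g => by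
    rw [BesovMorrey.multiplier_heat hm (mul_nonneg hs hθ.le)]

/-- The symbol `|ξ|⁶ e^{-|2πξ|²}`. -/
def heatSymbolSix (N : ℕ) : 𝓢(Space N, ℂ) :=
  SchwartzMap.smulLeftCLM ℂ (fun ξ : Space N => (((‖ξ‖ ^ 2) ^ 3 : ℝ) : ℂ)) (heatSymbol N)

theorem heatSymbolSix_apply (ξ : Space N) :
    heatSymbolSix N ξ = (((‖ξ‖ ^ 2) ^ 3 : ℝ) : ℂ) * heatSymbol N ξ := by
  have h : (fun ξ : Space N => (((‖ξ‖ ^ 2) ^ 3 : ℝ) : ℂ)).HasTemperateGrowth :=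
    Function.Complex.hasTemperateGrowth_ofReal.comp
      ((Function.hasTemperateGrowth_norm_sq (Space N)).pow 3)
  rw [heatSymbolSix, SchwartzMap.smulLeftCLM_apply_apply h, smul_eq_mul]

/-- A smooth compactly supported symbol that equals `|η|⁻⁶` on the support of `φ₀(2π ·)`. -/
theorem exists_annulus_symbol (hζ : IsCutoff ζ) : ∃ a : 𝓢(Space N, ℂ), ∀ η : Space N,
    phiZero ζ ((2 * Real.pi) • η) ≠ 0 → (((‖η‖ ^ 2) ^ 3 : ℝ) : ℂ) * a η = 1 := by
  -- on the support `3/4 < ρ < 5/3`, where `ρ = 2π|η|`, one has `9/10 ρ ≤ 3/2` and `20/9 ρ ≥ 5/3`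
  set c₁ : ℝ := 9 / 10 * (2 * Real.pi) with hc₁
  set c₂ : ℝ := 20 / 9 * (2 * Real.pi) with hc₂
  have hpi := Real.two_pi_pos
  set a₀ : Space N → ℝ := fun η =>
    ζ (c₁ * ‖η‖) * ((1 - ζ (c₂ * ‖η‖)) * ((‖η‖ ^ 2) ^ 3)⁻¹) with ha₀
  have hsmooth : ContDiff ℝ ((⊤ : ℕ∞) : WithTop ℕ∞) a₀ := by
    refine (hζ.contDiff_norm c₁).mul ?_
    rw [contDiff_iff_contDiffAt]
    intro x
    by_cases hx : x = 0
    · have hev : (fun η : Space N => (1 - ζ (c₂ * ‖η‖)) * ((‖η‖ ^ 2) ^ 3)⁻¹) =ᶠ[𝓝 x]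
          fun _ => 0 := by
        have hc : ContinuousAt (fun ξ : Space N => c₂ * ‖ξ‖) x := by fun_prop
        have : ∀ᶠ ξ in 𝓝 x, c₂ * ‖ξ‖ < 3 / 2 := by
          refine hc.eventually_lt_const ?_
          rw [hx]; simp
        filter_upwards [this] with ξ hξ
        rw [hζ.eq_one _ hξ.le, sub_self, zero_mul]
      exact contDiffAt_const.congr_of_eventuallyEq hev
    · refine (contDiffAt_const.sub (hζ.contDiff_norm c₂).contDiffAt).mul (ContDiffAt.inv ?_ ?_)
      · exact ((contDiff_norm_sq ℝ).contDiffAt).pow 3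
      · have := norm_pos_iff.2 hx
        positivity
  have hsupp : HasCompactSupport a₀ :=
    (hζ.hasCompactSupport (N := N) (c := c₁) (by positivity)).mul_right
  refine ⟨(hsupp.comp_left (g := ((↑) : ℝ → ℂ)) Complex.ofReal_zero).toSchwartzMap
    (Complex.ofRealCLM.contDiff.comp hsmooth), fun η hη => ?_⟩
  change (((‖η‖ ^ 2) ^ 3 : ℝ) : ℂ) * ((a₀ η : ℝ) : ℂ) = 1
  rw [phiZero, norm_smul, Real.norm_of_nonneg hpi.le] at hη
  have h1 : 2 * Real.pi * ‖η‖ < 5 / 3 := by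
    by_contra h
    rw [not_lt] at h
    rw [hζ.eq_zero h, hζ.eq_zero (by linarith), sub_self] at hη
    exact hη rfl
  have h2 : 3 / 4 < 2 * Real.pi * ‖η‖ := by
    by_contra h
    rw [not_lt] at h
    rw [hζ.eq_one _ (by linarith), hζ.eq_one _ (by linarith), sub_self] at hη
    exact hη rfl
  have hη0 : 0 < ‖η‖ := by
    rcases (norm_nonneg η).eq_or_lt with h | h
    · rw [← h] at h2; norm_num at h2
    · exact h
  have e1 : ζ (c₁ * ‖η‖) = 1 := hζ.eq_one _ (by rw [hc₁]; linarith)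
  have e2 : ζ (c₂ * ‖η‖) = 0 := hζ.eq_zero (by rw [hc₂]; linarith)
  rw [← Complex.ofReal_mul, ha₀]
  simp only [e1, e2]
  rw [sub_zero, one_mul, one_mul, mul_inv_cancel₀ (by positivity), Complex.ofReal_one]

/-- On the `j`-th block, the heat semigroup at time `τ` is `(4^j τ)⁻³` times two multipliers that
are dilates of fixed Schwartz symbols. -/
theorem heat_block_eq (hζ : IsCutoff ζ) {a : 𝓢(Space N, ℂ)} (ha : ∀ η : Space N,
    phiZero ζ ((2 * Real.pi) • η) ≠ 0 → (((‖η‖ ^ 2) ^ 3 : ℝ) : ℂ) * a η = 1)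
    {τ : ℝ} (hτ : 0 < τ) (j : ℤ) (u : Dist N) :
    heat τ (multiplier (phi ζ j) u) = ((((τ * 4 ^ j) ^ 3)⁻¹ : ℝ) : ℂ) •
      dilMul (heatSymbolSix N) (√τ) (dilMul a (2 ^ (-j)) (multiplier (phi ζ j) u)) := by
  have hφ := hasTemperateGrowth_phi (N := N) hζ j
  rw [heat_eq_dilMul hτ.le, dilMul, dilMul, dilMul, multiplier,
    TemperedDistribution.fourierMultiplierCLM_fourierMultiplierCLM_apply hφ
      (hasTemperateGrowth_dilate _ _),
    TemperedDistribution.fourierMultiplierCLM_fourierMultiplierCLM_apply hφ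
      (hasTemperateGrowth_dilate _ _),
    TemperedDistribution.fourierMultiplierCLM_fourierMultiplierCLM_apply
      (hφ.mul (hasTemperateGrowth_dilate _ _)) (hasTemperateGrowth_dilate _ _),
    ← smul_apply,
    ← TemperedDistribution.fourierMultiplierCLM_smul
      ((hφ.mul (hasTemperateGrowth_dilate _ _)).mul (hasTemperateGrowth_dilate _ _))]
  congr 2
  ext ξ
  simp only [Pi.mul_apply, Pi.smul_apply, smul_eq_mul]
  by_cases h0 : phi ζ j ((2 * Real.pi) • ξ) = 0
  · simp [h0]
  · have h1 : (((‖(2 : ℝ) ^ (-j) • ξ‖ ^ 2) ^ 3 : ℝ) : ℂ) * a ((2 : ℝ) ^ (-j) • ξ) = 1 := by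
      refine ha _ ?_
      rwa [phi, smul_comm] at h0
    have h2 : (((τ * 4 ^ j) ^ 3)⁻¹ : ℝ) * (‖√τ • ξ‖ ^ 2) ^ 3 =
        (‖(2 : ℝ) ^ (-j) • ξ‖ ^ 2) ^ 3 := by
      rw [norm_smul, norm_smul, mul_pow, mul_pow, Real.norm_of_nonneg (Real.sqrt_nonneg τ),
        Real.sq_sqrt hτ.le, Real.norm_of_nonneg (by positivity : (0 : ℝ) ≤ 2 ^ (-j))]
      have h4 : ((2 : ℝ) ^ (-j)) ^ 2 = ((4 : ℝ) ^ j)⁻¹ := by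
        rw [zpow_neg, inv_pow, ← zpow_natCast, ← zpow_mul, mul_comm, zpow_mul]
        norm_num
      rw [mul_pow (2 ^ (-j) : ℝ) ‖ξ‖ 2, h4]
      have h40 : (0 : ℝ) < 4 ^ j := by positivity
      field_simp
    rw [heatSymbolSix_apply]
    calc _ = (((phi ζ j ((2 * Real.pi) • ξ) : ℝ) : ℂ) * heatSymbol N (√τ • ξ)) *
          ((((‖(2 : ℝ) ^ (-j) • ξ‖ ^ 2) ^ 3 : ℝ) : ℂ) * a ((2 : ℝ) ^ (-j) • ξ)) := by
          rw [h1, mul_one]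
      _ = _ := by rw [← h2]; push_cast; ring

variable {w : ℝ → ℝ} {k : ℕ}

theorem IsWeight.exists_isDistIntegral_of_le (hw : IsWeight w k) {ω : ℝ → ℝ}
    (hω : AEStronglyMeasurable ω (volume.restrict (Ioi 0)))
    (hle : ∀ θ : ℝ, 0 < θ → |ω θ| ≤ |w θ|) {s : ℝ} (hs : 0 ≤ s) (u : Dist N) :
    ∃ v : Dist N, IsDistIntegral ω (fun θ => heat (s * θ) u) v := by
  refine exists_isDistIntegral hω (fun n => ?_) hs u
  refine Integrable.mono' (hw.integrableOn_moment n) ?_ ?_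
  · exact (continuous_abs.comp_aestronglyMeasurable hω).mul
      (Continuous.aestronglyMeasurable (by fun_prop))
  · filter_upwards [ae_restrict_mem measurableSet_Ioi] with θ hθ
    have hθ0 : (0 : ℝ) < θ := hθ
    rw [Real.norm_of_nonneg (mul_nonneg (abs_nonneg _) (by positivity))]
    exact mul_le_mul_of_nonneg_right (hle θ hθ0) (by positivity)

/-- The low-frequency block is not improved by the operators, only preserved. -/
theorem exists_low_block_le (hζ : IsCutoff ζ) (hw : IsWeight w k) : ∃ C : ℝ, 0 < C ∧
    ∀ (I : Set ℝ), Ioc 0 1 ⊆ I → ∀ p q : ℝ, 1 ≤ q → ∀ s : ℝ, 0 < s → ∀ u v : Dist N,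
      IsDistIntegral w (fun θ => heat (s * θ) u) v →
      morreySupNorm I p q (multiplier (phiLow ζ) v) ≤
        ENNReal.ofReal C * morreySupNorm I p q (multiplier (phiLow ζ) u) := by
  set W : ℝ≥0∞ := (∫⁻ θ in Ioi 0, ‖w θ‖ₑ) + 1 with hW
  have hWt : W ≠ ∞ := by
    have : Integrable w (volume.restrict (Ioi 0)) := by
      have h := hw.integrableOn_moment 0
      simp only [pow_zero, mul_one] at h
      exact (integrable_norm_iff hw.aestronglyMeasurable).1 h
    have h2 : ∫⁻ θ in Ioi 0, ‖w θ‖ₑ ≠ ∞ := this.2.ne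
    simpa [hW] using h2
  have hW0 : W ≠ 0 := by simp [hW]
  have hC0 : W * kernelConst (heatSymbol N) ≠ 0 := mul_ne_zero hW0 (kernelConst_ne_zero _)
  have hCt : W * kernelConst (heatSymbol N) ≠ ∞ := ENNReal.mul_ne_top hWt (kernelConst_ne_top _)
  refine ⟨(W * kernelConst (heatSymbol N)).toReal, ENNReal.toReal_pos hC0 hCt,
    fun I hI p q hq s hs u v huv => ?_⟩
  rw [ENNReal.ofReal_toReal hCt]
  have h := (huv.multiplier_heat hs.le (hasTemperateGrowth_phiLow hζ)).congr_on (w' := w)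
    (U' := fun θ => dilMul (heatSymbol N) (√(s * θ)) (multiplier (phiLow ζ) u))
    fun θ hθ g => by rw [heat_eq_dilMul (mul_nonneg hs.le hθ.le)]
  exact morreySupNorm_distIntegral_dilMul_le hI hq _ hw.aestronglyMeasurable
    (by fun_prop) hW0 hWt le_self_add h

/-- The key estimate: the solution operators act on the `j`-th block with norm
`O(min (1, (4^j s)^{-(k+1)}))`, where `s = t^α`. -/
theorem exists_block_le (hζ : IsCutoff ζ) (hw : IsWeight w k) (hk : k ≤ 1) : ∃ C : ℝ, 0 < C ∧
    ∀ (I : Set ℝ), Ioc 0 1 ⊆ I → ∀ p q : ℝ, 1 ≤ q → ∀ s : ℝ, 0 < s → ∀ (j : ℤ) (u v : Dist N),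
      IsDistIntegral w (fun θ => heat (s * θ) u) v →
      morreySupNorm I p q (multiplier (phi ζ j) v) ≤
        ENNReal.ofReal (C * min 1 ((s * 4 ^ j) ^ (k + 1))⁻¹) *
          morreySupNorm I p q (multiplier (phi ζ j) u) := by
  obtain ⟨a, ha⟩ := exists_annulus_symbol (N := N) hζ
  obtain ⟨D, hD, hdecay⟩ := hw.exists_decay hk
  set K : ℝ≥0∞ := kernelConst (heatSymbol N) +
    kernelConst (heatSymbolSix N) * kernelConst a with hK
  have hK0 : K ≠ 0 := by
    rw [hK]
    exact fun h => kernelConst_ne_zero _ (add_eq_zero.1 h).1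
  have hKt : K ≠ ∞ := ENNReal.add_ne_top.2 ⟨kernelConst_ne_top _,
    ENNReal.mul_ne_top (kernelConst_ne_top _) (kernelConst_ne_top _)⟩
  refine ⟨D * K.toReal, mul_pos hD (ENNReal.toReal_pos hK0 hKt),
    fun I hI p q hq s hs j u v huv => ?_⟩
  set l : ℝ := s * 4 ^ j with hl
  have hl0 : 0 < l := by positivity
  set W : ℝ≥0∞ := ENNReal.ofReal (D * min 1 (l ^ (k + 1))⁻¹) with hW
  have hWpos : 0 < D * min 1 (l ^ (k + 1))⁻¹ := mul_pos hD (lt_min one_pos (by positivity))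
  have hW0 : W ≠ 0 := by rw [hW]; simpa using hWpos
  have hWt : W ≠ ∞ := ENNReal.ofReal_ne_top
  have hCW : ENNReal.ofReal (D * K.toReal * min 1 (l ^ (k + 1))⁻¹) = W * K := by
    rw [mul_right_comm, ENNReal.ofReal_mul hWpos.le, ENNReal.ofReal_toReal hKt]
  rw [hCW]
  set u' := multiplier (phi ζ j) u with hu'
  set v' := multiplier (phi ζ j) v with hv'
  have hv : IsDistIntegral w (fun θ => heat (s * θ) u') v' :=
    huv.multiplier_heat hs.le (hasTemperateGrowth_phi hζ j)
  -- the weight is split at `l θ = 1`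
  set ω₁ : ℝ → ℝ := (Iic l⁻¹).indicator w with hω₁
  set ω₂ : ℝ → ℝ := (Ioi l⁻¹).indicator w with hω₂
  have hω₁m : AEStronglyMeasurable ω₁ (volume.restrict (Ioi 0)) :=
    hw.aestronglyMeasurable.indicator measurableSet_Iic
  have hω₂m : AEStronglyMeasurable ω₂ (volume.restrict (Ioi 0)) :=
    hw.aestronglyMeasurable.indicator measurableSet_Ioi
  have hω₁le : ∀ θ : ℝ, 0 < θ → |ω₁ θ| ≤ |w θ| := fun θ _ => by
    rw [hω₁]; exact norm_indicator_le_norm_self w θ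
  have hω₂le : ∀ θ : ℝ, 0 < θ → |ω₂ θ| ≤ |w θ| := fun θ _ => by
    rw [hω₂]; exact norm_indicator_le_norm_self w θ
  obtain ⟨z₁, hz₁⟩ := hw.exists_isDistIntegral_of_le hω₁m hω₁le hs.le u'
  obtain ⟨z₂, hz₂⟩ := hw.exists_isDistIntegral_of_le hω₂m hω₂le hs.le u'
  have hsplit : ∀ θ, w θ = ω₁ θ + ω₂ θ := by
    intro θ
    by_cases h : θ ≤ l⁻¹
    · rw [hω₁, hω₂, indicator_of_mem (show θ ∈ Iic l⁻¹ from h),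
        indicator_of_notMem (by simpa using h), add_zero]
    · rw [hω₁, hω₂, indicator_of_notMem (show θ ∉ Iic l⁻¹ from h),
        indicator_of_mem (by simpa using h), zero_add]
  have hvz : v' = z₁ + z₂ := by
    ext g
    rw [(hv g).2, add_apply, (hz₁ g).2, (hz₂ g).2, ← integral_add (hz₁ g).1 (hz₂ g).1]
    congr 1; ext θ
    rw [hsplit θ]; push_cast; ring
  have hρ : Measurable fun θ : ℝ => √(s * θ) := by fun_prop
  -- low frequencies relative to the time scale
  have hn₁ : morreySupNorm I p q z₁ ≤
      W * kernelConst (heatSymbol N) * morreySupNorm I p q u' := by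
    refine morreySupNorm_distIntegral_dilMul_le hI hq (heatSymbol N) hω₁m hρ hW0 hWt
      (hdecay l hl0 ω₁ fun θ hθ => ?_) (hz₁.congr_on (w' := ω₁) fun θ hθ g => by
        rw [heat_eq_dilMul (mul_nonneg hs.le hθ.le)])
    by_cases h : θ ≤ l⁻¹
    · refine (hω₁le θ hθ).trans (le_mul_of_one_le_right (abs_nonneg _) ?_)
      have h1 : l * θ ≤ 1 := by
        calc l * θ ≤ l * l⁻¹ := by gcongr
          _ = 1 := mul_inv_cancel₀ hl0.ne'
      rw [le_div_iff₀ (by positivity), one_mul]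
      calc (1 + l * θ) ^ 3 ≤ (1 + 1) ^ 3 := by gcongr
        _ = 8 := by norm_num
    · rw [hω₁, indicator_of_notMem (show θ ∉ Iic l⁻¹ from h), abs_zero]
      positivity
  -- high frequencies relative to the time scale
  have hn₂ : morreySupNorm I p q z₂ ≤
      W * kernelConst (heatSymbolSix N) * (kernelConst a * morreySupNorm I p q u') := by
    have hz : IsDistIntegral (fun θ => ω₂ θ * ((l * θ) ^ 3)⁻¹)
        (fun θ => dilMul (heatSymbolSix N) (√(s * θ)) (dilMul a (2 ^ (-j)) u')) z₂ := by
      refine hz₂.congr_on fun θ hθ g => ?_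
      rw [hu', heat_block_eq hζ ha (mul_pos hs hθ) j u, smul_apply, smul_eq_mul, ← mul_assoc,
        ← Complex.ofReal_mul, hl]
      ring_nf
    refine (morreySupNorm_distIntegral_dilMul_le hI hq (heatSymbolSix N)
      (hω₂m.mul (Measurable.aestronglyMeasurable (by fun_prop))) hρ hW0 hWt
      (hdecay l hl0 _ fun θ hθ => ?_) hz).trans ?_
    · rw [Pi.mul_apply]
      by_cases h : l⁻¹ < θ
      · have h1 : 1 < l * θ := by rwa [inv_lt_iff_one_lt_mul₀' hl0] at h
        rw [abs_mul, abs_of_pos (by positivity : 0 < ((l * θ) ^ 3)⁻¹)]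
        refine mul_le_mul (hω₂le θ hθ) ?_ (by positivity) (abs_nonneg _)
        rw [inv_eq_one_div, div_le_div_iff₀ (by positivity) (by positivity), one_mul]
        calc (1 + l * θ) ^ 3 ≤ (2 * (l * θ)) ^ 3 := by gcongr; linarith
          _ = _ := by ring
      · rw [hω₂, indicator_of_notMem (show θ ∉ Ioi l⁻¹ from h), zero_mul, abs_zero]
        positivity
    · gcongr
      exact morreySupNorm_dilMul_le hI hq a _ u'
  rw [hvz]
  calc _ ≤ morreySupNorm I p q z₁ + morreySupNorm I p q z₂ := morreySupNorm_add_le hq _ _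
    _ ≤ W * kernelConst (heatSymbol N) * morreySupNorm I p q u' +
        W * kernelConst (heatSymbolSix N) * (kernelConst a * morreySupNorm I p q u') :=
        add_le_add hn₁ hn₂
    _ = _ := by rw [hK]; ring

end Blocks

/-! ### Polynomials -/

section Polynomials

variable {N : ℕ}

/-- The polynomial function on `ℝ^N` given by `P`. -/
def polyFun (P : MvPolynomial (Fin N) ℂ) (x : Space N) : ℂ :=
  MvPolynomial.eval (fun i => ((x i : ℝ) : ℂ)) P

theorem continuous_polyFun (P : MvPolynomial (Fin N) ℂ) : Continuous (polyFun P) := by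
  have h : Continuous fun x : Space N => fun i => ((x i : ℝ) : ℂ) := by fun_prop
  exact (MvPolynomial.continuous_eval P).comp h

theorem exists_norm_polyFun_le (P : MvPolynomial (Fin N) ℂ) :
    ∃ (C : ℝ) (n : ℕ), 0 ≤ C ∧ ∀ x : Space N, ‖polyFun P x‖ ≤ C * (1 + ‖x‖) ^ n := by
  induction P using MvPolynomial.induction_on with
  | C a => exact ⟨‖a‖, 0, norm_nonneg a, fun x => by simp [polyFun]⟩
  | add P Q hP hQ =>
    obtain ⟨C, n, hC, h⟩ := hP
    obtain ⟨D, m, hD, h'⟩ := hQ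
    refine ⟨C + D, max n m, by positivity, fun x => ?_⟩
    have h1 : (1 : ℝ) ≤ 1 + ‖x‖ := by linarith [norm_nonneg x]
    calc ‖polyFun (P + Q) x‖ ≤ ‖polyFun P x‖ + ‖polyFun Q x‖ := by
          rw [polyFun, map_add]; exact norm_add_le _ _
      _ ≤ C * (1 + ‖x‖) ^ n + D * (1 + ‖x‖) ^ m := add_le_add (h x) (h' x)
      _ ≤ C * (1 + ‖x‖) ^ max n m + D * (1 + ‖x‖) ^ max n m := by
          gcongr
          exacts [le_max_left _ _, le_max_right _ _]
      _ = _ := by ring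
  | mul_X P i hP =>
    obtain ⟨C, n, hC, h⟩ := hP
    refine ⟨C, n + 1, hC, fun x => ?_⟩
    have h1 : ‖((x i : ℝ) : ℂ)‖ ≤ 1 + ‖x‖ := by
      rw [Complex.norm_real]
      linarith [PiLp.norm_apply_le x i]
    calc ‖polyFun (P * MvPolynomial.X i) x‖ = ‖polyFun P x‖ * ‖((x i : ℝ) : ℂ)‖ := by
          simp [polyFun]
      _ ≤ C * (1 + ‖x‖) ^ n * (1 + ‖x‖) := by gcongr; exact h x
      _ = _ := by ring

theorem exists_enorm_polyFun_sub_le (P : MvPolynomial (Fin N) ℂ) :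
    ∃ (C : ℝ≥0∞) (n : ℕ), C ≠ ∞ ∧ ∀ x a : Space N,
      ‖polyFun P (x - a)‖ₑ ≤ C * (1 + ‖x‖ₑ) ^ n * (1 + ‖a‖ₑ) ^ n := by
  obtain ⟨C, n, hC, h⟩ := exists_norm_polyFun_le P
  refine ⟨ENNReal.ofReal C, n, ENNReal.ofReal_ne_top, fun x a => ?_⟩
  have h1 : (1 + ‖x - a‖) ^ n ≤ (1 + ‖x‖) ^ n * (1 + ‖a‖) ^ n := by
    rw [← mul_pow]
    gcongr
    nlinarith [norm_sub_le x a, norm_nonneg x, norm_nonneg a,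
      mul_nonneg (norm_nonneg x) (norm_nonneg a)]
  have h2 : ‖polyFun P (x - a)‖ ≤ C * (1 + ‖x‖) ^ n * (1 + ‖a‖) ^ n := by
    calc _ ≤ C * (1 + ‖x - a‖) ^ n := h _
      _ ≤ C * ((1 + ‖x‖) ^ n * (1 + ‖a‖) ^ n) := by gcongr
      _ = _ := by ring
  have h3 : ∀ y : Space N, (1 + ‖y‖ₑ) ^ n = ENNReal.ofReal ((1 + ‖y‖) ^ n) := fun y => by
    rw [ENNReal.ofReal_pow (by positivity), ENNReal.ofReal_add zero_le_one (norm_nonneg _),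
      ofReal_norm, ENNReal.ofReal_one]
  rw [h3, h3, ← ENNReal.ofReal_mul hC, ← ENNReal.ofReal_mul (by positivity), ← ofReal_norm]
  exact ENNReal.ofReal_le_ofReal h2

theorem exists_moderateGrowth_polyFun (P : MvPolynomial (Fin N) ℂ) :
    ∃ n : ℕ, ModerateGrowth n (polyFun P) := by
  obtain ⟨C, n, hC, h⟩ := exists_enorm_polyFun_sub_le P
  refine ⟨n, fun g => ⟨C * ∫⁻ x, ‖g x‖ₑ * (1 + ‖x‖ₑ) ^ n,
    ENNReal.mul_ne_top hC (lintegral_schwartz_moment_ne_top g n), fun a => ?_⟩⟩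
  rw [← lintegral_comp_sub_mul (fun x => ‖polyFun P x‖ₑ) (fun x => ‖g x‖ₑ) a,
    ← lintegral_const_mul' _ _ hC, ← lintegral_mul_const' _ _ (ENNReal.pow_ne_top (by simp))]
  refine lintegral_mono fun x => ?_
  calc _ ≤ C * (1 + ‖x‖ₑ) ^ n * (1 + ‖a‖ₑ) ^ n * ‖g x‖ₑ := by gcongr; exact h x a
    _ = _ := by ring

/-- An average of translates of a polynomial, with a weight that has all moments, is a polynomial.
Multiplication by a coordinate is absorbed into the weight, which is therefore arbitrary in the
induction. -/
theorem exists_polyFun_eq_average {Y : Type*} [MeasurableSpace Y] {ν : Measure Y}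
    {a : Y → Space N} (ha : Measurable a) (P : MvPolynomial (Fin N) ℂ) :
    ∀ k : Y → ℂ, AEStronglyMeasurable k ν →
      (∀ n : ℕ, ∫⁻ y, ‖k y‖ₑ * (1 + ‖a y‖ₑ) ^ n ∂ν ≠ ∞) →
      ∃ R : MvPolynomial (Fin N) ℂ, ∀ x, ∫ y, k y * polyFun P (x - a y) ∂ν = polyFun R x := by
  have hint : ∀ (P : MvPolynomial (Fin N) ℂ) (k : Y → ℂ), AEStronglyMeasurable k ν →
      (∀ n : ℕ, ∫⁻ y, ‖k y‖ₑ * (1 + ‖a y‖ₑ) ^ n ∂ν ≠ ∞) → ∀ x,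
      Integrable (fun y => k y * polyFun P (x - a y)) ν := by
    intro P k hk hmom x
    obtain ⟨C, n, hC, h⟩ := exists_enorm_polyFun_sub_le P
    refine ⟨hk.mul ((continuous_polyFun P).measurable.comp
      (measurable_const.sub ha)).aestronglyMeasurable, ?_⟩
    rw [hasFiniteIntegral_iff_enorm]
    have hCx : C * (1 + ‖x‖ₑ) ^ n ≠ ∞ := ENNReal.mul_ne_top hC (ENNReal.pow_ne_top (by simp))
    calc _ ≤ ∫⁻ y, C * (1 + ‖x‖ₑ) ^ n * (‖k y‖ₑ * (1 + ‖a y‖ₑ) ^ n) ∂ν := by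
          refine lintegral_mono fun y => ?_
          rw [enorm_mul]
          calc _ ≤ ‖k y‖ₑ * (C * (1 + ‖x‖ₑ) ^ n * (1 + ‖a y‖ₑ) ^ n) := by gcongr; exact h _ _
            _ = _ := by ring
      _ = C * (1 + ‖x‖ₑ) ^ n * ∫⁻ y, ‖k y‖ₑ * (1 + ‖a y‖ₑ) ^ n ∂ν :=
          lintegral_const_mul' _ _ hCx
      _ < ∞ := ENNReal.mul_lt_top hCx.lt_top (hmom n).lt_top
  induction P using MvPolynomial.induction_on with
  | C c =>
    intro k _ _
    refine ⟨MvPolynomial.C ((∫ y, k y ∂ν) * c), fun x => ?_⟩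
    simp only [polyFun, MvPolynomial.eval_C]
    rw [integral_mul_const]
  | add P Q hP hQ =>
    intro k hk hmom
    obtain ⟨R, hR⟩ := hP k hk hmom
    obtain ⟨S, hS⟩ := hQ k hk hmom
    refine ⟨R + S, fun x => ?_⟩
    have e : ∀ (P Q : MvPolynomial (Fin N) ℂ) y, polyFun (P + Q) y = polyFun P y + polyFun Q y :=
      fun P Q y => map_add _ _ _
    simp only [e, mul_add]
    rw [integral_add (hint P k hk hmom x) (hint Q k hk hmom x), hR, hS]
  | mul_X P i hP =>
    intro k hk hmom
    set k' : Y → ℂ := fun y => k y * ((a y i : ℝ) : ℂ) with hk'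
    have hai : Measurable fun y => ((a y i : ℝ) : ℂ) := by
      have : Continuous fun x : Space N => ((x i : ℝ) : ℂ) := by fun_prop
      exact this.measurable.comp ha
    have hk'm : AEStronglyMeasurable k' ν := hk.mul hai.aestronglyMeasurable
    have hmom' : ∀ n : ℕ, ∫⁻ y, ‖k' y‖ₑ * (1 + ‖a y‖ₑ) ^ n ∂ν ≠ ∞ := fun n => by
      refine ne_top_of_le_ne_top (hmom (n + 1)) (lintegral_mono fun y => ?_)
      rw [hk', enorm_mul, pow_succ]
      have h1 : ‖((a y i : ℝ) : ℂ)‖ₑ ≤ 1 + ‖a y‖ₑ := by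
        refine le_trans ?_ le_add_self
        rw [enorm_le_iff_norm_le, Complex.norm_real]
        exact PiLp.norm_apply_le (a y) i
      calc _ ≤ ‖k y‖ₑ * (1 + ‖a y‖ₑ) * (1 + ‖a y‖ₑ) ^ n := by gcongr
        _ = _ := by ring
    obtain ⟨R, hR⟩ := hP k hk hmom
    obtain ⟨S, hS⟩ := hP k' hk'm hmom'
    refine ⟨R * MvPolynomial.X i - S, fun x => ?_⟩
    have e : ∀ y, k y * polyFun (P * MvPolynomial.X i) (x - a y) =
        (k y * polyFun P (x - a y)) * ((x i : ℝ) : ℂ) - k' y * polyFun P (x - a y) := by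
      intro y
      simp only [polyFun, map_mul, MvPolynomial.eval_X, hk', PiLp.sub_apply]
      push_cast
      ring
    simp only [e]
    rw [integral_sub ((hint P k hk hmom x).mul_const _) (hint P k' hk'm hmom' x),
      integral_mul_const, hR, hS]
    simp [polyFun]

variable {w : ℝ → ℝ} {k : ℕ}

theorem IsWeight.lintegral_moment_ne_top (hw : IsWeight w k) {s : ℝ} (hs : 0 ≤ s) (n : ℕ) :
    ∫⁻ θ in Ioi 0, ‖w θ‖ₑ * (1 + ‖√(s * θ)‖ₑ) ^ n ≠ ∞ := by
  have hfin := ((hw.integrableOn_moment n).const_mul ((2 + s) ^ n)).lintegral_lt_top.ne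
  refine ne_top_of_le_ne_top hfin (setLIntegral_mono' measurableSet_Ioi fun θ hθ => ?_)
  have hθ0 : (0 : ℝ) < θ := hθ
  have e : ‖w θ‖ₑ * (1 + ‖√(s * θ)‖ₑ) ^ n = ENNReal.ofReal (|w θ| * (1 + √(s * θ)) ^ n) := by
    rw [ENNReal.ofReal_mul (abs_nonneg _), ENNReal.ofReal_pow (by positivity),
      ENNReal.ofReal_add zero_le_one (Real.sqrt_nonneg _), ENNReal.ofReal_one,
      ← Real.norm_eq_abs, ofReal_norm, ← Real.norm_of_nonneg (Real.sqrt_nonneg (s * θ)),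
      ofReal_norm, Real.norm_of_nonneg (Real.sqrt_nonneg (s * θ))]
  rw [e]
  refine ENNReal.ofReal_le_ofReal ?_
  have h0 : 0 ≤ s * θ := by positivity
  have h1 : 1 + √(s * θ) ≤ (2 + s) * (1 + θ) := by
    have : √(s * θ) ≤ 1 + s * θ := Real.sqrt_le_iff.2 ⟨by positivity, by nlinarith⟩
    nlinarith
  calc |w θ| * (1 + √(s * θ)) ^ n ≤ |w θ| * ((2 + s) * (1 + θ)) ^ n := by gcongr
    _ = _ := by rw [mul_pow]; ring

theorem exists_dilAverage_polyFun_eq (B : 𝓢(Space N, ℂ)) {ω ρ : ℝ → ℝ}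
    (hω : AEStronglyMeasurable ω (volume.restrict (Ioi 0))) (hρ : Measurable ρ)
    (hωρ : ∀ n : ℕ, ∫⁻ θ in Ioi 0, ‖ω θ‖ₑ * (1 + ‖ρ θ‖ₑ) ^ n ≠ ∞) (P : MvPolynomial (Fin N) ℂ) :
    ∃ R : MvPolynomial (Fin N) ℂ, dilAverage ω ρ B (polyFun P) = polyFun R := by
  have ha : Measurable (fun z : ℝ × Space N => ρ z.1 • z.2) :=
    (hρ.comp measurable_fst).smul measurable_snd
  obtain ⟨R, hR⟩ := exists_polyFun_eq_average ha P
    (fun z : ℝ × Space N => (ω z.1 : ℂ) * B z.2) (aestronglyMeasurable_dilAverage_kernel B hω)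
    fun n => lintegral_dilAverage_kernel_ne_top B hω hρ (hωρ n)
  exact ⟨R, funext hR⟩

/-- The solution operators map polynomials to polynomials. -/
theorem IsDistIntegral.mem_polynomials (hw : IsWeight w k) {s : ℝ} (hs : 0 ≤ s) {v : Dist N}
    (hv : v ∈ polynomials N) :
    ∀ z, IsDistIntegral w (fun θ => heat (s * θ) v) z → z ∈ polynomials N := by
  have hex := fun u : Dist N =>
    hw.exists_isDistIntegral_of_le hw.aestronglyMeasurable (fun _ _ => le_rfl) hs u
  have hheat_add : ∀ τ (u u' : Dist N), heat τ (u + u') = heat τ u + heat τ u' :=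
    fun τ u u' => map_add _ _ _
  have hheat_smul : ∀ τ (c : ℂ) (u : Dist N), heat τ (c • u) = c • heat τ u :=
    fun τ c u => map_smul _ _ _
  refine Submodule.span_induction (p := fun v _ => ∀ z,
    IsDistIntegral w (fun θ => heat (s * θ) v) z → z ∈ polynomials N) ?_ ?_ ?_ ?_ hv
  · rintro v ⟨P, hP⟩ z hz
    obtain ⟨n, hn⟩ := exists_moderateGrowth_polyFun P
    have hρ : Measurable fun θ : ℝ => √(s * θ) := by fun_prop
    have hz' := hz.congr_on (w' := w) (U' := fun θ => dilMul (heatSymbol N) (√(s * θ)) v)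
      fun θ hθ g => by rw [heat_eq_dilMul (mul_nonneg hs hθ.le)]
    have hrep := represents_dilAverage (continuous_polyFun P).measurable.stronglyMeasurable hn hP
      (heatSymbol N) hw.aestronglyMeasurable hρ (hw.lintegral_moment_ne_top hs n) hz'
    obtain ⟨R, hR⟩ := exists_dilAverage_polyFun_eq (𝓕⁻ (heatSymbol N)) hw.aestronglyMeasurable hρ
      (hw.lintegral_moment_ne_top hs) P
    rw [hR] at hrep
    exact Submodule.subset_span ⟨R, hrep⟩
  · intro z hz
    have h0 : IsDistIntegral w (fun θ => heat (s * θ) (0 : Dist N)) 0 := by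
      intro g
      have e : ∀ τ, heat τ (0 : Dist N) g = 0 := fun τ => by
        rw [heat, BesovMorrey.multiplier, map_zero]; rfl
      simp only [e, mul_zero, integral_zero]
      exact ⟨integrableOn_zero, rfl⟩
    rw [hz.unique h0]
    exact Submodule.zero_mem _
  · intro u u' _ _ hu hu' z hz
    obtain ⟨y, hy⟩ := hex u
    obtain ⟨y', hy'⟩ := hex u'
    have h := hy.add hy'
    simp only [← hheat_add] at h
    rw [hz.unique h]
    exact Submodule.add_mem _ (hu y hy) (hu' y' hy')
  · intro c u _ hu z hz
    obtain ⟨y, hy⟩ := hex u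
    have h := hy.smul c
    simp only [← hheat_smul] at h
    rw [hz.unique h]
    exact Submodule.smul_mem _ c (hu y hy)

end Polynomials

/-! ### Sequence spaces -/

section Sequences

theorem lrNorm_mono {ι : Type} (r : ℝ≥0∞) {a b : ι → ℝ≥0∞} (h : ∀ i, a i ≤ b i) :
    lrNorm r a ≤ lrNorm r b := by
  unfold lrNorm
  split_ifs
  · exact iSup_mono h
  · exact ENNReal.rpow_le_rpow (ENNReal.tsum_le_tsum fun i =>
      ENNReal.rpow_le_rpow (h i) ENNReal.toReal_nonneg) (by positivity)

theorem lrNorm_const_mul {ι : Type} {r : ℝ≥0∞} (hr : 1 ≤ r) (c : ℝ≥0∞) (a : ι → ℝ≥0∞) :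
    lrNorm r (fun i => c * a i) = c * lrNorm r a := by
  unfold lrNorm
  split_ifs with h
  · rw [ENNReal.mul_iSup]
  · have hr0 : 0 < r.toReal := ENNReal.toReal_pos (one_pos.trans_le hr).ne' h
    simp only [ENNReal.mul_rpow_of_nonneg _ _ hr0.le]
    rw [ENNReal.tsum_mul_left, ENNReal.mul_rpow_of_nonneg _ _ (by positivity), ← ENNReal.rpow_mul,
      mul_one_div_cancel hr0.ne', ENNReal.rpow_one]

/-- The factor `λ^γ min (1, λ^{-κ})` by which the solution operators act on a block at the relative
frequency `λ = 4^j t^α`, when the gain of regularity is `2 γ`. -/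
def decayFactor (γ : ℝ) (κ : ℕ) (x : ℝ) : ℝ := x ^ γ * min 1 (x ^ κ)⁻¹

theorem decayFactor_nonneg (γ : ℝ) (κ : ℕ) {x : ℝ} (hx : 0 < x) : 0 ≤ decayFactor γ κ x := by
  unfold decayFactor; positivity

theorem decayFactor_le_rpow {γ : ℝ} {κ : ℕ} {x : ℝ} (hx : 0 < x) : decayFactor γ κ x ≤ x ^ γ :=
  mul_le_of_le_one_right (by positivity) (min_le_left _ _)

theorem decayFactor_le_rpow_sub {γ : ℝ} {κ : ℕ} {x : ℝ} (hx : 0 < x) :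
    decayFactor γ κ x ≤ x ^ (γ - κ) := by
  rw [Real.rpow_sub hx, Real.rpow_natCast, div_eq_mul_inv]
  exact mul_le_mul_of_nonneg_left (min_le_right _ _) (by positivity)

theorem decayFactor_le_one {γ : ℝ} {κ : ℕ} (h0 : 0 ≤ γ) (h1 : γ ≤ κ) {x : ℝ} (hx : 0 < x) :
    decayFactor γ κ x ≤ 1 := by
  rcases le_total x 1 with h | h
  · exact (decayFactor_le_rpow hx).trans (Real.rpow_le_one hx.le h h0)
  · exact (decayFactor_le_rpow_sub hx).trans
      (Real.rpow_le_one_of_one_le_of_nonpos h (sub_nonpos.2 h1))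

/-- For `0 < γ < κ` the factors are summable over the dyadic frequencies. Uniformity in `T` follows by
shifting the index by the integer part of `log₄ T`. -/
theorem exists_tsum_decayFactor_le {γ : ℝ} {κ : ℕ} (h0 : 0 < γ) (h1 : γ < κ) :
    ∃ C : ℝ, 0 < C ∧ ∀ T : ℝ, 0 < T →
      ∑' j : ℤ, ENNReal.ofReal (decayFactor γ κ (T * 4 ^ j)) ≤ ENNReal.ofReal C := by
  set Q : ℝ := max ((4 : ℝ) ^ (-γ)) ((4 : ℝ) ^ (γ - κ)) with hQ
  have hQ0 : 0 < Q := lt_max_of_lt_left (by positivity)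
  have hQ1 : Q < 1 := max_lt (Real.rpow_lt_one_of_one_lt_of_neg (by norm_num) (by linarith))
    (Real.rpow_lt_one_of_one_lt_of_neg (by norm_num) (by linarith))
  have hsum : Summable fun i : ℤ => (4 : ℝ) ^ γ * Q ^ i.natAbs := by
    refine Summable.mul_left _ (Summable.of_nat_of_neg ?_ ?_)
    · simpa using summable_geometric_of_lt_one hQ0.le hQ1
    · simpa using summable_geometric_of_lt_one hQ0.le hQ1
  refine ⟨∑' i : ℤ, (4 : ℝ) ^ γ * Q ^ i.natAbs,
    hsum.tsum_pos (fun i => by positivity) 0 (by positivity), fun T hT => ?_⟩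
  obtain ⟨m, hm1, hm2⟩ := exists_mem_Ico_zpow hT (by norm_num : (1 : ℝ) < 4)
  have hpt : ∀ j : ℤ, decayFactor γ κ (T * 4 ^ j) ≤ (4 : ℝ) ^ γ * Q ^ (j + m).natAbs := by
    intro j
    have hx : 0 < T * 4 ^ j := by positivity
    have hlow : (4 : ℝ) ^ (j + m) ≤ T * 4 ^ j := by
      rw [zpow_add₀ (by norm_num), mul_comm]; gcongr
    have hupp : T * 4 ^ j ≤ 4 * (4 : ℝ) ^ (j + m) := by
      rw [zpow_add₀ (by norm_num)]
      rw [zpow_add_one₀ (by norm_num)] at hm2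
      have : (0 : ℝ) < 4 ^ j := by positivity
      nlinarith
    rcases le_total 0 (j + m) with h | h
    · obtain ⟨n, hn⟩ := Int.eq_ofNat_of_zero_le h
      rw [hn] at hlow ⊢
      rw [zpow_natCast] at hlow
      have h41 : (1 : ℝ) ≤ 4 ^ γ := Real.one_le_rpow (by norm_num) h0.le
      calc _ ≤ (T * 4 ^ j) ^ (γ - κ) := decayFactor_le_rpow_sub hx
        _ ≤ ((4 : ℝ) ^ n) ^ (γ - κ) :=
          Real.rpow_le_rpow_of_nonpos (by positivity) hlow (by linarith)
        _ = ((4 : ℝ) ^ (γ - κ)) ^ n := by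
          rw [← Real.rpow_natCast, ← Real.rpow_natCast, ← Real.rpow_mul (by norm_num),
            ← Real.rpow_mul (by norm_num), mul_comm]
        _ ≤ Q ^ n := by gcongr; exact le_max_right _ _
        _ ≤ 4 ^ γ * Q ^ n := le_mul_of_one_le_left (by positivity) h41
    · obtain ⟨n, hn⟩ := Int.eq_ofNat_of_zero_le (neg_nonneg.2 h)
      have hn' : j + m = -(n : ℤ) := by omega
      rw [hn'] at hupp ⊢
      rw [zpow_neg, zpow_natCast] at hupp
      calc _ ≤ (T * 4 ^ j) ^ γ := decayFactor_le_rpow hx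
        _ ≤ (4 * ((4 : ℝ) ^ n)⁻¹) ^ γ := by gcongr
        _ = 4 ^ γ * ((4 : ℝ) ^ (-γ)) ^ n := by
          rw [Real.mul_rpow (by norm_num) (by positivity), Real.inv_rpow (by positivity),
            Real.rpow_neg (by norm_num), inv_pow, ← Real.rpow_natCast, ← Real.rpow_natCast,
            ← Real.rpow_mul (by norm_num), ← Real.rpow_mul (by norm_num), mul_comm γ]
        _ ≤ 4 ^ γ * Q ^ n := by gcongr; exact le_max_left _ _
        _ = _ := by simp
  rw [ENNReal.ofReal_tsum_of_nonneg (fun i => by positivity) hsum,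
    ← (Equiv.addRight m).tsum_eq fun i : ℤ => ENNReal.ofReal ((4 : ℝ) ^ γ * Q ^ i.natAbs)]
  exact ENNReal.tsum_le_tsum fun j => ENNReal.ofReal_le_ofReal (hpt j)

/-- The sequence of factors `decayFactor γ κ (4^j T)` multiplies `l^r` into `l^{r'}`, uniformly in
`T > 0` and over all families of distinct frequencies. -/
def DecayMultiplies (γ : ℝ) (κ : ℕ) (r r' : ℝ≥0∞) : Prop :=
  ∃ C : ℝ, 0 < C ∧ ∀ T : ℝ, 0 < T → ∀ (ι : Type) (e : ι → ℤ), Function.Injective e →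
    ∀ a b : ι → ℝ≥0∞, (∀ i, b i ≤ ENNReal.ofReal (decayFactor γ κ (T * 4 ^ e i)) * a i) →
      lrNorm r' b ≤ ENNReal.ofReal C * lrNorm r a

theorem decayMultiplies_self {γ : ℝ} {κ : ℕ} (h0 : 0 ≤ γ) (h1 : γ ≤ κ) (r : ℝ≥0∞) :
    DecayMultiplies γ κ r r := by
  refine ⟨1, one_pos, fun T hT ι e _ a b hab => ?_⟩
  rw [ENNReal.ofReal_one, one_mul]
  refine lrNorm_mono r fun i => (hab i).trans (mul_le_of_le_one_left' ?_)
  rw [ENNReal.ofReal_le_one]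
  exact decayFactor_le_one h0 h1 (by positivity)

theorem decayMultiplies_top_one {γ : ℝ} {κ : ℕ} (h0 : 0 < γ) (h1 : γ < κ) :
    DecayMultiplies γ κ ∞ 1 := by
  obtain ⟨C, hC, h⟩ := exists_tsum_decayFactor_le h0 h1
  refine ⟨C, hC, fun T hT ι e he a b hab => ?_⟩
  simp only [lrNorm, ENNReal.one_ne_top, if_false, if_true, ENNReal.toReal_one, ENNReal.rpow_one,
    div_one]
  calc ∑' i, b i ≤ ∑' i, ENNReal.ofReal (decayFactor γ κ (T * 4 ^ e i)) * ⨆ i, a i :=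
        ENNReal.tsum_le_tsum fun i => (hab i).trans (by gcongr; exact le_iSup a i)
    _ = (∑' i, ENNReal.ofReal (decayFactor γ κ (T * 4 ^ e i))) * ⨆ i, a i :=
        ENNReal.tsum_mul_right
    _ ≤ (∑' j : ℤ, ENNReal.ofReal (decayFactor γ κ (T * 4 ^ j))) * ⨆ i, a i := by
        gcongr
        exact ENNReal.tsum_comp_le_tsum_of_injective he
          fun j : ℤ => ENNReal.ofReal (decayFactor γ κ (T * 4 ^ j))
    _ ≤ _ := by gcongr; exact h T hT

end Sequences

/-! ### Besov-Morrey estimates -/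

section Estimates

variable {N : ℕ} {ζ : ℝ → ℝ} {w : ℝ → ℝ} {k : ℕ} {s σ : ℝ}

/-- The gain `2^{j(σ-s)}` in the weight of the `j`-th block is absorbed by the decay of the operators
on that block, up to the factor `T^{-(σ-s)/2}`. -/
theorem weighted_block_le {κ : ℕ} {C T : ℝ} (hC : 0 < C) (hT : 0 < T) (j : ℤ) {x y : ℝ≥0∞}
    (h : y ≤ ENNReal.ofReal (C * min 1 ((T * 4 ^ j) ^ κ)⁻¹) * x) :
    ENNReal.ofReal ((2 : ℝ) ^ ((j : ℝ) * σ)) * y ≤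
      ENNReal.ofReal (decayFactor ((σ - s) / 2) κ (T * 4 ^ j)) *
        (ENNReal.ofReal (C * T ^ ((s - σ) / 2)) *
          (ENNReal.ofReal ((2 : ℝ) ^ ((j : ℝ) * s)) * x)) := by
  refine (mul_le_mul_right h _).trans (le_of_eq ?_)
  have hx : 0 < T * (4 : ℝ) ^ j := by positivity
  have h4 : ((4 : ℝ) ^ j) ^ ((σ - s) / 2) = (2 : ℝ) ^ ((j : ℝ) * (σ - s)) := by
    rw [show (4 : ℝ) = 2 ^ (2 : ℝ) by norm_num, ← Real.rpow_intCast, ← Real.rpow_mul (by norm_num),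
      ← Real.rpow_mul (by norm_num)]
    congr 1; ring
  have hT1 : T ^ ((s - σ) / 2) * T ^ ((σ - s) / 2) = 1 := by
    rw [← Real.rpow_add hT, show (s - σ) / 2 + (σ - s) / 2 = 0 by ring, Real.rpow_zero]
  have h2 : (2 : ℝ) ^ ((j : ℝ) * σ) = 2 ^ ((j : ℝ) * (σ - s)) * 2 ^ ((j : ℝ) * s) := by
    rw [← Real.rpow_add two_pos]; ring_nf
  rw [← mul_assoc, ← mul_assoc, ← mul_assoc, ← ENNReal.ofReal_mul (by positivity),
    ← ENNReal.ofReal_mul (decayFactor_nonneg _ _ hx),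
    ← ENNReal.ofReal_mul (mul_nonneg (decayFactor_nonneg _ _ hx) (by positivity))]
  congr 2
  rw [decayFactor, Real.mul_rpow hT.le (by positivity), h4, h2]
  linear_combination (-(2 : ℝ) ^ ((j : ℝ) * (σ - s)) * 2 ^ ((j : ℝ) * s) * C *
    min 1 ((T * 4 ^ j) ^ κ)⁻¹) * hT1

theorem exists_homBesovMorrey_le (hζ : IsCutoff ζ) (hw : IsWeight w k) (hk : k ≤ 1) {p q : ℝ}
    (hq : 1 ≤ q) {r r' : ℝ≥0∞} (hr : 1 ≤ r)
    (hdec : DecayMultiplies ((σ - s) / 2) (k + 1) r r') :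
    ∃ C : ℝ, 0 < C ∧ ∀ T : ℝ, 0 < T → ∀ u v : Dist N,
      IsDistIntegral w (fun θ => heat (T * θ) u) v →
      homBesovMorrey ζ σ p q r' v ≤
        ENNReal.ofReal (C * T ^ ((s - σ) / 2)) * homBesovMorrey ζ s p q r u := by
  obtain ⟨C, hC, hblock⟩ := exists_block_le (N := N) hζ hw hk
  obtain ⟨D, hD, hmul⟩ := hdec
  refine ⟨D * C, by positivity, fun T hT u v huv => ?_⟩
  unfold homBesovMorrey
  refine (hmul T hT ℤ id Function.injective_id _ _ fun j => weighted_block_le (s := s) hC hT j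
    (hblock (Ioi 0) (fun x hx => hx.1) p q hq T hT j u v huv)).trans ?_
  rw [lrNorm_const_mul hr, ← mul_assoc, ← ENNReal.ofReal_mul hD.le, ← mul_assoc]
  rfl

theorem exists_besovMorreyNorm_le (hζ : IsCutoff ζ) (hw : IsWeight w k) (hk : k ≤ 1) {p q : ℝ}
    (hq : 1 ≤ q) {r r' : ℝ≥0∞} (hr : 1 ≤ r)
    (hdec : DecayMultiplies ((σ - s) / 2) (k + 1) r r') :
    ∃ C : ℝ, 0 < C ∧ ∀ T : ℝ, 0 < T → ∀ u v : Dist N,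
      IsDistIntegral w (fun θ => heat (T * θ) u) v →
      besovMorreyNorm ζ σ p q r' v ≤
        ENNReal.ofReal (C * (1 + T ^ ((s - σ) / 2))) * besovMorreyNorm ζ s p q r u := by
  obtain ⟨C₀, hC₀, hlow⟩ := exists_low_block_le (N := N) hζ hw
  obtain ⟨C, hC, hblock⟩ := exists_block_le (N := N) hζ hw hk
  obtain ⟨D, hD, hmul⟩ := hdec
  refine ⟨C₀ + D * C, by positivity, fun T hT u v huv => ?_⟩
  have hTp : 0 < T ^ ((s - σ) / 2) := by positivity
  have hhigh : lrNorm r' (fun k : ℕ => ENNReal.ofReal ((2 : ℝ) ^ (σ * ((k : ℝ) + 1))) *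
      locMorreyNorm p q (multiplier (phi ζ ((k : ℤ) + 1)) v)) ≤
      ENNReal.ofReal (D * C * T ^ ((s - σ) / 2)) *
        lrNorm r (fun k : ℕ => ENNReal.ofReal ((2 : ℝ) ^ (s * ((k : ℝ) + 1))) *
          locMorreyNorm p q (multiplier (phi ζ ((k : ℤ) + 1)) u)) := by
    have hcast : ∀ (b : ℝ) (k : ℕ), b * ((k : ℝ) + 1) = (((k : ℤ) + 1 : ℤ) : ℝ) * b :=
      fun b k => by push_cast; ring
    simp only [hcast]
    refine (hmul T hT ℕ (fun k => (k : ℤ) + 1) (fun a b hab => by simpa using hab) _ _ fun i =>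
      weighted_block_le (s := s) hC hT ((i : ℤ) + 1)
        (hblock (Ioc 0 1) subset_rfl p q hq T hT ((i : ℤ) + 1) u v huv)).trans ?_
    rw [lrNorm_const_mul hr, ← mul_assoc, ← ENNReal.ofReal_mul hD.le, ← mul_assoc]
    rfl
  unfold besovMorreyNorm
  rw [mul_add]
  refine add_le_add ((hlow (Ioc 0 1) subset_rfl p q hq T hT u v huv).trans ?_) (hhigh.trans ?_)
  · refine mul_le_mul_left (ENNReal.ofReal_le_ofReal ?_) _
    nlinarith [mul_pos hD hC, mul_pos hC₀ hTp, mul_pos (mul_pos hD hC) hTp]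
  · refine mul_le_mul_left (ENNReal.ofReal_le_ofReal ?_) _
    nlinarith [mul_pos hD hC, mul_pos hC₀ hTp, mul_pos (mul_pos hD hC) hTp]

theorem IsWeight.exists_image (hw : IsWeight w k) {T : ℝ} (hT : 0 ≤ T) (u : Dist N) :
    ∃ v : Dist N, IsDistIntegral w (fun θ => heat (T * θ) u) v :=
  hw.exists_isDistIntegral_of_le hw.aestronglyMeasurable (fun _ _ => le_rfl) hT u

/-- The solution operators act on classes modulo polynomials. -/
theorem IsWeight.onClasses (hw : IsWeight w k) {T : ℝ} (hT : 0 ≤ T) {u v : Dist N}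
    (huv : IsDistIntegral w (fun θ => heat (T * θ) u) v) :
    OnClasses (fun u v => IsDistIntegral w (fun θ => heat (T * θ) u) v) (modPoly u)
      (modPoly v) := by
  intro u' hu'
  obtain ⟨z, hz⟩ := hw.exists_image hT (u' - u)
  have hzp : z ∈ polynomials N :=
    hz.mem_polynomials hw hT ((Submodule.Quotient.eq _).1 hu') z
  refine ⟨v + z, ?_, ?_⟩
  · have h := huv.add hz
    have e : ∀ θ, heat (T * θ) u + heat (T * θ) (u' - u) = heat (T * θ) u' := fun θ => by
      have : heat (T * θ) (u + (u' - u)) = heat (T * θ) u + heat (T * θ) (u' - u) :=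
        map_add _ _ _
      rw [← this, add_sub_cancel]
    simpa only [e] using h
  · refine (Submodule.Quotient.eq _).2 ?_
    rwa [add_sub_cancel_left]

theorem rpow_rpow_half {t : ℝ} (ht : 0 < t) (α a : ℝ) : (t ^ α) ^ (a / 2) = t ^ (a * α / 2) := by
  rw [← Real.rpow_mul ht.le]; ring_nf

theorem IsWeight.exists_besovMorrey_estimate (hζ : IsCutoff ζ) (hw : IsWeight w k) (hk : k ≤ 1)
    (α : ℝ) {p q : ℝ} (hq : 1 ≤ q) {r r' : ℝ≥0∞} (hr : 1 ≤ r)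
    (hdec : DecayMultiplies ((σ - s) / 2) (k + 1) r r') :
    ∃ C : ℝ, 0 < C ∧ ∀ u : Dist N, MemN ζ s p q r u → ∀ t : ℝ, 0 < t →
      ∃ v : Dist N, IsDistIntegral w (fun θ => heat (t ^ α * θ) u) v ∧ MemN ζ σ p q r' v ∧
        besovMorreyNorm ζ σ p q r' v ≤
          ENNReal.ofReal (C * (1 + t ^ ((s - σ) * α / 2))) * besovMorreyNorm ζ s p q r u := by
  obtain ⟨C, hC, h⟩ := exists_besovMorreyNorm_le (N := N) (p := p) hζ hw hk hq hr hdec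
  refine ⟨C, hC, fun u hu t ht => ?_⟩
  have hT : 0 < t ^ α := by positivity
  obtain ⟨v, hv⟩ := hw.exists_image hT.le u
  have hle := h _ hT u v hv
  rw [rpow_rpow_half ht] at hle
  exact ⟨v, hv, hle.trans_lt (ENNReal.mul_lt_top ENNReal.ofReal_lt_top hu), hle⟩

theorem IsWeight.exists_homBesovMorrey_estimate (hζ : IsCutoff ζ) (hw : IsWeight w k) (hk : k ≤ 1)
    (α : ℝ) {p q : ℝ} (hq : 1 ≤ q) {r r' : ℝ≥0∞} (hr : 1 ≤ r)
    (hdec : DecayMultiplies ((σ - s) / 2) (k + 1) r r') :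
    ∃ C : ℝ, 0 < C ∧ ∀ x : DistModPoly N, MemH ζ s p q r x → ∀ t : ℝ, 0 < t →
      ∃ y : DistModPoly N,
        OnClasses (fun u v => IsDistIntegral w (fun θ => heat (t ^ α * θ) u) v) x y ∧
        MemH ζ σ p q r' y ∧ homBesovMorreyNorm ζ σ p q r' y ≤
          ENNReal.ofReal (C * t ^ ((s - σ) * α / 2)) * homBesovMorreyNorm ζ s p q r x := by
  obtain ⟨C, hC, h⟩ := exists_homBesovMorrey_le (N := N) (p := p) hζ hw hk hq hr hdec
  refine ⟨C, hC, fun x hx t ht => ?_⟩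
  have hT : 0 < t ^ α := by positivity
  obtain ⟨u₀, rfl⟩ := Submodule.Quotient.mk_surjective _ x
  obtain ⟨v₀, hv₀⟩ := hw.exists_image hT.le u₀
  have hcl := hw.onClasses hT.le hv₀
  have hle : homBesovMorreyNorm ζ σ p q r' (modPoly v₀) ≤
      ENNReal.ofReal (C * t ^ ((s - σ) * α / 2)) * homBesovMorreyNorm ζ s p q r (modPoly u₀) := by
    have h0 : ENNReal.ofReal (C * t ^ ((s - σ) * α / 2)) ≠ 0 := by
      rw [Ne, ENNReal.ofReal_eq_zero, not_le]; positivity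
    conv_rhs => unfold homBesovMorreyNorm
    simp only [ENNReal.mul_iInf_of_ne h0 ENNReal.ofReal_ne_top]
    refine le_iInf fun u => le_iInf fun hu => ?_
    obtain ⟨v, hv, hvy⟩ := hcl u hu
    have := h _ hT u v hv
    rw [rpow_rpow_half ht] at this
    exact (iInf₂_le v hvy).trans this
  exact ⟨modPoly v₀, hcl, hle.trans_lt (ENNReal.mul_lt_top ENNReal.ofReal_lt_top hx), hle⟩

end Estimates

end BesovMorrey

end

open BesovMorrey in
theorem lemma2 (N : ℕ) (hN : 1 ≤ N) (ζ : ℝ → ℝ) (hζ : IsCutoff ζ)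
    (α : ℝ) (hα0 : 0 < α) (hα1 : α < 1)
    (p q : ℝ) (hq : 1 ≤ q) (hqp : q ≤ p) (r : ℝ≥0∞) (hr : 1 ≤ r)
    (s σ : ℝ) (hsσ : s ≤ σ) :
    -- the operators `S_α(t)`
    (σ - s < 4 →
      -- inhomogeneous spaces
      (∃ C : ℝ, 0 < C ∧ ∀ u : Dist N, MemN ζ s p q r u → ∀ t : ℝ, 0 < t →
        ∃ v : Dist N, IsS α t u v ∧ MemN ζ σ p q r v ∧
          besovMorreyNorm ζ σ p q r v ≤
            ENNReal.ofReal (C * (1 + t ^ ((s - σ) * α / 2))) * besovMorreyNorm ζ s p q r u) ∧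
      (s < σ → ∃ C : ℝ, 0 < C ∧ ∀ u : Dist N, MemN ζ s p q ∞ u → ∀ t : ℝ, 0 < t →
        ∃ v : Dist N, IsS α t u v ∧ MemN ζ σ p q 1 v ∧
          besovMorreyNorm ζ σ p q 1 v ≤
            ENNReal.ofReal (C * (1 + t ^ ((s - σ) * α / 2))) * besovMorreyNorm ζ s p q ∞ u) ∧
      -- homogeneous spaces
      (∃ C : ℝ, 0 < C ∧ ∀ x : DistModPoly N, MemH ζ s p q r x → ∀ t : ℝ, 0 < t →
        ∃ y : DistModPoly N, OnClasses (IsS α t) x y ∧ MemH ζ σ p q r y ∧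
          homBesovMorreyNorm ζ σ p q r y ≤
            ENNReal.ofReal (C * t ^ ((s - σ) * α / 2)) * homBesovMorreyNorm ζ s p q r x) ∧
      (s < σ → ∃ C : ℝ, 0 < C ∧ ∀ x : DistModPoly N, MemH ζ s p q ∞ x → ∀ t : ℝ, 0 < t →
        ∃ y : DistModPoly N, OnClasses (IsS α t) x y ∧ MemH ζ σ p q 1 y ∧
          homBesovMorreyNorm ζ σ p q 1 y ≤
            ENNReal.ofReal (C * t ^ ((s - σ) * α / 2)) * homBesovMorreyNorm ζ s p q ∞ x)) ∧
    -- the operators `P_α(t)`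
    (σ - s < 2 →
      -- inhomogeneous spaces
      (∃ C : ℝ, 0 < C ∧ ∀ u : Dist N, MemN ζ s p q r u → ∀ t : ℝ, 0 < t →
        ∃ v : Dist N, IsP α t u v ∧ MemN ζ σ p q r v ∧
          besovMorreyNorm ζ σ p q r v ≤
            ENNReal.ofReal (C * (1 + t ^ ((s - σ) * α / 2))) * besovMorreyNorm ζ s p q r u) ∧
      (s < σ → ∃ C : ℝ, 0 < C ∧ ∀ u : Dist N, MemN ζ s p q ∞ u → ∀ t : ℝ, 0 < t →
        ∃ v : Dist N, IsP α t u v ∧ MemN ζ σ p q 1 v ∧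
          besovMorreyNorm ζ σ p q 1 v ≤
            ENNReal.ofReal (C * (1 + t ^ ((s - σ) * α / 2))) * besovMorreyNorm ζ s p q ∞ u) ∧
      -- homogeneous spaces
      (∃ C : ℝ, 0 < C ∧ ∀ x : DistModPoly N, MemH ζ s p q r x → ∀ t : ℝ, 0 < t →
        ∃ y : DistModPoly N, OnClasses (IsP α t) x y ∧ MemH ζ σ p q r y ∧
          homBesovMorreyNorm ζ σ p q r y ≤
            ENNReal.ofReal (C * t ^ ((s - σ) * α / 2)) * homBesovMorreyNorm ζ s p q r x) ∧
      (s < σ → ∃ C : ℝ, 0 < C ∧ ∀ x : DistModPoly N, MemH ζ s p q ∞ x → ∀ t : ℝ, 0 < t →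
        ∃ y : DistModPoly N, OnClasses (IsP α t) x y ∧ MemH ζ σ p q 1 y ∧
          homBesovMorreyNorm ζ σ p q 1 y ≤
            ENNReal.ofReal (C * t ^ ((s - σ) * α / 2)) * homBesovMorreyNorm ζ s p q ∞ x)) := by
  have hγ : 0 ≤ (σ - s) / 2 := by linarith
  have hS := isWeight_mul_wright hα0 hα1
  have hP := isWeight_wright hα0 hα1
  refine ⟨fun h => ?_, fun h => ?_⟩
  · have hself : DecayMultiplies ((σ - s) / 2) (1 + 1) r r :=
      decayMultiplies_self hγ (by push_cast; linarith) r
    have htop : s < σ → DecayMultiplies ((σ - s) / 2) (1 + 1) ∞ 1 := fun hs =>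
      decayMultiplies_top_one (by linarith) (by push_cast; linarith)
    exact ⟨hS.exists_besovMorrey_estimate hζ le_rfl α hq hr hself,
      fun hs => hS.exists_besovMorrey_estimate hζ le_rfl α hq le_top (htop hs),
      hS.exists_homBesovMorrey_estimate hζ le_rfl α hq hr hself,
      fun hs => hS.exists_homBesovMorrey_estimate hζ le_rfl α hq le_top (htop hs)⟩
  · have hself : DecayMultiplies ((σ - s) / 2) (0 + 1) r r :=
      decayMultiplies_self hγ (by push_cast; linarith) r
    have htop : s < σ → DecayMultiplies ((σ - s) / 2) (0 + 1) ∞ 1 := fun hs =>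
      decayMultiplies_top_one (by linarith) (by push_cast; linarith)
    exact ⟨hP.exists_besovMorrey_estimate hζ zero_le_one α hq hr hself,
      fun hs => hP.exists_besovMorrey_estimate hζ zero_le_one α hq le_top (htop hs),
      hP.exists_homBesovMorrey_estimate hζ zero_le_one α hq hr hself,
      fun hs => hP.exists_homBesovMorrey_estimate hζ zero_le_one α hq le_top (htop hs)⟩
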